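/- **Setting.** Consider an episodic MDP with finite state space $\mathcal S$ of size $S$, finite action space $\mathcal A$ of size $A\ge 1$, horizon $H\ge 1$, initial distribution $p_0$, step-dependent transitions $\mathbb P_h(\cdot\mid s,a)$ and random rewards $r_h\in[0,1]$ with law depending on $(h,s,a)$, for $h=0,\dots,H-1$. Policies are randomized and Markov, $\pi=(\pi_h)_h$; $V^\pi_h$ is the value function and $d^\pi_h(s)$ the probability that $\pi$ is in state $s$ at step $h$. Let $\pi^\star$ be an optimal policy, and let the guide-policy $\pi^g$ and the number $C$ satisfy $d^{\pi^\star}_h(s)\le C\,d^{\pi^g}_h(s)$ for all $s$ and all $h<H$. **JSRL.** Given $T\ge 1$, put $n=\lceil T/H\rceil$ and start with $\pi=\pi^g$. For $h=H-1,H-2,\dots,0$: run a contextual-bandit algorithm (the oracle) for $n$ rounds; in each round, roll out a trajectory of $\pi$ with $\pi_h$ replaced by the policy $\pi^t:\mathcal S\to\Delta(\mathcal A)$ that the oracle chooses for that round, and return to the oracle the context-action-reward sample $(s_h,a_h,\sum_{l=h}^{H-1}r_l)$, whose reward lies in $[0,H-h]$; after the $n$ rounds set $\pi_h$ to the uniform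 mixture of the policies executed in these rounds. The final $\pi$ is the output $\hat\pi$. **Oracles.** Let $N$ be a positive integer, the number of contexts for which the oracle is tuned. An empirical mean over an empty set of observations is $0$, and ties in an argmax are broken by a fixed rule that depends only on the set of maximizers. * *Tabular $\varepsilon$-greedy.* Let $\varepsilon=\min\{1,(NA/n)^{1/3}\}$. In context $s$, play a uniformly random action with probability $\varepsilon$, and otherwise the action whose empirical mean reward in context $s$, over all earlier rounds of this run of the oracle, is largest. * *Tabular FALCON+*, for rewards in $[0,R]$ (so $R=H-h$ at iteration $h$ of JSRL). Number the rounds $0,1,2,\dots$; let $\tau_0=0$ and $\tau_m=2^m$ for $m\ge1$, and let epoch $m\ge 1$ consist of the rounds $t$ with $\tau_{m-1}\le t<\tau_m$. In epoch $m$ let $\hat f_m(s,a)$ be the empirical mean of the rewards of $a$ in context $s$ over the rounds of epoch $m-1$ alone ($\hat f_1=0$), let $\gamma_1=1$ and, for $m\ge 2$, $\gamma_m=\frac12\sqrt{A/\mathcal E(\tau_{m-1}-\tau_{m-2})}$ with $\mathcal E(\ell)=R^2NA/\ell$. In context $s$, with $\hat a$ maximizing $\hat f_m(s,\cdot)$,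 play each $a\ne\hat a$ with probability $1/\big(A+\gamma_m(\hat f_m(s,\hat a)-\hat f_m(s,a))\big)$, and $\hat a$ with the remaining probability. **Claim.** There is an absolute constant $K>0$ such that for all MDPs, $H$, $T$, $\pi^g$, $\pi^\star$, $C$ as above, and every $N\ge \max_{h<H}\#\{s: d^{\pi^g}_h(s)>0\}$, in expectation over the run of JSRL, $$\mathbb E\Big[\mathbb E_{s_0\sim p_0}\big[V^{\pi^\star}_0(s_0)-V^{\hat\pi}_0(s_0)\big]\Big]\le K\,\frac{C\,H^{7/3}N^{1/3}A^{1/3}}{T^{1/3}}$$ if the oracle is tabular $\varepsilon$-greedy tuned for $N$ contexts, and $$\mathbb E\Big[\mathbb E_{s_0\sim p_0}\big[V^{\pi^\star}_0(s_0)-V^{\hat\pi}_0(s_0)\big]\Big]\le K\,\frac{C\,H^{5/2}N^{1/2}A}{T^{1/2}}$$ if it is tabular FALCON+ tuned for $N$ contexts. In particular one may take $N=S$, or $N$ equal to the maximum over the steps of the number of states that $\pi^g$ visits with positive probability. -/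

import Mathlib

namespace JSRL

noncomputable section

open MeasureTheory

variable {S A : Type*} [Fintype S] [Fintype A]

/-! ### Tabular episodic MDPs -/

/-- A time-inhomogeneous MDP with finite state space `S` and finite action space `A`. Steps are
numbered `0, 1, 2, …`; with horizon `H` only the data of the steps `h < H` matter. The reward of
step `h` is random, with a law `reward h s a` supported in `[0, 1]`. -/
structure MDP (S A : Type*) [Fintype S] [Fintype A] where
  init : stdSimplex ℝ S
  trans : ℕ → S → A → stdSimplex ℝ S
  reward : ℕ → S → A → Measure ℝ
  isProbabilityMeasure_reward : ∀ h s a, IsProbabilityMeasure (reward h s a)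
  reward_mem_Icc : ∀ h s a, ∀ᵐ x ∂(reward h s a), x ∈ Set.Icc (0 : ℝ) 1

/-- A (randomized, Markov, non-stationary) policy: `π h s a` is the probability of playing `a` in
state `s` at step `h`. -/
abbrev Policy (S A : Type*) [Fintype A] : Type _ := ℕ → S → stdSimplex ℝ A

/-- `M.valueToGo π k h s`: expected sum of the rewards of the `k` steps `h, …, h + k - 1` when
the state at step `h` is `s` and `π` is followed. -/
def MDP.valueToGo (M : MDP S A) (π : Policy S A) : ℕ → ℕ → S → ℝ
  | 0, _, _ => 0
  | k + 1, h, s => ∑ a, π h s a *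
      ((∫ x, x ∂(M.reward h s a)) + ∑ s', M.trans h s a s' * M.valueToGo π k (h + 1) s')

/-- The value function `V_h^π` for horizon `H`. -/
def MDP.value (M : MDP S A) (H : ℕ) (π : Policy S A) (h : ℕ) (s : S) : ℝ :=
  M.valueToGo π (H - h) h s

/-- `E_{s₀ ∼ p₀} V_0^π(s₀)`. -/
def MDP.initValue (M : MDP S A) (H : ℕ) (π : Policy S A) : ℝ :=
  ∑ s, M.init s * M.value H π 0 s

/-- `π` is an optimal policy for horizon `H`. -/
def MDP.IsOptimal (M : MDP S A) (H : ℕ) (π : Policy S A) : Prop :=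
  ∀ π' : Policy S A, M.initValue H π' ≤ M.initValue H π

/-- The state occupancy distribution `d_h^π(s)`. -/
def MDP.occupancy (M : MDP S A) (π : Policy S A) : ℕ → S → ℝ
  | 0, s => M.init s
  | h + 1, s' => ∑ s, ∑ a, M.occupancy π h s * π h s a * M.trans h s a s'

open Classical in
/-- The maximum over the steps `h < H` of the number of states that `π` visits with positive
probability at step `h`. -/
def MDP.maxVisited (M : MDP S A) (H : ℕ) (π : Policy S A) : ℕ :=
  (Finset.range H).sup fun h => (Finset.univ.filter fun s => 0 < M.occupancy π h s).card

theorem MDP.maxVisited_le_card (M : MDP S A) (H : ℕ) (π : Policy S A) :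
    M.maxVisited H π ≤ Fintype.card S :=
  Finset.sup_le fun _ _ => Finset.card_le_univ _

/-! ### Laws of trajectories -/

/-- The mixture `∑ i, w i • μ i` of measures: draw `i ∼ w`, then draw from `μ i`. -/
def mix {ι β : Type*} [Fintype ι] [MeasurableSpace β] (w : stdSimplex ℝ ι) (μ : ι → Measure β) :
    Measure β :=
  ∑ i, ENNReal.ofReal (w i) • μ i

section Laws

variable [MeasurableSpace S] [MeasurableSpace A]

/-- Law of the state-action-reward triples of the `k` steps `h, …, h + k - 1`, when the state at
step `h` is `s` and `π` is followed: draw the action, the reward and the next state, and go on. -/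
def MDP.tailLaw (M : MDP S A) (π : Policy S A) :
    (k : ℕ) → ℕ → S → Measure (Fin k → S × A × ℝ)
  | 0, _, _ => Measure.dirac Fin.elim0
  | k + 1, h, s => mix (π h s) fun a => (M.reward h s a).bind fun r =>
      mix (M.trans h s a) fun s' =>
        (M.tailLaw π k (h + 1) s').map (Fin.cons (α := fun _ => S × A × ℝ) (s, a, r))

/-- Law of a full trajectory `(s_l, a_l, r_l)_{l < H}` of the policy `π`. -/
def MDP.rollout (M : MDP S A) (H : ℕ) (π : Policy S A) : Measure (Fin H → S × A × ℝ) :=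
  mix M.init fun s => M.tailLaw π H 0 s

/-- The contextual-bandit sample `(s_h, a_h, ∑_{l ≥ h} r_l)` read off a trajectory. -/
def cbSample {H : ℕ} (h : Fin H) (τ : Fin H → S × A × ℝ) : S × A × ℝ :=
  ((τ h).1, (τ h).2.1, ∑ l ∈ Finset.Ici h, (τ l).2.2)

/-! ### Contextual-bandit algorithms and JSRL -/

/-- A contextual-bandit algorithm: in round `t` (rounds are numbered `0, 1, …`) the context-action-
reward triples of the earlier rounds determine the policy `S → Δ(A)` executed in round `t`. -/
abbrev CBAlgorithm (S A : Type*) [Fintype A] : Type _ :=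
  (t : ℕ) → (Fin t → S × A × ℝ) → S → stdSimplex ℝ A

/-- Law of the first `t` contextual-bandit samples collected at iteration `h` of JSRL, the current
policy being `π`. In each round a trajectory is rolled out with `π`, except that at step `h` the
policy chosen by the contextual-bandit algorithm for that round is executed. -/
def MDP.cbHistory (M : MDP S A) {H : ℕ} (alg : CBAlgorithm S A) (h : Fin H) (π : Policy S A) :
    (t : ℕ) → Measure (Fin t → S × A × ℝ)
  | 0 => Measure.dirac Fin.elim0
  | t + 1 => (M.cbHistory alg h π t).bind fun x =>
      ((M.rollout H (Function.update π h (alg t x))).map (cbSample h)).map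
        (Fin.snoc (α := fun _ => S × A × ℝ) x)

/-- `Unif({π^0, …, π^{n-1}})`, the uniform mixture of the policies executed in the `n` rounds with
samples `x` (for `n = 0`, where there is no such mixture, the value is `fallback`). -/
def averagePolicy (alg : CBAlgorithm S A) (n : ℕ) (x : Fin n → S × A × ℝ)
    (fallback : S → stdSimplex ℝ A) (s : S) : stdSimplex ℝ A :=
  if hn : 0 < n then
    ⟨fun a => (∑ t : Fin n, alg t (fun i => x (Fin.castLE t.is_lt.le i)) s a) / n, by
      have hn' : (0 : ℝ) < n := by exact_mod_cast hn
      refine ⟨fun a => div_nonneg (Finset.sum_nonneg fun t _ => ?_) hn'.le, ?_⟩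
      · exact (alg t (fun i => x (Fin.castLE t.is_lt.le i)) s).2.1 a
      · rw [← Finset.sum_div, Finset.sum_comm]
        have h1 : ∀ t : Fin n, ∑ a, alg t (fun i => x (Fin.castLE t.is_lt.le i)) s a = 1 :=
          fun t => (alg t (fun i => x (Fin.castLE t.is_lt.le i)) s).2.2
        simp [h1, hn'.ne']⟩
  else fallback s

/-- One iteration of JSRL with current policy `π`: law of the policy in which `π_h` is replaced by
the uniform mixture of the policies that `alg` executed in its `n` rounds. -/
def MDP.jsrlIteration (M : MDP S A) {H : ℕ} (alg : CBAlgorithm S A) (n : ℕ) (h : Fin H)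
    (π : Policy S A) : Measure (Policy S A) :=
  (M.cbHistory alg h π n).map fun x => Function.update π h (averagePolicy alg n x (π h))

/-- The iterations `h - 1, h - 2, …, 0` of JSRL, started with the current policy `π`. The oracle is
told the range of the bandit rewards, which is `[0, H - h]` at iteration `h`. -/
def MDP.jsrlFrom (M : MDP S A) (H : ℕ) (oracle : ℝ → CBAlgorithm S A) (n : ℕ) :
    (h : ℕ) → h ≤ H → Policy S A → Measure (Policy S A)
  | 0, _, π => Measure.dirac π
  | h + 1, hh, π =>
      (M.jsrlIteration (oracle ((H : ℝ) - h)) n (⟨h, hh⟩ : Fin H) π).bind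
        (M.jsrlFrom H oracle n h (Nat.le_of_succ_le hh))

/-- Law of the policy returned by JSRL with guide-policy `πg`, horizon `H` and `n` rounds of the
contextual-bandit oracle in each of the iterations `h = H - 1, …, 0`. -/
def MDP.jsrl (M : MDP S A) (H : ℕ) (oracle : ℝ → CBAlgorithm S A) (n : ℕ) (πg : Policy S A) :
    Measure (Policy S A) :=
  M.jsrlFrom H oracle n H le_rfl πg

end Laws

/-- For a random policy with law `μ`, the expected suboptimality
`E_{π ∼ μ} E_{s₀ ∼ p₀} [V_0^{π⋆}(s₀) - V_0^π(s₀)]` (a well-defined expectation) is at most `b`. -/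
def MDP.SuboptimalityLE (M : MDP S A) (H : ℕ) (πstar : Policy S A) (μ : Measure (Policy S A))
    (b : ℝ) : Prop :=
  IsProbabilityMeasure μ ∧
    Integrable (fun π => M.initValue H πstar - M.initValue H π) μ ∧
    ∫ π, (M.initValue H πstar - M.initValue H π) ∂μ ≤ b

/-- The number `⌈T / H⌉` of rounds in each iteration. -/
def rounds (T H : ℕ) : ℕ := ⌈(T : ℝ) / H⌉₊

/-! ### The two oracles -/

/-- The maximizers of `f`. -/
def argmaxSet (f : A → ℝ) : Finset A :=
  open Classical in Finset.univ.filter fun a => ∀ b, f b ≤ f a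

theorem argmaxSet_nonempty [Nonempty A] (f : A → ℝ) : (argmaxSet f).Nonempty := by
  obtain ⟨a, ha⟩ := Finite.exists_max f
  exact ⟨a, by simpa [argmaxSet] using ha⟩

/-- The greedy action for `f`. Ties are broken by an arbitrary rule that looks only at the set of
maximizers. -/
def greedy [Nonempty A] (f : A → ℝ) : A := (argmaxSet_nonempty f).choose

open Classical in
/-- Mean of the observed rewards of action `a` in context `s` over the rounds `lo ≤ i < hi`
(`0` if there was no such observation). -/
def empMean {t : ℕ} (x : Fin t → S × A × ℝ) (lo hi : ℕ) (s : S) (a : A) : ℝ :=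
  let I : Finset (Fin t) := Finset.univ.filter fun i =>
    lo ≤ (i : ℕ) ∧ (i : ℕ) < hi ∧ (x i).1 = s ∧ (x i).2.1 = a
  (∑ i ∈ I, (x i).2.2) / I.card

open Classical in
/-- With probability `ε` a uniformly random action, otherwise the action `a₀`. -/
def exploreOr [Nonempty A] (ε : Set.Icc (0 : ℝ) 1) (a₀ : A) : stdSimplex ℝ A :=
  ⟨fun a => (ε : ℝ) / Fintype.card A + (1 - ε) * (if a = a₀ then 1 else 0), by
    refine ⟨fun a => ?_, ?_⟩
    · have h0 := ε.2.1
      have h1 : 0 ≤ 1 - (ε : ℝ) := sub_nonneg.2 ε.2.2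
      positivity
    · have hA : (Fintype.card A : ℝ) ≠ 0 := by exact_mod_cast Fintype.card_ne_zero
      simp [Finset.sum_add_distrib, mul_div_cancel₀ _ hA]⟩

/-- The exploration probability `min {1, (N A / n)^{1/3}}` for `n` rounds, `N` contexts and
`A` actions. -/
def epsRate (N nA n : ℕ) : Set.Icc (0 : ℝ) 1 :=
  ⟨min 1 (((N : ℝ) * nA / n) ^ (1 / 3 : ℝ)), le_min zero_le_one (by positivity), min_le_left _ _⟩

/-- Tabular `ε`-greedy for `n` rounds, tuned for `N` contexts: explore uniformly with probability
`ε`, otherwise play greedily for the empirical means of all earlier rounds. -/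
def epsGreedy [Nonempty A] (N n : ℕ) : CBAlgorithm S A := fun t x s =>
  exploreOr (epsRate N (Fintype.card A) n) (greedy (empMean x 0 t s))

open Classical in
/-- Inverse gap weighting with learning rate `γ`: with `â` the greedy action, an action `a ≠ â` has
probability `1 / (A + γ (f â - f a))`, and `â` has the remaining probability. -/
def inverseGapWeight [Nonempty A] (γ : ℝ) (f : A → ℝ) (a : A) : ℝ :=
  let w : A → ℝ := fun b => 1 / (Fintype.card A + γ * (f (greedy f) - f b))
  if a = greedy f then 1 - ∑ b ∈ Finset.univ.erase (greedy f), w b else w a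

theorem inverseGapWeight_mem [Nonempty A] {γ : ℝ} (hγ : 0 ≤ γ) (f : A → ℝ) :
    inverseGapWeight γ f ∈ stdSimplex ℝ A := by
  classical
  have hA : (0 : ℝ) < Fintype.card A := by exact_mod_cast Fintype.card_pos
  have hmax : ∀ b, f b ≤ f (greedy f) := by
    have h : greedy f ∈ argmaxSet f := (argmaxSet_nonempty f).choose_spec
    simpa [argmaxSet] using h
  have hle : ∀ b, (Fintype.card A : ℝ) ≤ Fintype.card A + γ * (f (greedy f) - f b) := fun b =>
    le_add_of_nonneg_right (mul_nonneg hγ (sub_nonneg.2 (hmax b)))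
  have hw : ∀ b, 1 / (Fintype.card A + γ * (f (greedy f) - f b)) ≤ 1 / (Fintype.card A : ℝ) :=
    fun b => one_div_le_one_div_of_le hA (hle b)
  refine ⟨fun a => ?_, ?_⟩
  · by_cases ha : a = greedy f
    · simp only [inverseGapWeight, ha, if_true]
      have h1 := Finset.sum_le_sum fun b (_ : b ∈ Finset.univ.erase (greedy f)) => hw b
      have h2 : ∑ _b ∈ (Finset.univ : Finset A).erase (greedy f), 1 / (Fintype.card A : ℝ) ≤
          ∑ _b : A, 1 / (Fintype.card A : ℝ) :=
        Finset.sum_le_sum_of_subset_of_nonneg (Finset.erase_subset _ _)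
          fun _ _ _ => by positivity
      have h3 : ∑ _b : A, 1 / (Fintype.card A : ℝ) = 1 := by simp [hA.ne']
      linarith
    · simp only [inverseGapWeight, ha, if_false]
      exact one_div_nonneg.2 (hA.le.trans (hle a))
  · rw [← Finset.add_sum_erase _ _ (Finset.mem_univ (greedy f)),
      Finset.sum_congr rfl (g := fun b => 1 / (Fintype.card A + γ * (f (greedy f) - f b)))]
    · simp [inverseGapWeight]
    · intro b hb
      simp [inverseGapWeight, Finset.ne_of_mem_erase hb]

/-- The epoch schedule `τ_0 = 0` and `τ_m = 2 ^ m` for `m ≥ 1`. -/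
def epochEnd (m : ℕ) : ℕ := if m = 0 then 0 else 2 ^ m

/-- The epoch `m ≥ 1` of round `t`, that is, `τ_{m-1} ≤ t < τ_m` (rounds start at `0`). -/
def epoch (t : ℕ) : ℕ := Nat.log 2 t + 1

theorem epoch_spec (t : ℕ) : epochEnd (epoch t - 1) ≤ t ∧ t < epochEnd (epoch t) := by
  refine ⟨?_, by simpa [epochEnd, epoch] using Nat.lt_pow_succ_log_self one_lt_two t⟩
  rcases Nat.eq_zero_or_pos (Nat.log 2 t) with h | h
  · simp [epochEnd, epoch, h]
  · have ht : t ≠ 0 := by rintro rfl; simp at h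
    simpa [epochEnd, epoch, h.ne'] using Nat.pow_log_le_self 2 ht

/-- The bound `R² N A / ℓ` on the mean squared error of the empirical means over `ℓ` rounds, for
`N` contexts, `A` actions and rewards in `[0, R]`. -/
def tabularError (N nA : ℕ) (R ℓ : ℝ) : ℝ := R ^ 2 * N * nA / ℓ

/-- The learning rate of FALCON+ in epoch `m`: `γ_1 = 1`, and `γ_m = (1/2) √(A / 𝓔(τ_{m-1} - τ_{m-2}))`
for `m ≥ 2`, where `𝓔` is the estimation error of the regression oracle. -/
def falconRate (N nA : ℕ) (R : ℝ) (m : ℕ) : ℝ :=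
  if m ≤ 1 then 1
  else 1 / 2 * Real.sqrt (nA / tabularError N nA R ((epochEnd (m - 1) : ℝ) - epochEnd (m - 2)))

theorem falconRate_nonneg (N nA : ℕ) (R : ℝ) (m : ℕ) : 0 ≤ falconRate N nA R m := by
  unfold falconRate
  split_ifs <;> positivity

/-- Tabular FALCON+, tuned for `N` contexts and rewards in `[0, R]`: in epoch `m`, inverse gap
weighting for the least-squares estimate (the empirical means) on the data of epoch `m - 1` alone
(no data for `m = 1`). -/
def falconPlus [Nonempty A] (N : ℕ) (R : ℝ) : CBAlgorithm S A := fun t x s =>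
  ⟨_, inverseGapWeight_mem (falconRate_nonneg N (Fintype.card A) R (epoch t))
    (empMean x (epochEnd (epoch t - 2)) (epochEnd (epoch t - 1)) s)⟩

end

end JSRL

namespace JSRL

noncomputable section

open MeasureTheory ProbabilityTheory

/-! ### Measurability and integrals of mixtures and compositions -/

section MeasureTools

variable {α β γ : Type*} [MeasurableSpace α] [MeasurableSpace β] [MeasurableSpace γ]

/-! The proof reduces JSRL to `H` stationary contextual bandits and then bounds the expected regret
of each oracle.

Reduction. At iteration `h` the steps before `h` still follow the guide and the later steps are
frozen. Occupancies at `h` depend only on the former and returns only on the latter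
(`MDP.map_cbSample_rollout`), so the oracle faces i.i.d. contexts from the guide's occupancy and
rewards whose mean is the current action value. By the performance difference argument
(`MDP.initValue_sub_le`), the suboptimality is at most the sum over steps of the gap "best action
value minus value of the action distribution played", averaged over the occupancy of the comparator.
Gaps are nonnegative, so passing to the guide's occupancy costs only the factor `C`. At step `h`
this averaged gap is the bandit regret of the mixture policy, and later iterations do not change it
(`MDP.totalGap_update`). Regret is affine in the policy, so the mixture has the average regret of
the rounds. Since there are `H` iterations with reward range at most `H`, an oracle with average
regret `R * b` gives `C * H * (H * b)`, and `n ≥ T / H` turns this into the stated rates.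

ε-greedy. The regret of a round is at most the exploration cost plus the estimation error at the
best action and at the action played. Exploration bounds the first error through the mean squared
error of an empirical mean. The squares of the second are summable up to a logarithm, because an
error is charged only when its action is observed (`Bandit.sum_sum_integral_mul_sq_empMean_sub_le`).
The exponent `1/3` absorbs this logarithm.

FALCON+. Inverse gap weighting allows the error under any policy to be bounded by that policy's
estimated regret and the squared error under the weighting policy. Hence regret and estimated regret
bound each other up to a slack that contracts by `1/7` per epoch, plus the new estimation error
(`Bandit.regret_estRegret_step`). The comparison is pathwise, and expectations are taken only of the
slack. No concentration inequality or union bound is used, hence no logarithm.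

Both oracles use `Bandit.integral_mul_sq_empMean_sub_le`. When an action is played in a context with
probability at least `q` in each of `ℓ` rounds, `q` times the squared error has mean at most `20 R²
/ ℓ`. The proof is a supermartingale argument for `msePotential`: a regularised squared mean, plus
an exponential term that pays for too few observations. -/

theorem measurable_map_family {μ : α → Measure β} (hμ : Measurable μ)
    [∀ a, IsProbabilityMeasure (μ a)] {f : α → β → γ} (hf : Measurable (Function.uncurry f)) :
    Measurable fun a => (μ a).map (f a) := by
  let κ : Kernel α β := ⟨μ, hμ⟩
  have : IsMarkovKernel κ := ⟨fun a => inferInstanceAs (IsProbabilityMeasure (μ a))⟩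
  refine Measure.measurable_of_measurable_coe _ fun s hs => ?_
  have h1 : ∀ a, (μ a).map (f a) s = κ a (Prod.mk a ⁻¹' (Function.uncurry f ⁻¹' s)) := fun a => by
    rw [Measure.map_apply (f := f a) (hf.comp measurable_prodMk_left) hs]
    rfl
  simp_rw [h1]
  exact Kernel.measurable_kernel_prodMk_left (hf hs)

theorem measurable_bind_family {μ : α → Measure β} (hμ : Measurable μ)
    [∀ a, IsProbabilityMeasure (μ a)] {g : α → β → Measure γ}
    (hg : Measurable (Function.uncurry g)) : Measurable fun a => (μ a).bind (g a) := by
  let κ : Kernel α β := ⟨μ, hμ⟩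
  have : IsMarkovKernel κ := ⟨fun a => inferInstanceAs (IsProbabilityMeasure (μ a))⟩
  refine Measure.measurable_of_measurable_coe _ fun s hs => ?_
  have h1 : ∀ a, (μ a).bind (g a) s = ∫⁻ b, g a b s ∂κ a := fun a => by
    rw [Measure.bind_apply (f := g a) hs (hg.comp measurable_prodMk_left).aemeasurable]
    rfl
  simp_rw [h1]
  exact Measurable.lintegral_kernel_prod_right ((Measure.measurable_coe hs).comp hg)

theorem isProbabilityMeasure_bind {μ : Measure α} [IsProbabilityMeasure μ] {κ : α → Measure β}
    (hκ : Measurable κ) (h1 : ∀ a, IsProbabilityMeasure (κ a)) :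
    IsProbabilityMeasure (μ.bind κ) :=
  ⟨by rw [Measure.bind_apply MeasurableSet.univ hκ.aemeasurable]; simp⟩

theorem integral_bind_family {μ : Measure α} [IsProbabilityMeasure μ] {κ : α → Measure β}
    (hκ : Measurable κ) (h1 : ∀ a, IsProbabilityMeasure (κ a)) {F : β → ℝ}
    (hF : Integrable F (μ.bind κ)) :
    ∫ b, F b ∂(μ.bind κ) = ∫ a, ∫ b, F b ∂(κ a) ∂μ := by
  let η : Kernel α β := ⟨κ, hκ⟩
  have : IsMarkovKernel η := ⟨h1⟩
  have h2 : μ.bind κ = (η ∘ₖ Kernel.const Unit μ) () := Measure.comp_eq_comp_const_apply (κ := η)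
  rw [h2] at hF ⊢
  rw [Kernel.integral_comp hF]
  rfl

theorem ae_bind_of_forall_ae {μ : Measure α} {κ : α → Measure β} (hκ : Measurable κ)
    {p : β → Prop} (hp : MeasurableSet {b | p b}) (h : ∀ᵐ a ∂μ, ∀ᵐ b ∂(κ a), p b) :
    ∀ᵐ b ∂(μ.bind κ), p b := by
  rw [ae_iff, Measure.bind_apply (s := {b | ¬p b}) hp.compl hκ.aemeasurable]
  refine (lintegral_eq_zero_iff ((Measure.measurable_coe (s := {b | ¬p b}) hp.compl).comp hκ)).2 ?_
  filter_upwards [h] with a ha using ha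

theorem measurable_finset_sum_smul_measure {ι : Type*} (s : Finset ι) {w : ι → α → ℝ}
    {μ : ι → α → Measure β} (hw : ∀ i, Measurable (w i)) (hμ : ∀ i, Measurable (μ i)) :
    Measurable fun a => ∑ i ∈ s, ENNReal.ofReal (w i a) • μ i a := by
  refine Measure.measurable_of_measurable_coe _ fun t ht => ?_
  simp only [Measure.coe_finsetSum, Finset.sum_apply, Measure.smul_apply, smul_eq_mul]
  exact Finset.measurable_sum _ fun i _ =>
    (hw i).ennreal_ofReal.mul ((Measure.measurable_coe ht).comp (hμ i))

end MeasureTools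

/-! ### Finite mixtures of measures. -/

section Mix

variable {ι β γ : Type*} [Fintype ι] [MeasurableSpace β] [MeasurableSpace γ]

theorem lintegral_mix (w : stdSimplex ℝ ι) (μ : ι → Measure β) (f : β → ENNReal) :
    ∫⁻ x, f x ∂(mix w μ) = ∑ i, ENNReal.ofReal (w i) * ∫⁻ x, f x ∂(μ i) := by
  simp [mix, lintegral_finsetSum_measure]

theorem integral_mix (w : stdSimplex ℝ ι) (μ : ι → Measure β) {f : β → ℝ}
    (hf : ∀ i, Integrable f (μ i)) :
    ∫ x, f x ∂(mix w μ) = ∑ i, w i * ∫ x, f x ∂(μ i) := by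
  rw [mix, integral_finsetSum_measure
    fun i _ => (hf i).smul_measure ENNReal.ofReal_ne_top]
  simp [integral_smul_measure]

instance isProbabilityMeasure_mix (w : stdSimplex ℝ ι) (μ : ι → Measure β)
    [∀ i, IsProbabilityMeasure (μ i)] : IsProbabilityMeasure (mix w μ) := by
  refine ⟨?_⟩
  simp only [mix, Measure.coe_finsetSum, Finset.sum_apply, Measure.smul_apply, measure_univ,
    smul_eq_mul, mul_one]
  rw [← ENNReal.ofReal_sum_of_nonneg fun i _ => stdSimplex.zero_le w i]
  simp

theorem ae_mix_of_forall (w : stdSimplex ℝ ι) (μ : ι → Measure β) {p : β → Prop}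
    (h : ∀ i, ∀ᵐ x ∂(μ i), p x) : ∀ᵐ x ∂(mix w μ), p x := by
  rw [ae_iff, mix]
  simp only [Measure.coe_finsetSum, Finset.sum_apply, Measure.smul_apply, smul_eq_mul]
  refine Finset.sum_eq_zero fun i _ => ?_
  rw [ae_iff.1 (h i), mul_zero]

end Mix

section FinTuples

variable {β : Type*} [MeasurableSpace β]

theorem measurable_finCons (k : ℕ) :
    Measurable fun z : β × (Fin k → β) => (Fin.cons (α := fun _ => β) z.1 z.2) := by
  refine measurable_pi_lambda _ fun i => ?_
  refine Fin.cases ?_ (fun j => ?_) i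
  · simpa using measurable_fst
  · simpa [Function.comp_def] using (measurable_pi_apply j).comp measurable_snd

theorem measurable_finSnoc (k : ℕ) :
    Measurable fun z : (Fin k → β) × β => (Fin.snoc (α := fun _ => β) z.1 z.2) := by
  refine measurable_pi_lambda _ fun i => ?_
  refine Fin.lastCases ?_ (fun j => ?_) i
  · simpa using measurable_snd
  · simpa [Function.comp_def] using (measurable_pi_apply j).comp measurable_fst

end FinTuples

theorem measurable_simplex_apply {A : Type*} [Fintype A] (a : A) :
    Measurable fun p : stdSimplex ℝ A => p a :=
  (measurable_pi_apply a).comp measurable_subtype_coe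

theorem measurable_policy_apply {S A : Type*} [Fintype A] (h : ℕ) (s : S) (a : A) :
    Measurable fun π : Policy S A => π h s a :=
  (measurable_simplex_apply a).comp ((measurable_pi_apply s).comp (measurable_pi_apply h))

/-! ### Laws of returns and of bandit samples -/

section ReturnLaws

variable {S A : Type*} [Fintype S] [Fintype A]

instance (M : MDP S A) (h : ℕ) (s : S) (a : A) : IsProbabilityMeasure (M.reward h s a) :=
  M.isProbabilityMeasure_reward h s a

/-- Law of the sum of the rewards of the `k` steps from step `h` on. -/
def MDP.returnLaw (M : MDP S A) (π : Policy S A) : ℕ → ℕ → S → Measure ℝ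
  | 0, _, _ => Measure.dirac 0
  | k + 1, h, s => mix (π h s) fun a =>
      (M.reward h s a) ∗ (mix (M.trans h s a) fun s' => M.returnLaw π k (h + 1) s')

/-- Law of the sum of the rewards of the `k + 1` steps from step `h` on, when the action at step
`h` is `a`. -/
def MDP.actionReturnLaw (M : MDP S A) (π : Policy S A) (k h : ℕ) (s : S) (a : A) : Measure ℝ :=
  (M.reward h s a) ∗ (mix (M.trans h s a) fun s' => M.returnLaw π k (h + 1) s')

/-- The action-value function for the `k + 1` steps from step `h` on. -/
def MDP.actionValue (M : MDP S A) (π : Policy S A) (k h : ℕ) (s : S) (a : A) : ℝ :=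
  (∫ x, x ∂(M.reward h s a)) + ∑ s', M.trans h s a s' * M.valueToGo π k (h + 1) s'

theorem MDP.valueToGo_succ (M : MDP S A) (π : Policy S A) (k h : ℕ) (s : S) :
    M.valueToGo π (k + 1) h s = ∑ a, π h s a * M.actionValue π k h s a := rfl

theorem MDP.returnLaw_succ (M : MDP S A) (π : Policy S A) (k h : ℕ) (s : S) :
    M.returnLaw π (k + 1) h s = mix (π h s) (M.actionReturnLaw π k h s) := rfl

instance isProbabilityMeasure_returnLaw (M : MDP S A) (π : Policy S A) (k h : ℕ) (s : S) :
    IsProbabilityMeasure (M.returnLaw π k h s) := by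
  induction k generalizing h s with
  | zero => exact inferInstanceAs (IsProbabilityMeasure (Measure.dirac (0 : ℝ)))
  | succ k ih =>
    rw [MDP.returnLaw_succ]
    have (a : A) : IsProbabilityMeasure (M.actionReturnLaw π k h s a) := by
      unfold MDP.actionReturnLaw; infer_instance
    infer_instance

instance isProbabilityMeasure_actionReturnLaw (M : MDP S A) (π : Policy S A) (k h : ℕ) (s : S)
    (a : A) : IsProbabilityMeasure (M.actionReturnLaw π k h s a) := by
  unfold MDP.actionReturnLaw; infer_instance

theorem ae_conv_of_ae {μ ν : Measure ℝ} [SFinite μ] [SFinite ν] {p q r : ℝ → Prop}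
    (hr : MeasurableSet {x | r x}) (hμ : ∀ᵐ x ∂μ, p x) (hν : ∀ᵐ y ∂ν, q y)
    (h : ∀ x y, p x → q y → r (x + y)) : ∀ᵐ z ∂(μ ∗ ν), r z := by
  unfold Measure.conv
  rw [ae_map_iff (by fun_prop) hr]
  have hs : MeasurableSet {z : ℝ × ℝ | r (z.1 + z.2)} :=
    hr.preimage (f := fun z : ℝ × ℝ => z.1 + z.2) (by fun_prop)
  rw [Measure.ae_prod_iff_ae_ae hs]
  filter_upwards [hμ] with x hx
  filter_upwards [hν] with y hy using h x y hx hy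

theorem MDP.actionReturnLaw_ae (M : MDP S A) (π : Policy S A) (k h : ℕ) (s : S) (a : A)
    (hk : ∀ s', ∀ᵐ x ∂(M.returnLaw π k (h + 1) s'), x ∈ Set.Icc (0 : ℝ) k) :
    ∀ᵐ x ∂(M.actionReturnLaw π k h s a), x ∈ Set.Icc (0 : ℝ) (k + 1) := by
  unfold MDP.actionReturnLaw
  refine ae_conv_of_ae measurableSet_Icc (M.reward_mem_Icc h s a) (ae_mix_of_forall _ _ hk) ?_
  intro x y hx hy
  exact ⟨add_nonneg hx.1 hy.1, by linarith [hx.2, hy.2]⟩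

theorem MDP.returnLaw_ae_mem (M : MDP S A) (π : Policy S A) (k h : ℕ) (s : S) :
    ∀ᵐ x ∂(M.returnLaw π k h s), x ∈ Set.Icc (0 : ℝ) k := by
  induction k generalizing h s with
  | zero =>
    exact (ae_dirac_iff measurableSet_Icc).2 (by simp)
  | succ k ih =>
    rw [MDP.returnLaw_succ]
    refine ae_mix_of_forall _ _ fun a => ?_
    push_cast
    exact M.actionReturnLaw_ae π k h s a (ih _)

theorem MDP.actionReturnLaw_ae_mem (M : MDP S A) (π : Policy S A) (k h : ℕ) (s : S) (a : A) :
    ∀ᵐ x ∂(M.actionReturnLaw π k h s a), x ∈ Set.Icc (0 : ℝ) (k + 1) :=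
  M.actionReturnLaw_ae π k h s a (M.returnLaw_ae_mem π k (h + 1))

theorem integrable_of_ae_mem_Icc {μ : Measure ℝ} [IsFiniteMeasure μ] {a b : ℝ}
    (h : ∀ᵐ x ∂μ, x ∈ Set.Icc a b) : Integrable (fun x => x) μ :=
  Integrable.of_mem_Icc a b measurable_id.aemeasurable h

theorem integral_conv_id {μ ν : Measure ℝ} [IsProbabilityMeasure μ] [IsProbabilityMeasure ν]
    (hμ : Integrable (fun x => x) μ) (hν : Integrable (fun x => x) ν) :
    ∫ z, z ∂(μ ∗ ν) = ∫ x, x ∂μ + ∫ y, y ∂ν := by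
  unfold Measure.conv
  rw [integral_map (by fun_prop) (by fun_prop),
    integral_add (f := fun z : ℝ × ℝ => z.1) (g := fun z : ℝ × ℝ => z.2)
      (hμ.comp_fst ν) (hν.comp_snd μ)]
  simp [integral_fun_fst (fun x : ℝ => x), integral_fun_snd (fun x : ℝ => x)]

theorem MDP.integral_actionReturnLaw_of_integral_returnLaw (M : MDP S A) (π : Policy S A)
    (k h : ℕ) (hk : ∀ s, ∫ x, x ∂(M.returnLaw π k (h + 1) s) = M.valueToGo π k (h + 1) s)
    (s : S) (a : A) : ∫ x, x ∂(M.actionReturnLaw π k h s a) = M.actionValue π k h s a := by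
  unfold MDP.actionReturnLaw MDP.actionValue
  rw [integral_conv_id (integrable_of_ae_mem_Icc (M.reward_mem_Icc h s a))
    (integrable_of_ae_mem_Icc (ae_mix_of_forall _ _ (M.returnLaw_ae_mem π k (h + 1)))),
    integral_mix _ _ fun s' => integrable_of_ae_mem_Icc (M.returnLaw_ae_mem π k (h + 1) s')]
  simp [hk]

theorem MDP.integral_returnLaw (M : MDP S A) (π : Policy S A) (k h : ℕ) (s : S) :
    ∫ x, x ∂(M.returnLaw π k h s) = M.valueToGo π k h s := by
  induction k generalizing h s with
  | zero => simp [MDP.returnLaw, MDP.valueToGo]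
  | succ k ih =>
    rw [MDP.returnLaw_succ, MDP.valueToGo_succ, integral_mix _ _ fun a =>
      integrable_of_ae_mem_Icc (M.actionReturnLaw_ae_mem π k h s a)]
    simp [M.integral_actionReturnLaw_of_integral_returnLaw π k h (ih _)]

theorem MDP.integral_actionReturnLaw (M : MDP S A) (π : Policy S A) (k h : ℕ) (s : S) (a : A) :
    ∫ x, x ∂(M.actionReturnLaw π k h s a) = M.actionValue π k h s a :=
  M.integral_actionReturnLaw_of_integral_returnLaw π k h (M.integral_returnLaw π k (h + 1)) s a

/-! The laws depend only on the later components of the policy, occupancies on the earlier ones. -/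

theorem MDP.returnLaw_congr (M : MDP S A) {π π' : Policy S A} (k h : ℕ)
    (hπ : ∀ l, h ≤ l → π l = π' l) (s : S) : M.returnLaw π k h s = M.returnLaw π' k h s := by
  induction k generalizing h s with
  | zero => rfl
  | succ k ih =>
    have h2 := ih (h + 1) fun l hl => hπ l (by omega)
    simp only [MDP.returnLaw, hπ h le_rfl, h2]

theorem MDP.actionReturnLaw_congr (M : MDP S A) {π π' : Policy S A} (k h : ℕ)
    (hπ : ∀ l, h < l → π l = π' l) (s : S) (a : A) :
    M.actionReturnLaw π k h s a = M.actionReturnLaw π' k h s a := by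
  unfold MDP.actionReturnLaw
  simp only [M.returnLaw_congr k (h + 1) fun l hl => hπ l (by omega)]

theorem MDP.actionValue_congr (M : MDP S A) {π π' : Policy S A} (k h : ℕ)
    (hπ : ∀ l, h < l → π l = π' l) (s : S) (a : A) :
    M.actionValue π k h s a = M.actionValue π' k h s a := by
  rw [← M.integral_actionReturnLaw, ← M.integral_actionReturnLaw,
    M.actionReturnLaw_congr k h hπ]

theorem MDP.occupancy_congr (M : MDP S A) {π π' : Policy S A} (h : ℕ)
    (hπ : ∀ l, l < h → π l = π' l) (s : S) : M.occupancy π h s = M.occupancy π' h s := by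
  induction h generalizing s with
  | zero => rfl
  | succ h ih =>
    simp only [MDP.occupancy, hπ h (Nat.lt_succ_self h),
      ih fun l hl => hπ l (by omega)]

theorem MDP.occupancy_nonneg (M : MDP S A) (π : Policy S A) (h : ℕ) (s : S) :
    0 ≤ M.occupancy π h s := by
  induction h generalizing s with
  | zero => exact stdSimplex.zero_le _ _
  | succ h ih =>
    exact Finset.sum_nonneg fun s _ => Finset.sum_nonneg fun a _ =>
      mul_nonneg (mul_nonneg (ih s) (stdSimplex.zero_le _ _)) (stdSimplex.zero_le _ _)

/-- The forward recursion of occupancies in dual form, as needed to match the backward recursion of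
values. -/
theorem MDP.sum_occupancy_succ_mul (M : MDP S A) (π : Policy S A) (h : ℕ) (g : S → ℝ) :
    ∑ s', M.occupancy π (h + 1) s' * g s' =
      ∑ s, M.occupancy π h s * ∑ a, π h s a * ∑ s', M.trans h s a s' * g s' := by
  simp only [MDP.occupancy, Finset.sum_mul, Finset.mul_sum]
  rw [Finset.sum_comm]
  refine Finset.sum_congr rfl fun s _ => ?_
  rw [Finset.sum_comm]
  refine Finset.sum_congr rfl fun a _ => Finset.sum_congr rfl fun s' _ => by ring

theorem MDP.sum_occupancy (M : MDP S A) (π : Policy S A) (h : ℕ) :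
    ∑ s, M.occupancy π h s = 1 := by
  induction h with
  | zero => exact stdSimplex.sum_eq_one _
  | succ h ih =>
    have := M.sum_occupancy_succ_mul π h fun _ => 1
    simpa [ih] using this

end ReturnLaws

/-! ### Bandit samples read off a trajectory. -/

section Samples

variable {S A : Type*}

theorem cbSample_zero_cons {k : ℕ} (z : S × A × ℝ) (y : Fin k → S × A × ℝ) :
    cbSample (0 : Fin (k + 1)) (Fin.cons (α := fun _ => S × A × ℝ) z y) =
      (z.1, z.2.1, z.2.2 + ∑ i, (y i).2.2) := by
  have h : Finset.Ici (0 : Fin (k + 1)) = Finset.univ := by ext; simp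
  simp [cbSample, h, Fin.sum_univ_succ]

theorem cbSample_succ_cons {k : ℕ} (i : Fin k) (z : S × A × ℝ) (y : Fin k → S × A × ℝ) :
    cbSample i.succ (Fin.cons (α := fun _ => S × A × ℝ) z y) = cbSample i y := by
  have h : Finset.Ici i.succ = (Finset.Ici i).map (Fin.succEmb k) := by
    ext j
    refine Fin.cases ?_ (fun j => ?_) j <;> simp
  simp only [cbSample, Fin.cons_succ, h, Finset.sum_map, Fin.coe_succEmb]

theorem measurable_cbSample [MeasurableSpace S] [MeasurableSpace A] {H : ℕ} (h : Fin H) :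
    Measurable (cbSample h : (Fin H → S × A × ℝ) → S × A × ℝ) := by
  unfold cbSample
  fun_prop

end Samples

section SampleLaw

variable {S A : Type*} [Fintype S] [Fintype A] [MeasurableSpace S] [MeasurableSpace A]

/-- Law of a context-action-reward triple: the context has law `d`, the action is drawn from `p`,
and the reward of action `a` in context `s` has law `ρ s a`. -/
def sampleLaw (d : S → ℝ) (ρ : S → A → Measure ℝ) (p : S → stdSimplex ℝ A) :
    Measure (S × A × ℝ) :=
  ∑ s, ∑ a, ENNReal.ofReal (d s * p s a) • (ρ s a).map fun r => (s, a, r)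

theorem lintegral_sampleLaw {d : S → ℝ} (hd : ∀ s, 0 ≤ d s) (ρ : S → A → Measure ℝ)
    (p : S → stdSimplex ℝ A) {F : S × A × ℝ → ENNReal} (hF : Measurable F) :
    ∫⁻ z, F z ∂(sampleLaw d ρ p) =
      ∑ s, ENNReal.ofReal (d s) * ∑ a, ENNReal.ofReal (p s a) * ∫⁻ r, F (s, a, r) ∂(ρ s a) := by
  simp only [sampleLaw, lintegral_finsetSum_measure, lintegral_smul_measure, Finset.mul_sum]
  refine Finset.sum_congr rfl fun s _ => Finset.sum_congr rfl fun a _ => ?_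
  rw [lintegral_map hF (by fun_prop), ENNReal.ofReal_mul (hd s), smul_eq_mul, mul_assoc]

theorem MDP.measurable_tailLaw_step (M : MDP S A) (π : Policy S A) (k h : ℕ) (s : S) (a : A)
    (hprob : ∀ s', IsProbabilityMeasure (M.tailLaw π k (h + 1) s')) :
    Measurable fun r : ℝ => mix (M.trans h s a) fun s' =>
      (M.tailLaw π k (h + 1) s').map (Fin.cons (α := fun _ => S × A × ℝ) (s, a, r)) := by
  refine measurable_finset_sum_smul_measure _ (fun _ => measurable_const) fun s' => ?_
  refine measurable_map_family (μ := fun _ : ℝ => M.tailLaw π k (h + 1) s') measurable_const ?_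
  exact (measurable_finCons k).comp
    (f := fun z : ℝ × (Fin k → S × A × ℝ) => ((s, a, z.1), z.2)) (by fun_prop)

instance isProbabilityMeasure_tailLaw (M : MDP S A) (π : Policy S A) (k h : ℕ) (s : S) :
    IsProbabilityMeasure (M.tailLaw π k h s) := by
  induction k generalizing h s with
  | zero => exact inferInstanceAs (IsProbabilityMeasure (Measure.dirac _))
  | succ k ih =>
    have (a : A) : IsProbabilityMeasure ((M.reward h s a).bind fun r =>
      mix (M.trans h s a) fun s' =>
        (M.tailLaw π k (h + 1) s').map (Fin.cons (α := fun _ => S × A × ℝ) (s, a, r))) := by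
      refine isProbabilityMeasure_bind (M.measurable_tailLaw_step π k h s a (ih _)) fun r => ?_
      have (s' : S) : IsProbabilityMeasure ((M.tailLaw π k (h + 1) s').map
          (Fin.cons (α := fun _ => S × A × ℝ) (s, a, r))) :=
        Measure.isProbabilityMeasure_map ((measurable_finCons k).comp
          (measurable_prodMk_left)).aemeasurable
      infer_instance
    exact inferInstanceAs (IsProbabilityMeasure (mix _ _))

theorem MDP.lintegral_tailLaw_succ (M : MDP S A) (π : Policy S A) (k h : ℕ) (s : S)
    {F : (Fin (k + 1) → S × A × ℝ) → ENNReal} (hF : Measurable F) :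
    ∫⁻ y, F y ∂(M.tailLaw π (k + 1) h s) = ∑ a, ENNReal.ofReal (π h s a) *
      ∫⁻ r, ∑ s', ENNReal.ofReal (M.trans h s a s') *
        ∫⁻ y, F (Fin.cons (α := fun _ => S × A × ℝ) (s, a, r) y) ∂(M.tailLaw π k (h + 1) s')
          ∂(M.reward h s a) := by
  rw [MDP.tailLaw, lintegral_mix]
  refine Finset.sum_congr rfl fun a _ => ?_
  rw [Measure.lintegral_bind
    (M.measurable_tailLaw_step π k h s a fun _ => inferInstance).aemeasurable hF.aemeasurable]
  congr 1
  refine lintegral_congr fun r => ?_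
  rw [lintegral_mix]
  refine Finset.sum_congr rfl fun s' _ => ?_
  exact congrArg _ (lintegral_map (g := Fin.cons (α := fun _ => S × A × ℝ) (s, a, r)) hF
    ((measurable_finCons k).comp measurable_prodMk_left))

/-- Given the state and the action, the reward is independent of the next state and of all that
follows, so the return is a convolution at each step. -/
theorem MDP.map_sum_tailLaw (M : MDP S A) (π : Policy S A) (k h : ℕ) (s : S) :
    (M.tailLaw π k h s).map (fun y => ∑ i, (y i).2.2) = M.returnLaw π k h s := by
  induction k generalizing h s with
  | zero =>
    rw [MDP.tailLaw, Measure.map_dirac' (by fun_prop)]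
    simp [MDP.returnLaw]
  | succ k ih =>
    refine Measure.ext_of_lintegral _ fun F hF => ?_
    rw [lintegral_map hF (by fun_prop), M.lintegral_tailLaw_succ π k h s (by fun_prop),
      MDP.returnLaw_succ, lintegral_mix]
    refine Finset.sum_congr rfl fun a _ => ?_
    rw [MDP.actionReturnLaw, Measure.lintegral_conv hF]
    congr 1
    refine lintegral_congr fun r => ?_
    rw [lintegral_mix]
    refine Finset.sum_congr rfl fun s' _ => ?_
    rw [← ih, lintegral_map (by fun_prop) (by fun_prop)]
    simp [Fin.sum_univ_succ]

/-- Dropping the first step of a trajectory started from the occupancy at `j` gives one started from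
the occupancy at `j + 1`. Induction on the offset `i` brings the sampled step to the front, where
the sample is the state, the action and the return. -/
theorem MDP.lintegral_cbSample_tailLaw (M : MDP S A) (π : Policy S A) {F : S × A × ℝ → ENNReal}
    (hF : Measurable F) (i k j : ℕ) (hi : i < k) :
    ∑ s, ENNReal.ofReal (M.occupancy π j s) *
        ∫⁻ y, F (cbSample ⟨i, hi⟩ y) ∂(M.tailLaw π k j s) =
      ∑ s, ENNReal.ofReal (M.occupancy π (j + i) s) * ∑ a, ENNReal.ofReal (π (j + i) s a) *
        ∫⁻ r, F (s, a, r) ∂(M.actionReturnLaw π (k - 1 - i) (j + i) s a) := by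
  induction i generalizing k j with
  | zero =>
    obtain ⟨k, rfl⟩ : ∃ k', k = k' + 1 := ⟨k - 1, by omega⟩
    refine Finset.sum_congr rfl fun s _ => ?_
    rw [M.lintegral_tailLaw_succ π k j s (F := fun y => F (cbSample ⟨0, hi⟩ y))
      (hF.comp (measurable_cbSample _))]
    congr 1
    refine Finset.sum_congr rfl fun a _ => ?_
    congr 1
    rw [MDP.actionReturnLaw, Measure.lintegral_conv (by fun_prop)]
    refine lintegral_congr fun r => ?_
    rw [lintegral_mix]
    refine Finset.sum_congr rfl fun s' _ => ?_
    simp only [add_tsub_cancel_right, tsub_zero, add_zero]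
    rw [← M.map_sum_tailLaw, lintegral_map (by fun_prop) (by fun_prop)]
    congr 1
    refine lintegral_congr fun y => ?_
    exact congrArg F (cbSample_zero_cons _ _)
  | succ i ih =>
    obtain ⟨k, rfl⟩ : ∃ k', k = k' + 1 := ⟨k - 1, by omega⟩
    have hi' : i < k := by omega
    have h1 : ∀ s, ∫⁻ y, F (cbSample ⟨i + 1, hi⟩ y) ∂(M.tailLaw π (k + 1) j s) =
        ∑ a, ENNReal.ofReal (π j s a) * ∑ s', ENNReal.ofReal (M.trans j s a s') *
          ∫⁻ y, F (cbSample ⟨i, hi'⟩ y) ∂(M.tailLaw π k (j + 1) s') := by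
      intro s
      rw [M.lintegral_tailLaw_succ π k j s (F := fun y => F (cbSample ⟨i + 1, hi⟩ y))
        (hF.comp (measurable_cbSample _))]
      refine Finset.sum_congr rfl fun a _ => ?_
      have h2 : ∀ (r : ℝ) (y : Fin k → S × A × ℝ),
          F (cbSample ⟨i + 1, hi⟩ (Fin.cons (α := fun _ => S × A × ℝ) (s, a, r) y)) =
            F (cbSample ⟨i, hi'⟩ y) := fun r y =>
        congrArg F (cbSample_succ_cons ⟨i, hi'⟩ _ _)
      simp only [h2, lintegral_const, measure_univ, mul_one]
    have h3 := ih k (j + 1) hi'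
    have e1 : j + 1 + i = j + (i + 1) := by omega
    have e2 : k - 1 - i = k + 1 - 1 - (i + 1) := by omega
    rw [e1, e2] at h3
    rw [← h3]
    simp only [h1]
    have h4 : ∀ s', ENNReal.ofReal (M.occupancy π (j + 1) s') =
        ∑ s, ∑ a, ENNReal.ofReal (M.occupancy π j s) * ENNReal.ofReal (π j s a) *
          ENNReal.ofReal (M.trans j s a s') := by
      intro s'
      have n1 := M.occupancy_nonneg π j
      rw [MDP.occupancy, ENNReal.ofReal_sum_of_nonneg fun s _ => Finset.sum_nonneg fun a _ =>
        mul_nonneg (mul_nonneg (n1 s) (stdSimplex.zero_le _ _)) (stdSimplex.zero_le _ _)]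
      refine Finset.sum_congr rfl fun s _ => ?_
      rw [ENNReal.ofReal_sum_of_nonneg fun a _ =>
        mul_nonneg (mul_nonneg (n1 s) (stdSimplex.zero_le _ _)) (stdSimplex.zero_le _ _)]
      refine Finset.sum_congr rfl fun a _ => ?_
      rw [ENNReal.ofReal_mul (mul_nonneg (n1 s) (stdSimplex.zero_le _ _)),
        ENNReal.ofReal_mul (n1 s)]
    simp only [h4, Finset.sum_mul, Finset.mul_sum]
    symm
    rw [Finset.sum_comm]
    refine Finset.sum_congr rfl fun s _ => ?_
    rw [Finset.sum_comm]
    refine Finset.sum_congr rfl fun a _ => Finset.sum_congr rfl fun s' _ => by ring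

/-- The bandit sample of a rollout in which `p` is played at step `h`. -/
theorem MDP.map_cbSample_rollout (M : MDP S A) {H : ℕ} (h : Fin H) (π : Policy S A)
    (p : S → stdSimplex ℝ A) :
    (M.rollout H (Function.update π h p)).map (cbSample h) =
      sampleLaw (M.occupancy π h) (M.actionReturnLaw π (H - 1 - h) h) p := by
  refine Measure.ext_of_lintegral _ fun F hF => ?_
  rw [lintegral_map hF (measurable_cbSample h), lintegral_sampleLaw (M.occupancy_nonneg π h) _ _ hF,
    MDP.rollout, lintegral_mix]
  have h1 := M.lintegral_cbSample_tailLaw (Function.update π h p) hF h H 0 h.2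
  rw [zero_add] at h1
  refine h1.trans (Finset.sum_congr rfl fun s _ => ?_)
  -- The occupancy at `h` involves only the components before `h`, the law of the return only those
  -- after `h`. Replacing the component at `h` by `p` affects neither, which makes the bandit
  -- stationary over the rounds.
  rw [M.occupancy_congr (π' := π) h fun l hl => Function.update_of_ne hl.ne _ _]
  congr 1
  refine Finset.sum_congr rfl fun a _ => ?_
  rw [M.actionReturnLaw_congr (π' := π) _ h fun l hl => Function.update_of_ne hl.ne' _ _,
    Function.update_self]

end SampleLaw

/-! ### Contextual bandits -/

/-- A stochastic contextual bandit with finitely many contexts and actions: the law of the context,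
the laws of the rewards, and a bound for the rewards. -/
structure Bandit (S A : Type*) [Fintype S] [Fintype A] where
  d : S → ℝ
  d_nonneg : ∀ s, 0 ≤ d s
  d_sum : ∑ s, d s = 1
  ρ : S → A → Measure ℝ
  isProbabilityMeasure_ρ : ∀ s a, IsProbabilityMeasure (ρ s a)
  R : ℝ
  R_nonneg : 0 ≤ R
  ρ_mem_Icc : ∀ s a, ∀ᵐ r ∂(ρ s a), r ∈ Set.Icc 0 R

/-- The policies chosen by the algorithm are measurable functions of the samples. -/
def CBAlgorithm.IsMeasurable {S A : Type*} [Fintype A] [MeasurableSpace S] [MeasurableSpace A]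
    (alg : CBAlgorithm S A) : Prop :=
  ∀ t s a, Measurable fun x : Fin t → S × A × ℝ => alg t x s a

namespace Bandit

section Moments

variable {S A : Type*} [Fintype S] [Fintype A] (E : Bandit S A)

instance (s : S) (a : A) : IsProbabilityMeasure (E.ρ s a) := E.isProbabilityMeasure_ρ s a

/-- Mean reward. -/
def mean (s : S) (a : A) : ℝ := ∫ r, r ∂(E.ρ s a)

theorem integrable_reward (s : S) (a : A) : Integrable (fun r => r) (E.ρ s a) :=
  integrable_of_ae_mem_Icc (E.ρ_mem_Icc s a)

theorem mean_mem (s : S) (a : A) : E.mean s a ∈ Set.Icc 0 E.R := by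
  have h := E.ρ_mem_Icc s a
  refine ⟨integral_nonneg_of_ae (h.mono fun r hr => hr.1), ?_⟩
  have := integral_mono_ae (E.integrable_reward s a) (integrable_const E.R)
    (h.mono fun r hr => hr.2)
  simpa [mean] using this

theorem d_le_one (s : S) : E.d s ≤ 1 := by
  rw [← E.d_sum]
  exact Finset.single_le_sum (fun s _ => E.d_nonneg s) (Finset.mem_univ s)

theorem integrable_reward_sub (s : S) (a : A) :
    Integrable (fun r => r - E.mean s a) (E.ρ s a) :=
  (E.integrable_reward s a).sub (integrable_const _)

theorem integral_reward_sub (s : S) (a : A) : ∫ r, (r - E.mean s a) ∂(E.ρ s a) = 0 := by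
  rw [integral_sub (E.integrable_reward s a) (integrable_const _)]
  simp [mean]

theorem reward_sub_mem {s : S} {a : A} {r : ℝ} (hr : r ∈ Set.Icc 0 E.R) :
    |r - E.mean s a| ≤ E.R := by
  have hm := E.mean_mem s a
  rw [abs_le]
  constructor <;> linarith [hr.1, hr.2, hm.1, hm.2]

theorem integrable_reward_sub_sq (s : S) (a : A) :
    Integrable (fun r => (r - E.mean s a) ^ 2) (E.ρ s a) := by
  refine Integrable.of_mem_Icc 0 (E.R ^ 2) (by fun_prop) ?_
  filter_upwards [E.ρ_mem_Icc s a] with r hr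
  exact ⟨sq_nonneg _, sq_le_sq.2 (by rw [abs_of_nonneg E.R_nonneg]; exact E.reward_sub_mem hr)⟩

theorem integral_reward_sub_sq_le (s : S) (a : A) :
    ∫ r, (r - E.mean s a) ^ 2 ∂(E.ρ s a) ≤ E.R ^ 2 := by
  have := integral_mono_ae (E.integrable_reward_sub_sq s a) (integrable_const (E.R ^ 2)) (by
    filter_upwards [E.ρ_mem_Icc s a] with r hr
    exact sq_le_sq.2 (by rw [abs_of_nonneg E.R_nonneg]; exact E.reward_sub_mem hr))
  simpa using this

theorem integrable_add_reward_sub_sq (M : ℝ) (s : S) (a : A) :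
    Integrable (fun r => (M + (r - E.mean s a)) ^ 2) (E.ρ s a) := by
  have : (fun r => (M + (r - E.mean s a)) ^ 2) =
      fun r => M ^ 2 + 2 * M * (r - E.mean s a) + (r - E.mean s a) ^ 2 := by ext r; ring
  rw [this]
  exact ((integrable_const _).add ((E.integrable_reward_sub s a).const_mul _)).add
    (E.integrable_reward_sub_sq s a)

/-- The cross term vanishes because the deviation is centred. Both potential arguments below rest on
this variance bound. -/
theorem integral_add_reward_sub_sq_le (M : ℝ) (s : S) (a : A) :
    ∫ r, (M + (r - E.mean s a)) ^ 2 ∂(E.ρ s a) ≤ M ^ 2 + E.R ^ 2 := by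
  have : (fun r => (M + (r - E.mean s a)) ^ 2) =
      fun r => M ^ 2 + 2 * M * (r - E.mean s a) + (r - E.mean s a) ^ 2 := by ext r; ring
  rw [this, integral_add (f := fun r => M ^ 2 + 2 * M * (r - E.mean s a))
    ((integrable_const _).add ((E.integrable_reward_sub s a).const_mul _))
    (E.integrable_reward_sub_sq s a),
    integral_add (integrable_const _) ((E.integrable_reward_sub s a).const_mul _),
    integral_const_mul, E.integral_reward_sub]
  simpa using E.integral_reward_sub_sq_le s a

/-- One-round expected regret of `p`. -/
def regret [Nonempty A] (p : S → stdSimplex ℝ A) : ℝ :=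
  ∑ s, E.d s * (E.mean s (greedy (E.mean s)) - ∑ a, p s a * E.mean s a)

/-- All observed rewards are in the range of the rewards. -/
def Good {t : ℕ} (x : Fin t → S × A × ℝ) : Prop := ∀ i, (x i).2.2 ∈ Set.Icc 0 E.R

theorem good_snoc {t : ℕ} {x : Fin t → S × A × ℝ} {z : S × A × ℝ} (hx : E.Good x)
    (hz : z.2.2 ∈ Set.Icc 0 E.R) : E.Good (Fin.snoc (α := fun _ => S × A × ℝ) x z) := by
  intro i
  refine Fin.lastCases ?_ (fun j => ?_) i
  · simpa using hz
  · simpa using hx j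

theorem sum_d_mul_sum (p : S → stdSimplex ℝ A) (c : ℝ) :
    ∑ s, E.d s * ∑ a, p s a * c = c := by
  simp_rw [← Finset.sum_mul]
  simp [← Finset.sum_mul, E.d_sum]

end Moments

/-! ### Law of the history, conditional expectations and functions bounded on good histories. -/

section History

variable {S A : Type*} [Fintype S] [Fintype A] [MeasurableSpace S] [MeasurableSpace A]
  (E : Bandit S A)

/-- Law of the first `t` samples when `alg` is run. -/
def history (E : Bandit S A) (alg : CBAlgorithm S A) : (t : ℕ) → Measure (Fin t → S × A × ℝ)
  | 0 => Measure.dirac Fin.elim0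
  | t + 1 => (E.history alg t).bind fun x =>
      (sampleLaw E.d E.ρ (alg t x)).map (Fin.snoc (α := fun _ => S × A × ℝ) x)

/-- Measurable functions of the history that are bounded on good histories. -/
def Nice {t : ℕ} (F : (Fin t → S × A × ℝ) → ℝ) : Prop :=
  Measurable F ∧ ∃ B, ∀ x, E.Good x → |F x| ≤ B

instance isProbabilityMeasure_sampleLaw (p : S → stdSimplex ℝ A) :
    IsProbabilityMeasure (sampleLaw E.d E.ρ p) := by
  refine ⟨?_⟩
  have := lintegral_sampleLaw E.d_nonneg E.ρ p (F := fun _ => 1) measurable_const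
  simp only [lintegral_const, one_mul, measure_univ, mul_one] at this
  rw [this]
  have h (s : S) : ∑ a, ENNReal.ofReal (p s a) = 1 := by
    rw [← ENNReal.ofReal_sum_of_nonneg fun a _ => stdSimplex.zero_le _ _]; simp
  simp only [h, mul_one]
  rw [← ENNReal.ofReal_sum_of_nonneg fun s _ => E.d_nonneg s, E.d_sum, ENNReal.ofReal_one]

theorem integral_sampleLaw (p : S → stdSimplex ℝ A) {F : S × A × ℝ → ℝ} (hF : Measurable F)
    (hi : ∀ s a, Integrable (fun r => F (s, a, r)) (E.ρ s a)) :
    ∫ z, F z ∂(sampleLaw E.d E.ρ p) =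
      ∑ s, E.d s * ∑ a, p s a * ∫ r, F (s, a, r) ∂(E.ρ s a) := by
  have h1 (s : S) (a : A) : Integrable F
      (ENNReal.ofReal (E.d s * p s a) • (E.ρ s a).map fun r => (s, a, r)) := by
    refine Integrable.smul_measure ?_ ENNReal.ofReal_ne_top
    rw [integrable_map_measure hF.aestronglyMeasurable (by fun_prop)]
    exact hi s a
  rw [sampleLaw, integral_finsetSum_measure fun s _ => integrable_finsetSum_measure.2 fun a _ =>
    h1 s a]
  refine Finset.sum_congr rfl fun s _ => ?_
  rw [integral_finsetSum_measure fun a _ => h1 s a, Finset.mul_sum]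
  refine Finset.sum_congr rfl fun a _ => ?_
  rw [integral_smul_measure, integral_map (by fun_prop) hF.aestronglyMeasurable,
    ENNReal.toReal_ofReal (mul_nonneg (E.d_nonneg s) (stdSimplex.zero_le _ _)), smul_eq_mul,
    mul_assoc]

theorem measurable_sampleLaw {α : Type*} [MeasurableSpace α] {d : α → S → ℝ}
    {ρ : α → S → A → Measure ℝ} {p : α → S → stdSimplex ℝ A} (hd : ∀ s, Measurable fun x => d x s)
    (hρ : ∀ s a, Measurable fun x => ρ x s a) (hp : ∀ s a, Measurable fun x => p x s a) :
    Measurable fun x => sampleLaw (d x) (ρ x) (p x) := by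
  refine Measure.measurable_of_measurable_coe _ fun t ht => ?_
  simp only [sampleLaw, Measure.coe_finsetSum, Finset.sum_apply, Measure.smul_apply, smul_eq_mul]
  refine Finset.measurable_sum _ fun s _ => Finset.measurable_sum _ fun a _ =>
    ((hd s).mul (hp s a)).ennreal_ofReal.mul ?_
  exact (Measure.measurable_coe ht).comp ((Measure.measurable_map _ (by fun_prop)).comp (hρ s a))

variable {alg : CBAlgorithm S A}

theorem measurable_historyKernel (halg : alg.IsMeasurable) (t : ℕ) :
    Measurable fun x : Fin t → S × A × ℝ =>
      (sampleLaw E.d E.ρ (alg t x)).map (Fin.snoc (α := fun _ => S × A × ℝ) x) :=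
  measurable_map_family (μ := fun x => sampleLaw E.d E.ρ (alg t x))
    (measurable_sampleLaw (fun _ => measurable_const) (fun _ _ => measurable_const) (halg t))
    (f := fun x z => Fin.snoc (α := fun _ => S × A × ℝ) x z) (measurable_finSnoc t)

theorem isProbabilityMeasure_historyKernel (t : ℕ) (x : Fin t → S × A × ℝ) :
    IsProbabilityMeasure
      ((sampleLaw E.d E.ρ (alg t x)).map (Fin.snoc (α := fun _ => S × A × ℝ) x)) :=
  Measure.isProbabilityMeasure_map
    ((measurable_finSnoc t).comp (measurable_prodMk_left (x := x))).aemeasurable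

theorem isProbabilityMeasure_history (halg : alg.IsMeasurable) (t : ℕ) :
    IsProbabilityMeasure (E.history alg t) := by
  induction t with
  | zero => exact inferInstanceAs (IsProbabilityMeasure (Measure.dirac _))
  | succ t ih =>
    exact isProbabilityMeasure_bind (E.measurable_historyKernel halg t)
      (E.isProbabilityMeasure_historyKernel t)

theorem measurableSet_good (t : ℕ) : MeasurableSet {x : Fin t → S × A × ℝ | E.Good x} := by
  unfold Good
  rw [Set.ofPred_forall]
  exact MeasurableSet.iInter fun i => measurableSet_Icc.preimage (by fun_prop)

theorem ae_sampleLaw (p : S → stdSimplex ℝ A) :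
    ∀ᵐ z ∂(sampleLaw E.d E.ρ p), z.2.2 ∈ Set.Icc 0 E.R := by
  have hm : MeasurableSet {z : S × A × ℝ | ¬ z.2.2 ∈ Set.Icc 0 E.R} :=
    (measurableSet_Icc.preimage (f := fun z : S × A × ℝ => z.2.2) (by fun_prop)).compl
  rw [ae_iff, sampleLaw]
  simp only [Measure.coe_finsetSum, Finset.sum_apply, Measure.smul_apply, smul_eq_mul]
  refine Finset.sum_eq_zero fun s _ => Finset.sum_eq_zero fun a _ => ?_
  rw [Measure.map_apply (by fun_prop) hm]
  exact mul_eq_zero_of_right _ (E.ρ_mem_Icc s a)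

theorem ae_good (halg : alg.IsMeasurable) (t : ℕ) : ∀ᵐ x ∂(E.history alg t), E.Good x := by
  induction t with
  | zero => exact Filter.Eventually.of_forall fun x i => i.elim0
  | succ t ih =>
    refine ae_bind_of_forall_ae (E.measurable_historyKernel halg t) (E.measurableSet_good _) ?_
    filter_upwards [ih] with x hx
    have hm : Measurable (Fin.snoc (α := fun _ => S × A × ℝ) x) :=
      (measurable_finSnoc t).comp (measurable_prodMk_left (x := x))
    rw [ae_map_iff hm.aemeasurable (E.measurableSet_good _)]
    filter_upwards [E.ae_sampleLaw (alg t x)] with z hz using E.good_snoc hx hz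

variable {E}

theorem Nice.integrable {t : ℕ} {F : (Fin t → S × A × ℝ) → ℝ} (hF : E.Nice F)
    (halg : alg.IsMeasurable) : Integrable F (E.history alg t) := by
  have := E.isProbabilityMeasure_history halg t
  obtain ⟨hm, B, hB⟩ := hF
  refine Integrable.of_bound hm.aestronglyMeasurable B ?_
  filter_upwards [E.ae_good halg t] with x hx using hB x hx

theorem Nice.const {t : ℕ} (c : ℝ) : E.Nice (fun _ : Fin t → S × A × ℝ => c) :=
  ⟨measurable_const, |c|, fun _ _ => le_rfl⟩

theorem Nice.add {t : ℕ} {F G : (Fin t → S × A × ℝ) → ℝ} (hF : E.Nice F) (hG : E.Nice G) :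
    E.Nice fun x => F x + G x := by
  obtain ⟨hm, B, hB⟩ := hF
  obtain ⟨hm', B', hB'⟩ := hG
  exact ⟨hm.add hm', B + B', fun x hx =>
    (abs_add_le _ _).trans (add_le_add (hB x hx) (hB' x hx))⟩

theorem Nice.mul {t : ℕ} {F G : (Fin t → S × A × ℝ) → ℝ} (hF : E.Nice F) (hG : E.Nice G) :
    E.Nice fun x => F x * G x := by
  obtain ⟨hm, B, hB⟩ := hF
  obtain ⟨hm', B', hB'⟩ := hG
  refine ⟨hm.mul hm', B * B', fun x hx => ?_⟩
  rw [abs_mul]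
  exact mul_le_mul (hB x hx) (hB' x hx) (abs_nonneg _) ((abs_nonneg _).trans (hB x hx))

theorem Nice.const_mul {t : ℕ} {F : (Fin t → S × A × ℝ) → ℝ} (hF : E.Nice F) (c : ℝ) :
    E.Nice fun x => c * F x :=
  (Nice.const c).mul hF

theorem Nice.sub {t : ℕ} {F G : (Fin t → S × A × ℝ) → ℝ} (hF : E.Nice F) (hG : E.Nice G) :
    E.Nice fun x => F x - G x := by
  simpa [sub_eq_add_neg] using hF.add (hG.const_mul (-1))

theorem Nice.pow {t : ℕ} {F : (Fin t → S × A × ℝ) → ℝ} (hF : E.Nice F) (n : ℕ) :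
    E.Nice fun x => F x ^ n := by
  induction n with
  | zero => simpa using Nice.const 1
  | succ n ih => simpa [pow_succ] using ih.mul hF

theorem Nice.abs {t : ℕ} {F : (Fin t → S × A × ℝ) → ℝ} (hF : E.Nice F) :
    E.Nice fun x => |F x| := by
  obtain ⟨hm, B, hB⟩ := hF
  exact ⟨hm.abs, B, fun x hx => by simpa using hB x hx⟩

theorem Nice.sum {ι : Type*} {t : ℕ} (I : Finset ι) {F : ι → (Fin t → S × A × ℝ) → ℝ}
    (hF : ∀ i, E.Nice (F i)) : E.Nice fun x => ∑ i ∈ I, F i x := by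
  classical
  induction I using Finset.induction_on with
  | empty => simpa using Nice.const 0
  | insert i I hi ih => simpa [Finset.sum_insert hi] using (hF i).add ih

theorem Nice.comp_good {t u : ℕ} {F : (Fin t → S × A × ℝ) → ℝ} (hF : E.Nice F)
    (φ : Fin t → Fin u) : E.Nice fun x : Fin u → S × A × ℝ => F (fun i => x (φ i)) := by
  obtain ⟨hm, B, hB⟩ := hF
  exact ⟨hm.comp (by fun_prop), B, fun x hx => hB _ fun i => hx (φ i)⟩

theorem nice_alg (halg : alg.IsMeasurable) (t : ℕ) (s : S) (a : A) :
    E.Nice fun x => alg t x s a :=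
  ⟨halg t s a, 1, fun x _ => by
    rw [abs_of_nonneg (stdSimplex.zero_le _ _)]; exact stdSimplex.le_one _ _⟩

variable (E)

/-- Conditional expectation of `F` given the first `t` samples. -/
def step (alg : CBAlgorithm S A) {t : ℕ} (F : (Fin (t + 1) → S × A × ℝ) → ℝ)
    (x : Fin t → S × A × ℝ) : ℝ :=
  ∑ s, E.d s * ∑ a, alg t x s a *
    ∫ r, F (Fin.snoc (α := fun _ => S × A × ℝ) x (s, a, r)) ∂(E.ρ s a)

variable {E}

theorem Nice.integrable_snoc {t : ℕ} {F : (Fin (t + 1) → S × A × ℝ) → ℝ} (hF : E.Nice F)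
    {x : Fin t → S × A × ℝ} (hx : E.Good x) (s : S) (a : A) :
    Integrable (fun r => F (Fin.snoc (α := fun _ => S × A × ℝ) x (s, a, r))) (E.ρ s a) := by
  obtain ⟨hm, B, hB⟩ := hF
  refine Integrable.of_bound (Measurable.aestronglyMeasurable ?_) B ?_
  · exact hm.comp ((measurable_finSnoc t).comp (f := fun r : ℝ => (x, (s, a, r))) (by fun_prop))
  · filter_upwards [E.ρ_mem_Icc s a] with r hr using hB _ (E.good_snoc hx hr)

theorem Nice.step {t : ℕ} {F : (Fin (t + 1) → S × A × ℝ) → ℝ} (hF : E.Nice F)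
    (halg : alg.IsMeasurable) : E.Nice (E.step alg F) := by
  unfold Bandit.step
  refine Nice.sum _ fun s => Nice.const_mul (Nice.sum _ fun a =>
    (nice_alg halg t s a).mul ?_) _
  obtain ⟨hm, B, hB⟩ := hF
  refine ⟨?_, B, fun x hx => ?_⟩
  · refine StronglyMeasurable.measurable ?_
    refine StronglyMeasurable.integral_prod_right (ν := E.ρ s a)
      (f := fun x r => F (Fin.snoc (α := fun _ => S × A × ℝ) x (s, a, r))) ?_
    exact (hm.comp ((measurable_finSnoc t).comp
      (f := fun z : (Fin t → S × A × ℝ) × ℝ => (z.1, (s, a, z.2)))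
      (by fun_prop))).stronglyMeasurable
  · have := norm_integral_le_of_norm_le_const (μ := E.ρ s a) (C := B)
      (f := fun r => F (Fin.snoc (α := fun _ => S × A × ℝ) x (s, a, r))) (by
        filter_upwards [E.ρ_mem_Icc s a] with r hr using hB _ (E.good_snoc hx hr))
    simpa using this

theorem integral_history_succ (halg : alg.IsMeasurable) {t : ℕ}
    {F : (Fin (t + 1) → S × A × ℝ) → ℝ} (hF : E.Nice F) :
    ∫ x, F x ∂(E.history alg (t + 1)) = ∫ x, E.step alg F x ∂(E.history alg t) := by
  have := E.isProbabilityMeasure_history halg t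
  have h1 := hF.integrable halg
  rw [history] at h1 ⊢
  rw [integral_bind_family (E.measurable_historyKernel halg t)
    (E.isProbabilityMeasure_historyKernel t) h1]
  refine integral_congr_ae ?_
  filter_upwards [E.ae_good halg t] with x hx
  have hm : Measurable (Fin.snoc (α := fun _ => S × A × ℝ) x) :=
    (measurable_finSnoc t).comp (measurable_prodMk_left (x := x))
  rw [integral_map hm.aemeasurable hF.1.aestronglyMeasurable]
  exact E.integral_sampleLaw _ (hF.1.comp hm) fun s a => hF.integrable_snoc hx s a

theorem integral_history_mono (halg : alg.IsMeasurable) {t : ℕ}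
    {F G : (Fin t → S × A × ℝ) → ℝ} (hF : E.Nice F) (hG : E.Nice G)
    (h : ∀ x, E.Good x → F x ≤ G x) :
    ∫ x, F x ∂(E.history alg t) ≤ ∫ x, G x ∂(E.history alg t) := by
  refine integral_mono_ae (hF.integrable halg) (hG.integrable halg) ?_
  filter_upwards [E.ae_good halg t] with x hx using h x hx

theorem integral_history_succ_le (halg : alg.IsMeasurable) {t : ℕ}
    {F : (Fin (t + 1) → S × A × ℝ) → ℝ} {G : (Fin t → S × A × ℝ) → ℝ} (hF : E.Nice F)
    (hG : E.Nice G) (h : ∀ x, E.Good x → E.step alg F x ≤ G x) :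
    ∫ x, F x ∂(E.history alg (t + 1)) ≤ ∫ x, G x ∂(E.history alg t) := by
  rw [integral_history_succ halg hF]
  exact integral_history_mono halg (hF.step halg) hG h

theorem integral_history_const (halg : alg.IsMeasurable) {t : ℕ} (c : ℝ) :
    ∫ _, c ∂(E.history alg t) = c := by
  have := E.isProbabilityMeasure_history halg t
  simp

/-- Later rounds do not change the law of earlier samples: a function of the first `t` samples is
its own conditional expectation. -/
theorem integral_history_castAdd (halg : alg.IsMeasurable) {t : ℕ}
    {F : (Fin t → S × A × ℝ) → ℝ} (hF : E.Nice F) (j : ℕ) :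
    ∫ x, F (fun i => x (Fin.castAdd j i)) ∂(E.history alg (t + j)) =
      ∫ x, F x ∂(E.history alg t) := by
  induction j with
  | zero => rfl
  | succ j ih =>
    rw [← ih]
    refine (integral_history_succ (t := t + j) halg
      (F := fun x : Fin (t + j + 1) → S × A × ℝ => F (fun i => x (Fin.castAdd (j + 1) i)))
      (hF.comp_good _)).trans ?_
    congr 1
    ext x
    unfold Bandit.step
    have h1 (z : S × A × ℝ) (i : Fin t) : Fin.snoc (α := fun _ => S × A × ℝ) x z
        (Fin.castAdd (j + 1) i) = x (Fin.castAdd j i) :=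
      Fin.snoc_castSucc (α := fun _ => S × A × ℝ) z x (Fin.castAdd j i)
    simp only [h1, integral_const, probReal_univ, one_smul]
    exact E.sum_d_mul_sum _ _

end History

section Step

variable {S A : Type*} [Fintype S] [Fintype A] {E : Bandit S A} {alg : CBAlgorithm S A}

-- A round changes the statistics of one cell `(s, a)` only when that cell is drawn, which has
-- probability `E.d s * alg t x s a`.
open Classical in
theorem step_eq_of_single {t : ℕ} {F : (Fin (t + 1) → S × A × ℝ) → ℝ} {x : Fin t → S × A × ℝ}
    {s : S} {a : A} {F₀ : ℝ} {G : ℝ → ℝ} (hG : Integrable G (E.ρ s a))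
    (h : ∀ z : S × A × ℝ, F (Fin.snoc (α := fun _ => S × A × ℝ) x z) =
      if z.1 = s ∧ z.2.1 = a then G z.2.2 else F₀) :
    E.step alg F x = F₀ + E.d s * alg t x s a * (∫ r, G r ∂(E.ρ s a) - F₀) := by
  unfold Bandit.step
  have h1 : ∀ s' a', ∫ r, F (Fin.snoc (α := fun _ => S × A × ℝ) x (s', a', r)) ∂(E.ρ s' a') =
      F₀ + if s' = s then (if a' = a then (∫ r, G r ∂(E.ρ s a) - F₀) else 0) else 0 := by
    intro s' a'
    simp only [h]
    by_cases h1 : s' = s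
    · by_cases h2 : a' = a
      · subst h1 h2; simp
      · simp [h2]
    · simp [h1]
  simp only [h1, mul_add, Finset.sum_add_distrib, E.sum_d_mul_sum]
  rw [Finset.sum_eq_single s (fun b _ hb => by simp [hb]) (by simp),
    Finset.sum_eq_single a (fun b _ hb => by simp [hb]) (by simp)]
  simp [mul_assoc]

end Step

end Bandit

/-! ### Counts, deviations and empirical means -/

section Counts

variable {S A : Type*} {t : ℕ}

open Classical in
/-- Number of rounds `i ≥ lo` in which `a` was played in context `s`. -/
def count (x : Fin t → S × A × ℝ) (lo : ℕ) (s : S) (a : A) : ℝ :=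
  ∑ i : Fin t, if lo ≤ (i : ℕ) ∧ (x i).1 = s ∧ (x i).2.1 = a then 1 else 0

open Classical in
/-- Sum of the deviations from `m` of the rewards of `a` in context `s` over the rounds `i ≥ lo`. -/
def deviation (x : Fin t → S × A × ℝ) (lo : ℕ) (s : S) (a : A) (m : ℝ) : ℝ :=
  ∑ i : Fin t, if lo ≤ (i : ℕ) ∧ (x i).1 = s ∧ (x i).2.1 = a then (x i).2.2 - m else 0

open Classical in
theorem count_snoc (x : Fin t → S × A × ℝ) {lo : ℕ} (hlo : lo ≤ t) (s : S) (a : A)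
    (z : S × A × ℝ) : count (Fin.snoc (α := fun _ => S × A × ℝ) x z) lo s a =
      count x lo s a + if z.1 = s ∧ z.2.1 = a then 1 else 0 := by
  simp only [count, Fin.sum_univ_castSucc, Fin.snoc_castSucc, Fin.snoc_last, Fin.val_castSucc,
    Fin.val_last, hlo, true_and]

open Classical in
theorem deviation_snoc (x : Fin t → S × A × ℝ) {lo : ℕ} (hlo : lo ≤ t) (s : S) (a : A) (m : ℝ)
    (z : S × A × ℝ) : deviation (Fin.snoc (α := fun _ => S × A × ℝ) x z) lo s a m =
      deviation x lo s a m + if z.1 = s ∧ z.2.1 = a then z.2.2 - m else 0 := by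
  simp [deviation, Fin.sum_univ_castSucc, hlo]

theorem count_self (x : Fin t → S × A × ℝ) (s : S) (a : A) : count x t s a = 0 :=
  Finset.sum_eq_zero fun i _ => if_neg fun h => absurd i.2 (not_lt.2 h.1)

theorem deviation_self (x : Fin t → S × A × ℝ) (s : S) (a : A) (m : ℝ) :
    deviation x t s a m = 0 :=
  Finset.sum_eq_zero fun i _ => if_neg fun h => absurd i.2 (not_lt.2 h.1)

theorem count_nonneg (x : Fin t → S × A × ℝ) (lo : ℕ) (s : S) (a : A) : 0 ≤ count x lo s a :=
  Finset.sum_nonneg fun i _ => by split_ifs <;> simp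

theorem count_le (x : Fin t → S × A × ℝ) (lo : ℕ) (s : S) (a : A) : count x lo s a ≤ t := by
  have : count x lo s a ≤ ∑ _i : Fin t, (1 : ℝ) :=
    Finset.sum_le_sum fun i _ => by split_ifs <;> simp
  simpa using this

theorem one_le_count (x : Fin t → S × A × ℝ) (lo : ℕ) (s : S) (a : A) (h : count x lo s a ≠ 0) :
    1 ≤ count x lo s a := by
  classical
  obtain ⟨i, _, hi⟩ := Finset.exists_ne_zero_of_sum_ne_zero h
  have h1 := Finset.single_le_sum (f := fun i : Fin t =>
    if lo ≤ (i : ℕ) ∧ (x i).1 = s ∧ (x i).2.1 = a then (1 : ℝ) else 0)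
    (fun j _ => by split_ifs <;> simp) (Finset.mem_univ i)
  have h2 : (if lo ≤ (i : ℕ) ∧ (x i).1 = s ∧ (x i).2.1 = a then (1 : ℝ) else 0) = 1 := by
    by_cases h3 : lo ≤ (i : ℕ) ∧ (x i).1 = s ∧ (x i).2.1 = a
    · rw [if_pos h3]
    · simp [h3] at hi
  simp only [h2] at h1
  exact h1

open Classical in
theorem sum_count_le [Fintype S] [Fintype A] (x : Fin t → S × A × ℝ) (lo : ℕ) :
    ∑ s, ∑ a, count x lo s a ≤ t := by
  have h : ∀ i : Fin t, ∑ s, ∑ a,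
      (if lo ≤ (i : ℕ) ∧ (x i).1 = s ∧ (x i).2.1 = a then (1 : ℝ) else 0) ≤ 1 := by
    intro i
    rw [Finset.sum_eq_single (x i).1 (fun b _ hb => Finset.sum_eq_zero fun a _ =>
      if_neg fun h => hb h.2.1.symm) (by simp), Finset.sum_eq_single (x i).2.1 (fun b _ hb =>
      if_neg fun h => hb h.2.2.symm) (by simp)]
    split_ifs <;> simp
  have h2 : ∑ s, ∑ a, count x lo s a = ∑ i : Fin t, ∑ s, ∑ a,
      (if lo ≤ (i : ℕ) ∧ (x i).1 = s ∧ (x i).2.1 = a then (1 : ℝ) else 0) := by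
    unfold count
    rw [Finset.sum_comm]
    simp_rw [Finset.sum_comm (s := (Finset.univ : Finset S)) (t := (Finset.univ : Finset (Fin t)))]
    rw [Finset.sum_comm]
    exact Finset.sum_congr rfl fun i _ => Finset.sum_comm
  rw [h2]
  simpa using Finset.sum_le_sum fun i (_ : i ∈ (Finset.univ : Finset (Fin t))) => h i

theorem empMean_eq (x : Fin t → S × A × ℝ) {lo hi : ℕ} (hhi : t ≤ hi) (s : S) (a : A) :
    empMean x lo hi s a = deviation x lo s a 0 / count x lo s a := by
  classical
  have h : ∀ i : Fin t, (i : ℕ) < hi := fun i => i.2.trans_le hhi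
  simp only [empMean, deviation, count, h, true_and, sub_zero, Finset.sum_ite, Finset.sum_const_zero,
    add_zero, Finset.sum_const, nsmul_eq_mul, mul_one]

theorem deviation_eq (x : Fin t → S × A × ℝ) (lo : ℕ) (s : S) (a : A) (m : ℝ) :
    deviation x lo s a m = deviation x lo s a 0 - count x lo s a * m := by
  classical
  rw [count, Finset.sum_mul, deviation, deviation, ← Finset.sum_sub_distrib]
  refine Finset.sum_congr rfl fun i _ => ?_
  split_ifs <;> simp

theorem empMean_sub_eq (x : Fin t → S × A × ℝ) {lo hi : ℕ} (hhi : t ≤ hi) (s : S) (a : A) (m : ℝ)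
    (h : count x lo s a ≠ 0) :
    empMean x lo hi s a - m = deviation x lo s a m / count x lo s a := by
  rw [empMean_eq x hhi, deviation_eq x lo s a m]
  field_simp

/-- This reduces every window of rounds to one that ends with the history, where `empMean_eq`
applies. -/
theorem empMean_castAdd {j : ℕ} (x : Fin (t + j) → S × A × ℝ) (lo : ℕ) (s : S) (a : A) {hi : ℕ}
    (hhi : hi ≤ t) :
    empMean (fun i => x (Fin.castAdd j i)) lo hi s a = empMean x lo hi s a := by
  classical
  have key : ∀ f : Fin (t + j) → ℝ,
      ∑ i ∈ Finset.univ.filter (fun i : Fin t => lo ≤ (i : ℕ) ∧ (i : ℕ) < hi ∧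
        (x (Fin.castAdd j i)).1 = s ∧ (x (Fin.castAdd j i)).2.1 = a), f (Fin.castAdd j i) =
      ∑ i ∈ Finset.univ.filter (fun i : Fin (t + j) => lo ≤ (i : ℕ) ∧ (i : ℕ) < hi ∧
        (x i).1 = s ∧ (x i).2.1 = a), f i := by
    intro f
    rw [Finset.sum_filter, Finset.sum_filter, Fin.sum_univ_add]
    have h2 : ∀ i : Fin j, ¬ (t + (i : ℕ) < hi) := fun i => by omega
    simp [h2]
  have k1 := key fun i => (x i).2.2
  have k2 := key fun _ => 1
  simp only [Finset.sum_const, nsmul_eq_mul, mul_one] at k2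
  simp only [empMean]
  rw [k1, k2]

variable [MeasurableSpace S] [DiscreteMeasurableSpace S] [MeasurableSpace A]
  [DiscreteMeasurableSpace A]

theorem measurableSet_played (lo : ℕ) (i : Fin t) (s : S) (a : A) :
    MeasurableSet {x : Fin t → S × A × ℝ | lo ≤ (i : ℕ) ∧ (x i).1 = s ∧ (x i).2.1 = a} := by
  have h1 : MeasurableSet {x : Fin t → S × A × ℝ | (x i).1 = s} :=
    (MeasurableSet.of_discrete (s := {s})).preimage
      (f := fun x : Fin t → S × A × ℝ => (x i).1) (by fun_prop)
  have h2 : MeasurableSet {x : Fin t → S × A × ℝ | (x i).2.1 = a} :=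
    (MeasurableSet.of_discrete (s := {a})).preimage
      (f := fun x : Fin t → S × A × ℝ => (x i).2.1) (by fun_prop)
  exact (MeasurableSet.const _).inter (h1.inter h2)

@[fun_prop]
theorem measurable_count (lo : ℕ) (s : S) (a : A) :
    Measurable fun x : Fin t → S × A × ℝ => count x lo s a := by
  classical
  exact Finset.measurable_sum _ fun i _ =>
    Measurable.ite (measurableSet_played lo i s a) measurable_const measurable_const

@[fun_prop]
theorem measurable_deviation (lo : ℕ) (s : S) (a : A) (m : ℝ) :
    Measurable fun x : Fin t → S × A × ℝ => deviation x lo s a m := by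
  classical
  exact Finset.measurable_sum _ fun i _ =>
    Measurable.ite (measurableSet_played lo i s a) (by fun_prop) measurable_const

theorem measurable_empMean (lo hi : ℕ) (s : S) (a : A) :
    Measurable fun x : Fin t → S × A × ℝ => empMean x lo hi s a := by
  rcases le_total t hi with h | h
  · simp only [empMean_eq _ h]
    fun_prop
  · obtain ⟨j, rfl⟩ := Nat.exists_eq_add_of_le h
    simp only [← empMean_castAdd _ lo s a (le_refl hi), empMean_eq _ (le_refl hi)]
    exact ((measurable_deviation lo s a 0).div (measurable_count lo s a)).comp
      (f := fun (x : Fin (hi + j) → S × A × ℝ) i => x (Fin.castAdd j i)) (by fun_prop)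

end Counts

namespace Bandit

section GoodHistories

variable {S A : Type*} [Fintype S] [Fintype A] {E : Bandit S A} {t : ℕ}

theorem Good.abs_deviation_le {x : Fin t → S × A × ℝ} (hx : E.Good x) (lo : ℕ) (s : S) (a : A) :
    |deviation x lo s a (E.mean s a)| ≤ count x lo s a * E.R := by
  classical
  rw [count, Finset.sum_mul, deviation]
  refine (Finset.abs_sum_le_sum_abs _ _).trans (Finset.sum_le_sum fun i _ => ?_)
  split_ifs
  · simpa using E.reward_sub_mem (hx i)
  · simp

theorem Good.abs_empMean_sub_le {x : Fin t → S × A × ℝ} (hx : E.Good x) {lo hi : ℕ}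
    (hhi : t ≤ hi) (s : S) (a : A) : |empMean x lo hi s a - E.mean s a| ≤ E.R := by
  -- Without observations the estimate is the default `0`; since the mean lies in `[0, R]`, the
  -- error is still at most `R`.
  by_cases h : count x lo s a = 0
  · rw [empMean_eq x hhi, h, div_zero, zero_sub, abs_neg, abs_of_nonneg (E.mean_mem s a).1]
    exact (E.mean_mem s a).2
  · rw [empMean_sub_eq x hhi s a _ h, abs_div, abs_of_nonneg (count_nonneg x lo s a),
      div_le_iff₀ (lt_of_le_of_ne (count_nonneg x lo s a) (Ne.symm h)), mul_comm]
    exact hx.abs_deviation_le lo s a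

variable {alg : CBAlgorithm S A}

theorem step_count_deviation {F : (Fin (t + 1) → S × A × ℝ) → ℝ}
    {x : Fin t → S × A × ℝ} {lo : ℕ} (hlo : lo ≤ t) {s : S} {a : A} (φ : ℝ → ℝ → ℝ)
    (hφ : Integrable (fun r => φ (count x lo s a + 1)
      (deviation x lo s a (E.mean s a) + (r - E.mean s a))) (E.ρ s a))
    (hF : ∀ z, F (Fin.snoc (α := fun _ => S × A × ℝ) x z) =
      φ (count (Fin.snoc (α := fun _ => S × A × ℝ) x z) lo s a)
        (deviation (Fin.snoc (α := fun _ => S × A × ℝ) x z) lo s a (E.mean s a))) :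
    E.step alg F x = φ (count x lo s a) (deviation x lo s a (E.mean s a)) +
      E.d s * alg t x s a * (∫ r, φ (count x lo s a + 1)
        (deviation x lo s a (E.mean s a) + (r - E.mean s a)) ∂(E.ρ s a) -
          φ (count x lo s a) (deviation x lo s a (E.mean s a))) := by
  classical
  refine step_eq_of_single hφ fun z => ?_
  rw [hF, count_snoc x hlo, deviation_snoc x hlo]
  split_ifs <;> simp

end GoodHistories

section NiceEmpMean

variable {S A : Type*} [Fintype S] [Fintype A] [MeasurableSpace S] [DiscreteMeasurableSpace S]
  [MeasurableSpace A] [DiscreteMeasurableSpace A] {E : Bandit S A} {t : ℕ}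

theorem nice_empMean_sub (lo hi : ℕ) (s : S) (a : A) :
    E.Nice fun x : Fin t → S × A × ℝ => empMean x lo hi s a - E.mean s a := by
  refine ⟨(measurable_empMean lo hi s a).sub_const _, E.R, fun x hx => ?_⟩
  rcases le_total t hi with h | h
  · exact hx.abs_empMean_sub_le h s a
  · obtain ⟨j, rfl⟩ := Nat.exists_eq_add_of_le h
    simp only
    rw [← empMean_castAdd _ lo s a (le_refl hi)]
    exact Good.abs_empMean_sub_le (E := E) (x := fun i => x (Fin.castAdd j i))
      (fun i => hx _) le_rfl s a

theorem nice_deviation (lo : ℕ) (s : S) (a : A) :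
    E.Nice fun x : Fin t → S × A × ℝ => deviation x lo s a (E.mean s a) :=
  ⟨measurable_deviation lo s a _, t * E.R, fun x hx => (hx.abs_deviation_le lo s a).trans
    (mul_le_mul_of_nonneg_right (count_le x lo s a) E.R_nonneg)⟩

end NiceEmpMean

end Bandit

/-! ### Mean squared error of an empirical mean -/

/-- Potential for the squared error of an empirical mean of `k` rewards with deviation sum `M`,
when every round brings an observation with probability at least `q`. -/
def msePotential (R ℓ q w k M : ℝ) : ℝ :=
  q * (4 * ((M / (k + q * ℓ / 4)) ^ 2 + R ^ 2 / (k + q * ℓ / 4)) +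
    R ^ 2 * Real.exp (q * ℓ / 4 - k) * w)

/-- An observation adds at most `R² / (κ + 1)²` to the mean of the squared regularised average. The
fall of `R² / κ` pays for it, because `1/κ - 1/(κ+1) ≥ 1/(κ+1)²`. -/
theorem sq_div_add_le {κ M v R : ℝ} (hκ : 0 < κ) (hv : v ≤ R ^ 2) :
    (M ^ 2 + v) / (κ + 1) ^ 2 + R ^ 2 / (κ + 1) ≤ (M / κ) ^ 2 + R ^ 2 / κ := by
  have h1 : M ^ 2 / (κ + 1) ^ 2 ≤ M ^ 2 / κ ^ 2 :=
    div_le_div_of_nonneg_left (sq_nonneg _) (by positivity) (by gcongr; linarith)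
  have h2 : v / (κ + 1) ^ 2 ≤ R ^ 2 / (κ + 1) ^ 2 := by gcongr
  have h3 : R ^ 2 / (κ + 1) ^ 2 + R ^ 2 / (κ + 1) ≤ R ^ 2 / κ := by
    rw [div_add_div _ _ (by positivity) (by positivity), div_le_div_iff₀ (by positivity) hκ]
    nlinarith [mul_nonneg (sq_nonneg R) (by positivity : (0 : ℝ) ≤ κ + 1)]
  rw [add_div, div_pow]
  linarith

theorem exp_neg_one_le_half : Real.exp (-1) ≤ 1 / 2 := by
  rw [Real.exp_neg, inv_eq_one_div]
  exact one_div_le_one_div_of_le two_pos (by linarith [Real.add_one_le_exp (1 : ℝ)])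

/-- The bound is uniform in `q`, which is needed because `q` will be random. The factor `q` in front
of the potential compensates the small denominator `q ℓ / 4`. -/
theorem abs_msePotential_le {R ℓ q w k M : ℝ} (hℓ : 0 < ℓ) (hq : 0 ≤ q) (hq1 : q ≤ 1)
    (hw : 0 ≤ w) (hw1 : w ≤ 1) (hk : 0 ≤ k) (hM : |M| ≤ k * R) :
    |msePotential R ℓ q w k M| ≤ 4 * R ^ 2 + 16 * R ^ 2 / ℓ + R ^ 2 * Real.exp ℓ := by
  rcases hq.eq_or_lt with rfl | hq0
  · simp only [msePotential, zero_mul, abs_zero]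
    positivity
  have hκ : 0 < k + q * ℓ / 4 := by positivity
  have h1 : (M / (k + q * ℓ / 4)) ^ 2 ≤ R ^ 2 := by
    rw [div_pow, div_le_iff₀ (by positivity), ← sq_abs M, mul_comm, ← mul_pow]
    have hR : 0 ≤ k * R := (abs_nonneg _).trans hM
    have : |M| ≤ (k + q * ℓ / 4) * |R| := by
      have := mul_le_mul_of_nonneg_left (le_abs_self R) hk
      have h3 : 0 ≤ q * ℓ / 4 * |R| := by positivity
      nlinarith
    calc |M| ^ 2 ≤ ((k + q * ℓ / 4) * |R|) ^ 2 := by gcongr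
      _ = _ := by rw [mul_pow, sq_abs, mul_pow]
  have h2 : q * (R ^ 2 / (k + q * ℓ / 4)) ≤ 4 * R ^ 2 / ℓ := by
    rw [← mul_div_assoc, div_le_div_iff₀ hκ hℓ]
    nlinarith [mul_nonneg (sq_nonneg R) hk]
  have h3 : Real.exp (q * ℓ / 4 - k) ≤ Real.exp ℓ := Real.exp_le_exp.2 (by nlinarith)
  have h4 : 0 ≤ msePotential R ℓ q w k M := by unfold msePotential; positivity
  rw [abs_of_nonneg h4, msePotential]
  have h5 : q * (M / (k + q * ℓ / 4)) ^ 2 ≤ 1 * R ^ 2 :=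
    mul_le_mul hq1 h1 (sq_nonneg _) zero_le_one
  have h6 : q * (R ^ 2 * Real.exp (q * ℓ / 4 - k) * w) ≤ 1 * (R ^ 2 * Real.exp ℓ * 1) := by
    gcongr
  have h7 : 16 * R ^ 2 / ℓ = 4 * (4 * R ^ 2 / ℓ) := by ring
  rw [h7]
  nlinarith

/-- The potential decreases on average. -/
theorem msePotential_step_le {R ℓ q w k M v P Z : ℝ} (hℓ : 0 < ℓ) (hq : 0 < q)
    (hk : 0 ≤ k) (hw : 0 ≤ w) (hv : v ≤ M ^ 2 + R ^ 2) (hP : q ≤ P)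
    (hZ : Z = q * (4 * (v / (k + 1 + q * ℓ / 4) ^ 2 + R ^ 2 / (k + 1 + q * ℓ / 4)) +
      R ^ 2 * Real.exp (q * ℓ / 4 - (k + 1)) * w)) :
    msePotential R ℓ q w k M + P * (Z - msePotential R ℓ q w k M) ≤
      msePotential R ℓ q ((1 - q / 2) * w) k M := by
  have hκ : 0 < k + q * ℓ / 4 := by positivity
  have h1 := sq_div_add_le (M := M) (v := v - M ^ 2) (R := R) hκ (by linarith)
  rw [add_sub_cancel, show k + q * ℓ / 4 + 1 = k + 1 + q * ℓ / 4 by ring] at h1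
  -- An observation at least halves the exponential term and comes with probability at least `q`,
  -- hence the factor `1 - q / 2` per round in the weight `w`.
  have h2 : Real.exp (q * ℓ / 4 - (k + 1)) ≤ Real.exp (q * ℓ / 4 - k) / 2 := by
    rw [show q * ℓ / 4 - (k + 1) = q * ℓ / 4 - k + -1 by ring, Real.exp_add]
    have := mul_le_mul_of_nonneg_left exp_neg_one_le_half (Real.exp_pos (q * ℓ / 4 - k)).le
    linarith
  set e := Real.exp (q * ℓ / 4 - k)
  have he : 0 < e := Real.exp_pos _
  have h3 : R ^ 2 * Real.exp (q * ℓ / 4 - (k + 1)) * w ≤ R ^ 2 * (e / 2) * w := by gcongr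
  have h4 : Z - msePotential R ℓ q w k M ≤ q * (-(R ^ 2 * e * w / 2)) := by
    rw [hZ, msePotential, ← mul_sub]
    refine mul_le_mul_of_nonneg_left ?_ hq.le
    linarith
  have h5 : 0 ≤ R ^ 2 * e * w := by positivity
  have h6 : P * (Z - msePotential R ℓ q w k M) ≤ P * (q * (-(R ^ 2 * e * w / 2))) :=
    mul_le_mul_of_nonneg_left h4 (hq.le.trans hP)
  have h7 : q * (q * (R ^ 2 * e * w / 2)) ≤ P * (q * (R ^ 2 * e * w / 2)) :=
    mul_le_mul_of_nonneg_right hP (by positivity)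
  have h8 : msePotential R ℓ q ((1 - q / 2) * w) k M =
      msePotential R ℓ q w k M - q * (q * (R ^ 2 * e * w / 2)) := by
    simp only [msePotential]; ring
  rw [h8]
  linarith

/-- The regulariser contributes `16 R² / ℓ`. The exponential term is at most `q R² exp (-q ℓ / 4)`,
and `exp (-x) ≤ 1 / x` bounds it by `4 R² / ℓ`. -/
theorem msePotential_zero_le {R ℓ q : ℝ} {n : ℕ} (hℓ : ℓ = n) (hn : 0 < ℓ) (hq : 0 ≤ q)
    (hq1 : q ≤ 1) : msePotential R ℓ q ((1 - q / 2) ^ n) 0 0 ≤ 20 * R ^ 2 / ℓ := by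
  rcases hq.eq_or_lt with rfl | hq0
  · simp only [msePotential, zero_mul]
    positivity
  have h1 : (1 - q / 2) ^ n ≤ Real.exp (-(q / 2 * ℓ)) := by
    calc (1 - q / 2) ^ n ≤ Real.exp (-(q / 2)) ^ n :=
          pow_le_pow_left₀ (by linarith) (Real.one_sub_le_exp_neg _) n
      _ = Real.exp (-(q / 2 * ℓ)) := by rw [← Real.exp_nat_mul, hℓ]; ring_nf
  have h2 : Real.exp (q * ℓ / 4 - 0) * (1 - q / 2) ^ n ≤ 4 / (q * ℓ) := by
    calc Real.exp (q * ℓ / 4 - 0) * (1 - q / 2) ^ n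
        ≤ Real.exp (q * ℓ / 4 - 0) * Real.exp (-(q / 2 * ℓ)) := by gcongr
      _ = (Real.exp (q * ℓ / 4))⁻¹ := by rw [← Real.exp_add, ← Real.exp_neg]; ring_nf
      _ ≤ (q * ℓ / 4)⁻¹ := by
          gcongr
          linarith [Real.add_one_le_exp (q * ℓ / 4)]
      _ = 4 / (q * ℓ) := by rw [inv_div]
  have h3 : q * (R ^ 2 * (Real.exp (q * ℓ / 4 - 0) * (1 - q / 2) ^ n)) ≤
      q * (R ^ 2 * (4 / (q * ℓ))) := by gcongr
  have h4 : q * (R ^ 2 * (4 / (q * ℓ))) = 4 * R ^ 2 / ℓ := by field_simp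
  have h5 : q * (4 * (R ^ 2 / (0 + q * ℓ / 4))) = 16 * R ^ 2 / ℓ := by field_simp; ring
  have h6 : 20 * R ^ 2 / ℓ = 16 * R ^ 2 / ℓ + 4 * R ^ 2 / ℓ := by ring
  rw [msePotential, h6, ← h5]
  rw [h4] at h3
  have h7 : (0 : ℝ) / (0 + q * ℓ / 4) = 0 := zero_div _
  rw [h7]
  linarith

/-- The potential dominates the squared error. -/
theorem mul_sq_le_msePotential {R ℓ q k M e : ℝ} (hℓ : 0 < ℓ) (hq : 0 ≤ q) (hk : 0 ≤ k)
    (he : |e| ≤ R) (hM : k ≠ 0 → e = M / k) :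
    q * e ^ 2 ≤ msePotential R ℓ q 1 k M := by
  rcases hq.eq_or_lt with rfl | hq0
  · simp [msePotential]
  refine mul_le_mul_of_nonneg_left ?_ hq
  have he2 : e ^ 2 ≤ R ^ 2 := sq_le_sq.2 (he.trans (le_abs_self R))
  -- With fewer than `q ℓ / 4` observations the exponential exceeds `1` and pays for the trivial
  -- bound `R²`. Otherwise the regularised denominator is at most `2 k`, whence the factor `4`.
  rcases lt_or_ge k (q * ℓ / 4) with h | h
  · have h1 : 1 ≤ Real.exp (q * ℓ / 4 - k) := Real.one_le_exp (by linarith)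
    have h2 : 0 ≤ 4 * ((M / (k + q * ℓ / 4)) ^ 2 + R ^ 2 / (k + q * ℓ / 4)) := by positivity
    nlinarith [sq_nonneg R]
  · have hk0 : 0 < k := lt_of_lt_of_le (by positivity) h
    rw [hM hk0.ne']
    have h1 : (M / k) ^ 2 ≤ 4 * (M / (k + q * ℓ / 4)) ^ 2 := by
      rw [div_pow, div_pow, ← mul_div_assoc, div_le_div_iff₀ (by positivity) (by positivity)]
      have : (k + q * ℓ / 4) ^ 2 ≤ (2 * k) ^ 2 := by gcongr; linarith
      nlinarith [mul_le_mul_of_nonneg_left this (sq_nonneg M)]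
    have h2 : 0 ≤ 4 * (R ^ 2 / (k + q * ℓ / 4)) := by positivity
    have h3 : 0 ≤ R ^ 2 * Real.exp (q * ℓ / 4 - k) * 1 := by positivity
    linarith

namespace Bandit

variable {S A : Type*} [Fintype S] [Fintype A] [MeasurableSpace S] [DiscreteMeasurableSpace S]
  [MeasurableSpace A] [DiscreteMeasurableSpace A] {E : Bandit S A} {alg : CBAlgorithm S A}

/-- Mean squared error of the empirical mean over `ℓ` rounds, in each of which the action `a` is
played in context `s` with a probability of at least `q`, a function of the earlier samples. -/
theorem integral_mul_sq_empMean_sub_le (halg : alg.IsMeasurable) (s : S) (a : A) (lo ℓ : ℕ)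
    (hℓ : 0 < ℓ) {q : (Fin lo → S × A × ℝ) → ℝ} (hq : Measurable q) (hq0 : ∀ y, 0 ≤ q y)
    (hq1 : ∀ y, q y ≤ 1)
    (hP : ∀ j < ℓ, ∀ x : Fin (lo + j) → S × A × ℝ,
      q (fun i => x (Fin.castAdd j i)) ≤ E.d s * alg (lo + j) x s a) :
    ∫ x, q (fun i => x (Fin.castAdd ℓ i)) * (empMean x lo (lo + ℓ) s a - E.mean s a) ^ 2
      ∂(E.history alg (lo + ℓ)) ≤ 20 * E.R ^ 2 / ℓ := by
  have hℓ' : (0 : ℝ) < ℓ := by exact_mod_cast hℓ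
  -- The probability `q` is frozen at the first `lo` samples, and the exponent counts the remaining
  -- rounds, so the weight is `1` at the end.
  let Φ : (j : ℕ) → (Fin (lo + j) → S × A × ℝ) → ℝ := fun j x =>
    msePotential E.R ℓ (q fun i => x (Fin.castAdd j i))
      ((1 - q (fun i => x (Fin.castAdd j i)) / 2) ^ (ℓ - j)) (count x lo s a)
      (deviation x lo s a (E.mean s a))
  have hw : ∀ (y : Fin lo → S × A × ℝ) (i : ℕ),
      0 ≤ (1 - q y / 2) ^ i ∧ (1 - q y / 2) ^ i ≤ 1 := fun y i =>
    ⟨pow_nonneg (by linarith [hq1 y]) _,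
      pow_le_one₀ (by linarith [hq1 y]) (by linarith [hq0 y])⟩
  have hΦ : ∀ j, E.Nice (Φ j) := by
    intro j
    refine ⟨?_, _, fun x hx => abs_msePotential_le hℓ' (hq0 _) (hq1 _) (hw _ _).1 (hw _ _).2
      (count_nonneg _ _ _ _) (hx.abs_deviation_le lo s a)⟩
    have hq' : Measurable fun x : Fin (lo + j) → S × A × ℝ => q fun i => x (Fin.castAdd j i) :=
      hq.comp (by fun_prop)
    simp only [Φ, msePotential]
    fun_prop
  have hstep : ∀ j < ℓ, ∀ x, E.Good x → E.step alg (t := lo + j) (Φ (j + 1)) x ≤ Φ j x := by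
    intro j hj x hx
    set y : Fin lo → S × A × ℝ := fun i => x (Fin.castAdd j i) with hy
    have hsnoc : ∀ z : S × A × ℝ, (fun i : Fin lo =>
        (Fin.snoc (α := fun _ => S × A × ℝ) x z : Fin (lo + j + 1) → S × A × ℝ)
          (Fin.castAdd (j + 1) i)) = y := fun z => funext fun i =>
      Fin.snoc_castSucc (α := fun _ => S × A × ℝ) z x (Fin.castAdd j i)
    have hint : Integrable (fun r => msePotential E.R ℓ (q y) ((1 - q y / 2) ^ (ℓ - (j + 1)))
        (count x lo s a + 1) (deviation x lo s a (E.mean s a) + (r - E.mean s a)))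
        (E.ρ s a) := by
      simp only [msePotential, div_pow]
      exact (((((E.integrable_add_reward_sub_sq _ s a).div_const _).add
        (integrable_const _)).const_mul 4).add (integrable_const _)).const_mul _
    rw [step_count_deviation (F := Φ (j + 1)) (Nat.le_add_right lo j)
      (fun k M => msePotential E.R ℓ (q y) ((1 - q y / 2) ^ (ℓ - (j + 1))) k M) hint
      (fun z => by simp only [Φ]; rw [hsnoc])]
    have hΦj : Φ j x = msePotential E.R ℓ (q y)
        ((1 - q y / 2) * (1 - q y / 2) ^ (ℓ - (j + 1))) (count x lo s a)
        (deviation x lo s a (E.mean s a)) := by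
      rw [← pow_succ', show ℓ - (j + 1) + 1 = ℓ - j by omega]
    rw [hΦj]
    rcases (hq0 y).eq_or_lt with h0 | h0
    · simp [msePotential, ← h0]
    · refine msePotential_step_le hℓ' h0 (count_nonneg _ _ _ _) (hw _ _).1
        (E.integral_add_reward_sub_sq_le (deviation x lo s a (E.mean s a)) s a) (hP j hj x) ?_
      simp only [msePotential, div_pow]
      -- The potential is affine in the squared deviation, so its integral needs only the second
      -- moment.
      have haff : ∀ K c e : ℝ, ∫ r, q y * (4 * ((deviation x lo s a (E.mean s a) +
          (r - E.mean s a)) ^ 2 / K + c) + e) ∂(E.ρ s a) =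
          q y * (4 * ((∫ r, (deviation x lo s a (E.mean s a) + (r - E.mean s a)) ^ 2 ∂(E.ρ s a)) /
            K + c) + e) := by
        intro K c e
        have h1 : ∀ r : ℝ, q y * (4 * ((deviation x lo s a (E.mean s a) +
            (r - E.mean s a)) ^ 2 / K + c) + e) = q y * 4 / K * (deviation x lo s a (E.mean s a) +
            (r - E.mean s a)) ^ 2 + q y * (4 * c + e) := fun r => by ring
        simp_rw [h1]
        rw [integral_add ((E.integrable_add_reward_sub_sq _ s a).const_mul _) (integrable_const _),
          integral_const_mul]
        simp only [integral_const, probReal_univ, one_smul]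
        ring
      exact haff _ _ _
  have hmono : ∀ j ≤ ℓ, ∫ x, Φ j x ∂(E.history alg (lo + j)) ≤ 20 * E.R ^ 2 / ℓ := by
    intro j
    induction j with
    | zero =>
      intro _
      refine (integral_history_mono halg (hΦ 0) (Nice.const (20 * E.R ^ 2 / ℓ)) fun x _ => ?_).trans
        (integral_history_const halg _).le
      simp only [Φ]
      rw [show count x lo s a = 0 from count_self (t := lo) x s a,
        show deviation x lo s a (E.mean s a) = 0 from deviation_self (t := lo) x s a _]
      exact msePotential_zero_le rfl hℓ' (hq0 _) (hq1 _)
    | succ j ih =>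
      intro hj
      exact (integral_history_succ_le (t := lo + j) halg (hΦ (j + 1)) (hΦ j)
        (hstep j hj)).trans (ih (by omega))
  have hqn : E.Nice q := ⟨hq, 1, fun y _ => by rw [abs_of_nonneg (hq0 y)]; exact hq1 y⟩
  refine (integral_history_mono halg
    ((hqn.comp_good _).mul ((nice_empMean_sub lo (lo + ℓ) s a).pow 2)) (hΦ ℓ) ?_).trans
    (hmono ℓ le_rfl)
  intro x hx
  simp only [Φ, Nat.sub_self, pow_zero]
  exact mul_sq_le_msePotential hℓ' (hq0 _) (count_nonneg _ _ _ _)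
    (hx.abs_empMean_sub_le le_rfl s a) (empMean_sub_eq x le_rfl s a _)

/-- Mean squared error when `a` is played in context `s` with probability at least `q`. -/
theorem integral_mul_sq_empMean_sub_le_of_const (halg : alg.IsMeasurable) (s : S) (a : A) {t : ℕ}
    (ht : 0 < t) {q : ℝ} (hq0 : 0 ≤ q) (hq1 : q ≤ 1)
    (hP : ∀ j, ∀ x : Fin j → S × A × ℝ, q ≤ E.d s * alg j x s a) :
    ∫ x, q * (empMean x 0 t s a - E.mean s a) ^ 2 ∂(E.history alg t) ≤ 20 * E.R ^ 2 / t := by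
  have h := integral_mul_sq_empMean_sub_le (E := E) halg s a 0 t ht (q := fun _ => q)
    measurable_const (fun _ => hq0) (fun _ => hq1) fun j _ x => hP _ x
  -- The length of the history occurs in its type; generalising it allows `0 + t` to be replaced by
  -- `t`.
  have h2 : ∀ m, m = 0 + t → ∫ x, q * (empMean x 0 m s a - E.mean s a) ^ 2 ∂(E.history alg m) ≤
      20 * E.R ^ 2 / t := by rintro m rfl; exact h
  exact h2 t (zero_add t).symm

/-! ### Cumulative squared prediction error -/

theorem nice_log_count (t lo : ℕ) (s : S) (a : A) :
    E.Nice fun x : Fin t → S × A × ℝ => Real.log (count x lo s a + 1) := by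
  refine ⟨by fun_prop, t, fun x _ => ?_⟩
  have h0 := count_nonneg x lo s a
  have h1 := count_le x lo s a
  rw [abs_of_nonneg (Real.log_nonneg (by linarith))]
  linarith [Real.log_le_sub_one_of_pos (show 0 < count x lo s a + 1 by linarith)]

/-- The cumulative squared error of the running empirical mean, over the rounds in which it is
used. -/
theorem sum_integral_mul_sq_empMean_sub_le (halg : alg.IsMeasurable) (s : S) (a : A) (n : ℕ) :
    ∑ t ∈ Finset.range n, ∫ x, E.d s * alg t x s a * (empMean x 0 t s a - E.mean s a) ^ 2
      ∂(E.history alg t) ≤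
    12 * E.R ^ 2 * ∫ x, Real.log (count x 0 s a + 1) ∂(E.history alg n) := by
  -- On an observation the quadratic part rises by at most `6 R² / (k+2) - 6 M² / ((k+1)(k+2))` in
  -- the mean, and the logarithm takes off at least `12 R² / (k+2)`. The net fall pays for the
  -- squared error of that round.
  let φ : ℝ → ℝ → ℝ := fun k M => 6 * (M ^ 2 / (k + 1)) - 12 * E.R ^ 2 * Real.log (k + 1)
  let Φ : (t : ℕ) → (Fin t → S × A × ℝ) → ℝ := fun t x =>
    φ (count x 0 s a) (deviation x 0 s a (E.mean s a))
  have hU : ∀ t, E.Nice fun x : Fin t → S × A × ℝ =>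
      deviation x 0 s a (E.mean s a) ^ 2 / (count x 0 s a + 1) := by
    intro t
    obtain ⟨B, hB⟩ := ((nice_deviation (E := E) (t := t) 0 s a).pow 2).2
    refine ⟨by fun_prop, B, fun x hx => ?_⟩
    have h0 := count_nonneg x 0 s a
    rw [abs_div, abs_of_nonneg (show 0 ≤ count x 0 s a + 1 by linarith)]
    exact (div_le_self (abs_nonneg _) (by linarith)).trans (hB x hx)
  have hΦ : ∀ t, E.Nice (Φ t) := fun t => ((hU t).const_mul 6).sub ((nice_log_count t 0 s a).const_mul _)
  let Y : (t : ℕ) → (Fin t → S × A × ℝ) → ℝ := fun t x =>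
    E.d s * alg t x s a * (empMean x 0 t s a - E.mean s a) ^ 2
  have hY : ∀ t, E.Nice (Y t) := fun t =>
    ((nice_alg halg t s a).const_mul _).mul ((nice_empMean_sub 0 t s a).pow 2)
  have hstep : ∀ t, ∀ x, E.Good x → E.step alg (t := t) (Φ (t + 1)) x ≤ Φ t x - Y t x := by
    intro t x hx
    set k := count x 0 s a
    set M := deviation x 0 s a (E.mean s a)
    have hk : 0 ≤ k := count_nonneg _ _ _ _
    have hint : Integrable (fun r => φ (k + 1) (M + (r - E.mean s a))) (E.ρ s a) :=
      (((E.integrable_add_reward_sub_sq _ s a).div_const _).const_mul _).sub (integrable_const _)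
    rw [step_count_deviation (F := Φ (t + 1)) (Nat.zero_le t) φ hint (fun z => rfl)]
    have hZ : ∫ r, φ (k + 1) (M + (r - E.mean s a)) ∂(E.ρ s a) ≤
        6 * ((M ^ 2 + E.R ^ 2) / (k + 1 + 1)) - 12 * E.R ^ 2 * Real.log (k + 1 + 1) := by
      simp only [φ]
      rw [integral_sub (((E.integrable_add_reward_sub_sq _ s a).div_const _).const_mul _)
        (integrable_const _), integral_const_mul, integral_div]
      have := E.integral_add_reward_sub_sq_le M s a
      simp only [integral_const, probReal_univ, one_smul]
      gcongr
    have hL : 1 / (k + 1 + 1) ≤ Real.log (k + 1 + 1) - Real.log (k + 1) := by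
      rw [← Real.log_div (by positivity) (by positivity)]
      have := Real.one_sub_inv_le_log_of_pos (show 0 < (k + 1 + 1) / (k + 1) by positivity)
      refine le_trans (le_of_eq ?_) this
      field_simp
      ring
    -- The constant `6` comes from `(k+1)(k+2) ≤ 6 k²` for `k ≥ 1`, with equality at `k = 1`. For `k
    -- = 0` the trivial error `R²` is below the last term alone.
    have he : (empMean x 0 t s a - E.mean s a) ^ 2 ≤
        6 * (M ^ 2 / ((k + 1) * (k + 1 + 1)) + E.R ^ 2 / (k + 1 + 1)) := by
      by_cases h0 : k = 0
      · have h1 := sq_le_sq.2 ((hx.abs_empMean_sub_le (lo := 0) (hi := t) le_rfl s a).trans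
          (le_abs_self E.R))
        rw [h0]
        have : 0 ≤ M ^ 2 / ((0 + 1) * (0 + 1 + 1)) := by positivity
        nlinarith [sq_nonneg E.R]
      · have h1 : 1 ≤ k := one_le_count _ _ _ _ h0
        rw [empMean_sub_eq x le_rfl s a _ h0, div_pow]
        have h2 : M ^ 2 / k ^ 2 ≤ 6 * (M ^ 2 / ((k + 1) * (k + 1 + 1))) := by
          rw [← mul_div_assoc, div_le_div_iff₀ (by positivity) (by positivity)]
          nlinarith [mul_nonneg (sq_nonneg M) (show 0 ≤ 6 * k ^ 2 - (k + 1) * (k + 1 + 1) by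
            nlinarith)]
        have : 0 ≤ E.R ^ 2 / (k + 1 + 1) := by positivity
        linarith
    have hd : 6 * ((M ^ 2 + E.R ^ 2) / (k + 1 + 1)) - 6 * (M ^ 2 / (k + 1)) =
        6 * (E.R ^ 2 / (k + 1 + 1)) - 6 * (M ^ 2 / ((k + 1) * (k + 1 + 1))) := by
      field_simp
      ring
    have hL2 : 12 * E.R ^ 2 * (1 / (k + 1 + 1)) ≤
        12 * E.R ^ 2 * (Real.log (k + 1 + 1) - Real.log (k + 1)) :=
      mul_le_mul_of_nonneg_left hL (by positivity)
    have hL3 : 12 * E.R ^ 2 * (1 / (k + 1 + 1)) = 12 * (E.R ^ 2 / (k + 1 + 1)) := by ring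
    have hfin : ∫ r, φ (k + 1) (M + (r - E.mean s a)) ∂(E.ρ s a) - φ k M ≤
        -(empMean x 0 t s a - E.mean s a) ^ 2 := by
      simp only [φ] at hZ ⊢
      linarith
    have hPn : 0 ≤ E.d s * alg t x s a := mul_nonneg (E.d_nonneg s) (stdSimplex.zero_le _ _)
    have := mul_le_mul_of_nonneg_left hfin hPn
    simp only [Y, Φ]
    linarith
  have hsum : ∀ n, ∫ x, Φ n x ∂(E.history alg n) +
      ∑ t ∈ Finset.range n, ∫ x, Y t x ∂(E.history alg t) ≤ 0 := by
    intro n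
    induction n with
    | zero =>
      have h1 : ∀ x : Fin 0 → S × A × ℝ, Φ 0 x = 0 := fun x => by
        simp [Φ, φ, count, deviation]
      simp [h1]
    | succ n ih =>
      rw [Finset.sum_range_succ]
      have h1 := integral_history_succ_le halg (hΦ (n + 1)) ((hΦ n).sub (hY n)) (hstep n)
      rw [integral_sub ((hΦ n).integrable halg) ((hY n).integrable halg)] at h1
      linarith
  have h1 := hsum n
  have h2 : ∫ x, Φ n x ∂(E.history alg n) =
      6 * ∫ x, deviation x 0 s a (E.mean s a) ^ 2 / (count x 0 s a + 1) ∂(E.history alg n) -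
      12 * E.R ^ 2 * ∫ x, Real.log (count x 0 s a + 1) ∂(E.history alg n) := by
    rw [← integral_const_mul, ← integral_const_mul, ← integral_sub
      (((hU n).const_mul 6).integrable halg) (((nice_log_count n 0 s a).const_mul _).integrable halg)]
  have h3 : 0 ≤ ∫ x, deviation x 0 s a (E.mean s a) ^ 2 / (count x 0 s a + 1)
      ∂(E.history alg n) := integral_nonneg fun x =>
    div_nonneg (sq_nonneg _) (by linarith [count_nonneg x 0 s a])
  linarith

/-- Cumulative squared prediction error, summed over all actions and at most `N` contexts. -/
theorem sum_sum_integral_mul_sq_empMean_sub_le [Nonempty A] (halg : alg.IsMeasurable) {N n : ℕ}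
    (hN0 : 0 < N) {I : Finset S} (hI : ∀ s ∉ I, E.d s = 0) (hN : I.card ≤ N) :
    ∑ t ∈ Finset.range n, ∫ x, ∑ s, E.d s * ∑ a, alg t x s a *
      (empMean x 0 t s a - E.mean s a) ^ 2 ∂(E.history alg t) ≤
    12 * E.R ^ 2 * (N * Fintype.card A * Real.log (1 + n / (N * Fintype.card A))) := by
  have hnice : ∀ t s a, E.Nice fun x : Fin t → S × A × ℝ =>
      E.d s * alg t x s a * (empMean x 0 t s a - E.mean s a) ^ 2 := fun t s a =>
    ((nice_alg halg t s a).const_mul _).mul ((nice_empMean_sub 0 t s a).pow 2)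
  have h1 : ∀ t, ∫ x, ∑ s, E.d s * ∑ a, alg t x s a *
      (empMean x 0 t s a - E.mean s a) ^ 2 ∂(E.history alg t) =
      ∑ s ∈ I, ∑ a, ∫ x, E.d s * alg t x s a * (empMean x 0 t s a - E.mean s a) ^ 2
        ∂(E.history alg t) := by
    intro t
    have h2 : ∀ x : Fin t → S × A × ℝ, ∑ s, E.d s * ∑ a, alg t x s a *
        (empMean x 0 t s a - E.mean s a) ^ 2 =
        ∑ s ∈ I, ∑ a, E.d s * alg t x s a * (empMean x 0 t s a - E.mean s a) ^ 2 := by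
      intro x
      rw [← Finset.sum_subset (Finset.subset_univ I) fun s _ hs => by rw [hI s hs, zero_mul]]
      simp only [Finset.mul_sum, mul_assoc]
    simp_rw [h2]
    rw [integral_finsetSum _ fun s _ => (Nice.sum _ fun a => hnice t s a).integrable halg]
    refine Finset.sum_congr rfl fun s _ => ?_
    rw [integral_finsetSum _ fun a _ => (hnice t s a).integrable halg]
  simp_rw [h1]
  rw [Finset.sum_comm]
  have h3 : ∀ s, ∑ t ∈ Finset.range n, ∑ a, ∫ x, E.d s * alg t x s a *
      (empMean x 0 t s a - E.mean s a) ^ 2 ∂(E.history alg t) ≤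
      ∑ a, 12 * E.R ^ 2 * ∫ x, Real.log (count x 0 s a + 1) ∂(E.history alg n) := by
    intro s
    rw [Finset.sum_comm]
    exact Finset.sum_le_sum fun a _ => sum_integral_mul_sq_empMean_sub_le halg s a n
  refine (Finset.sum_le_sum fun s _ => h3 s).trans ?_
  simp_rw [← Finset.mul_sum]
  refine mul_le_mul_of_nonneg_left ?_ (by positivity)
  have h4 : ∑ s ∈ I, ∑ a, ∫ x, Real.log (count x 0 s a + 1) ∂(E.history alg n) =
      ∫ x, ∑ s ∈ I, ∑ a, Real.log (count x 0 s a + 1) ∂(E.history alg n) := by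
    rw [integral_finsetSum _ fun s _ =>
      (Nice.sum _ fun a => nice_log_count n 0 s a).integrable halg]
    refine Finset.sum_congr rfl fun s _ => ?_
    rw [integral_finsetSum _ fun a _ => (nice_log_count n 0 s a).integrable halg]
  rw [h4]
  refine (integral_history_mono halg (Nice.sum _ fun s => Nice.sum _ fun a =>
    nice_log_count n 0 s a) (Nice.const _) fun x _ => ?_).trans (integral_history_const halg _).le
  set m : ℝ := N * Fintype.card A
  have hm : 0 < m := by
    have : 0 < Fintype.card A := Fintype.card_pos
    positivity
  set w : ℝ := 1 + n / m
  have hw : 0 < w := by positivity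
  -- Jensen's inequality by hand: the tangent to `log` at `w = 1 + n / m`, which would be the value
  -- of every count plus one if `n` observations were spread evenly over `m` cells.
  have h5 : ∀ s a, Real.log (count x 0 s a + 1) ≤ Real.log w - 1 + 1 / w + count x 0 s a / w := by
    intro s a
    have h0 := count_nonneg x 0 s a
    have := Real.log_le_sub_one_of_pos (show 0 < (count x 0 s a + 1) / w by positivity)
    rw [Real.log_div (by positivity) (by positivity), add_div] at this
    linarith
  have h6 : ∑ s ∈ I, ∑ a, count x 0 s a ≤ n :=
    (Finset.sum_le_sum_of_subset_of_nonneg (Finset.subset_univ I) fun s _ _ =>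
      Finset.sum_nonneg fun a _ => count_nonneg x 0 s a).trans (sum_count_le x 0)
  -- Nonnegativity of the constant term permits replacing the number of contexts by its bound `N`.
  have h7 : 0 ≤ Real.log w - 1 + 1 / w := by
    have := Real.one_sub_inv_le_log_of_pos hw
    rw [one_div]; linarith
  have h8 : (I.card : ℝ) ≤ N := by exact_mod_cast hN
  calc ∑ s ∈ I, ∑ a, Real.log (count x 0 s a + 1)
      ≤ ∑ s ∈ I, ∑ a, (Real.log w - 1 + 1 / w + count x 0 s a / w) :=
        Finset.sum_le_sum fun s _ => Finset.sum_le_sum fun a _ => h5 s a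
    _ = I.card * Fintype.card A * (Real.log w - 1 + 1 / w) +
        (∑ s ∈ I, ∑ a, count x 0 s a) / w := by
        simp_rw [Finset.sum_add_distrib (g := fun a => count x 0 _ a / w), Finset.sum_div]
        rw [Finset.sum_add_distrib]
        simp only [Finset.sum_const, Finset.card_univ, nsmul_eq_mul, mul_assoc]
    _ ≤ m * (Real.log w - 1 + 1 / w) + n / w := by
        have h9 : (I.card : ℝ) * Fintype.card A ≤ m :=
          mul_le_mul_of_nonneg_right h8 (Nat.cast_nonneg _)
        gcongr
    _ = m * Real.log w := by
        simp only [w]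
        field_simp
        ring

end Bandit

/-! ### Greedy actions -/

section Greedy

variable {A : Type*} [Fintype A] [Nonempty A]

theorem le_greedy (f : A → ℝ) (b : A) : f b ≤ f (greedy f) := by
  have h : greedy f ∈ argmaxSet f := (argmaxSet_nonempty f).choose_spec
  have h2 : ∀ b, f b ≤ f (greedy f) := by simpa [argmaxSet] using h
  exact h2 b

/-- Tie-breaking depends only on the set of maximizers. The greedy action is thus a function of a
set with finitely many possible values, each attained on a measurable set, so the arbitrary choice
does no harm. -/
theorem measurable_ite_eq_greedy {α : Type*} [MeasurableSpace α] {f : α → A → ℝ}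
    (hf : ∀ a, Measurable fun x => f x a) (a : A) : MeasurableSet {x | a = greedy (f x)} := by
  classical
  let g : Finset A → A := fun T => if h : T.Nonempty then h.choose else Classical.arbitrary A
  have hg : ∀ x, greedy (f x) = g (argmaxSet (f x)) := fun x => by
    simp only [g, dif_pos (argmaxSet_nonempty (f x))]
    rfl
  have hT : ∀ T : Finset A, MeasurableSet {x | argmaxSet (f x) = T} := by
    intro T
    have h1 : {x | argmaxSet (f x) = T} = ⋂ b, {x | b ∈ T ↔ ∀ c, f x c ≤ f x b} := by
      ext x
      simp only [Set.mem_ofPred_eq, Set.mem_iInter, Finset.ext_iff, argmaxSet, Finset.mem_filter,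
        Finset.mem_univ, true_and]
      exact forall_congr' fun b => Iff.comm
    rw [h1]
    refine MeasurableSet.iInter fun b => ?_
    have h2 : MeasurableSet {x | ∀ c, f x c ≤ f x b} := by
      rw [Set.ofPred_forall]
      exact MeasurableSet.iInter fun c => measurableSet_le (hf c) (hf b)
    exact (MeasurableSet.const (b ∈ T)).iff h2
  have h3 : {x | a = greedy (f x)} =
      ⋃ T ∈ {T : Finset A | a = g T}, {x | argmaxSet (f x) = T} := by
    ext x
    simp [hg]
  rw [h3]
  exact MeasurableSet.biUnion (Set.to_countable _) fun T _ => hT T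

theorem measurable_comp_greedy {α : Type*} [MeasurableSpace α] {f g : α → A → ℝ}
    (hf : ∀ a, Measurable fun x => f x a) (hg : ∀ a, Measurable fun x => g x a) :
    Measurable fun x => g x (greedy (f x)) := by
  classical
  have h : ∀ x, g x (greedy (f x)) = ∑ a, if a = greedy (f x) then g x a else 0 := fun x => by simp
  simp_rw [h]
  exact Finset.measurable_sum _ fun a _ =>
    Measurable.ite (measurable_ite_eq_greedy hf a) (hg a) measurable_const

end Greedy

/-! ### Regret -/

theorem sum_one_div_sqrt_le (n : ℕ) :
    ∑ t ∈ Finset.range n, 1 / Real.sqrt (t + 1) ≤ 2 * Real.sqrt n := by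
  induction n with
  | zero => simp
  | succ n ih =>
    rw [Finset.sum_range_succ]
    have h1 : 0 < Real.sqrt (n + 1 : ℝ) := Real.sqrt_pos.2 (by positivity)
    have h2 : 1 / Real.sqrt (n + 1 : ℝ) ≤ 2 * Real.sqrt (n + 1 : ℝ) - 2 * Real.sqrt n := by
      rw [div_le_iff₀ h1]
      have h3 := Real.sq_sqrt (show (0 : ℝ) ≤ n + 1 by positivity)
      have h4 := Real.sq_sqrt (show (0 : ℝ) ≤ n by positivity)
      nlinarith [sq_nonneg (Real.sqrt (n + 1 : ℝ) - Real.sqrt n)]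
    push_cast
    linarith

/-- Arithmetic-geometric mean inequality. With a deterministic `η` it replaces Cauchy-Schwarz, so
that only expectations of squares have to be bounded. -/
theorem abs_le_add_sq_div {η e : ℝ} (hη : 0 < η) : |e| ≤ 1 / (4 * η) + η * e ^ 2 := by
  have h : 1 / (4 * η) + η * e ^ 2 - |e| = η * (|e| - 1 / (2 * η)) ^ 2 := by
    rw [sub_sq, sq_abs]
    field_simp
    ring
  nlinarith [mul_nonneg hη.le (sq_nonneg (|e| - 1 / (2 * η)))]

namespace Bandit

section Support

variable {S A : Type*} [Fintype S] [Fintype A] (E : Bandit S A)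

theorem card_pos_of_support {I : Finset S} (hI : ∀ s ∉ I, E.d s = 0) : 0 < I.card := by
  rw [Finset.card_pos]
  by_contra h
  have h1 := E.d_sum
  rw [Finset.not_nonempty_iff_eq_empty] at h
  rw [Finset.sum_eq_zero fun s _ => hI s (by simp [h])] at h1
  exact zero_ne_one h1

end Support

section RegretBasic

variable {S A : Type*} [Fintype S] [Fintype A] [Nonempty A] (E : Bandit S A)

theorem regret_le (p : S → stdSimplex ℝ A) : E.regret p ≤ E.R := by
  calc E.regret p ≤ ∑ s, E.d s * E.R := by
        refine Finset.sum_le_sum fun s _ => mul_le_mul_of_nonneg_left ?_ (E.d_nonneg s)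
        have h1 : 0 ≤ ∑ a, p s a * E.mean s a := Finset.sum_nonneg fun a _ =>
          mul_nonneg (stdSimplex.zero_le _ _) (E.mean_mem s a).1
        linarith [(E.mean_mem s (greedy (E.mean s))).2]
    _ = E.R := by rw [← Finset.sum_mul, E.d_sum, one_mul]

end RegretBasic

variable {S A : Type*} [Fintype S] [Fintype A] [Nonempty A]
  [MeasurableSpace S] [MeasurableSpace A] {E : Bandit S A} {alg : CBAlgorithm S A}

theorem nice_regret (halg : alg.IsMeasurable) (t : ℕ) : E.Nice fun x => E.regret (alg t x) := by
  unfold regret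
  exact Nice.sum _ fun s => Nice.const_mul ((Nice.const _).sub (Nice.sum _ fun a =>
    (nice_alg halg t s a).mul (Nice.const _))) _

theorem sum_integral_regret_le (halg : alg.IsMeasurable) (n : ℕ) :
    ∑ t ∈ Finset.range n, ∫ x, E.regret (alg t x) ∂(E.history alg t) ≤ n * E.R := by
  have h : ∀ t, ∫ x, E.regret (alg t x) ∂(E.history alg t) ≤ E.R := fun t =>
    (integral_history_mono halg (nice_regret halg t) (Nice.const E.R) fun x _ =>
      E.regret_le _).trans (integral_history_const halg _).le
  simpa using Finset.sum_le_sum fun t (_ : t ∈ Finset.range n) => h t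

end Bandit

/-! ### `ε`-greedy -/

section EpsGreedy

variable {S A : Type*} [Fintype A] [Nonempty A]

open Classical in
theorem exploreOr_apply (ε : Set.Icc (0 : ℝ) 1) (a₀ a : A) :
    exploreOr ε a₀ a = (ε : ℝ) / Fintype.card A + (1 - ε) * (if a = a₀ then 1 else 0) := rfl

theorem epsGreedy_isMeasurable [MeasurableSpace S] [DiscreteMeasurableSpace S]
    [MeasurableSpace A] [DiscreteMeasurableSpace A] (N n : ℕ) :
    (epsGreedy N n : CBAlgorithm S A).IsMeasurable := by
  classical
  intro t s a
  simp only [epsGreedy, exploreOr_apply]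
  exact measurable_const.add (measurable_const.mul (Measurable.ite
    (measurable_ite_eq_greedy (fun b => measurable_empMean 0 t s b) a)
    measurable_const measurable_const))

/-- Exploration loses at most `R`. A greedy choice loses at most the error of `f` at the best action
plus that at the chosen action, and the latter is part of the error averaged over the actions
played. -/
theorem exploreOr_gap_le {ε : Set.Icc (0 : ℝ) 1} {R : ℝ} {m f : A → ℝ}
    (hm : ∀ a, m a ∈ Set.Icc 0 R) :
    m (greedy m) - ∑ a, exploreOr ε (greedy f) a * m a ≤
      ε * R + |f (greedy m) - m (greedy m)| + ∑ a, exploreOr ε (greedy f) a * |f a - m a| := by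
  classical
  have hε0 : (0 : ℝ) ≤ ε := ε.2.1
  have hε1 : (0 : ℝ) ≤ 1 - ε := sub_nonneg.2 ε.2.2
  have hsum : ∀ g : A → ℝ, ∑ a, exploreOr ε (greedy f) a * g a =
      (ε : ℝ) / Fintype.card A * ∑ a, g a + (1 - ε) * g (greedy f) := by
    intro g
    simp only [exploreOr_apply, add_mul, Finset.sum_add_distrib, ← Finset.mul_sum]
    simp
  rw [hsum, hsum]
  have h1 : 0 ≤ (ε : ℝ) / Fintype.card A * ∑ a, m a :=
    mul_nonneg (by positivity) (Finset.sum_nonneg fun a _ => (hm a).1)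
  have h2 : 0 ≤ (ε : ℝ) / Fintype.card A * ∑ a, |f a - m a| := by positivity
  have h3 : m (greedy m) - m (greedy f) ≤
      |f (greedy m) - m (greedy m)| + |f (greedy f) - m (greedy f)| := by
    have := le_greedy f (greedy m)
    linarith [neg_abs_le (f (greedy m) - m (greedy m)), le_abs_self (f (greedy f) - m (greedy f))]
  have h4 := mul_le_mul_of_nonneg_left h3 hε1
  have h5 : (1 - (ε : ℝ)) * |f (greedy m) - m (greedy m)| ≤ |f (greedy m) - m (greedy m)| :=
    mul_le_of_le_one_left (abs_nonneg _) (by linarith)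
  have h6 : (ε : ℝ) * m (greedy m) ≤ ε * R := mul_le_mul_of_nonneg_left (hm _).2 hε0
  linarith

variable [Fintype S] [MeasurableSpace S] [DiscreteMeasurableSpace S] [MeasurableSpace A]
  [DiscreteMeasurableSpace A] {E : Bandit S A}

/-- Expected error for the best actions under a policy that explores. -/
theorem Bandit.integral_sum_abs_empMean_sub_le {alg : CBAlgorithm S A} (halg : alg.IsMeasurable)
    {N t : ℕ} (ht : 0 < t) {I : Finset S} (hI : ∀ s ∉ I, E.d s = 0) (hN : I.card ≤ N) {ε θ : ℝ}
    (hε0 : 0 < ε) (hε1 : ε ≤ 1) (hθ : 0 < θ)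
    (hP : ∀ j, ∀ x : Fin j → S × A × ℝ, ∀ s a, ε / Fintype.card A ≤ alg j x s a) (b : S → A) :
    ∫ x, ∑ s, E.d s * |empMean x 0 t s (b s) - E.mean s (b s)| ∂(E.history alg t) ≤
      1 / (4 * θ) + θ * (20 * E.R ^ 2 * N * Fintype.card A / (ε * t)) := by
  have hA : (0 : ℝ) < Fintype.card A := by exact_mod_cast Fintype.card_pos
  have hA1 : (1 : ℝ) ≤ Fintype.card A := by exact_mod_cast Fintype.card_pos (α := A)
  have ht' : (0 : ℝ) < t := by exact_mod_cast ht
  have hn : ∀ s, E.Nice fun x : Fin t → S × A × ℝ =>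
      (empMean x 0 t s (b s) - E.mean s (b s)) ^ 2 := fun s => (nice_empMean_sub 0 t s _).pow 2
  have h1 : ∀ s, ∫ x, E.d s * (empMean x 0 t s (b s) - E.mean s (b s)) ^ 2 ∂(E.history alg t) ≤
      20 * E.R ^ 2 * Fintype.card A / (ε * t) := by
    intro s
    -- The cell is hit with probability at least `d(s) ε / A`. Only `ε / A` is divided out
    -- afterwards; the weight `d(s)` is the one wanted in the sum over contexts, so rare contexts
    -- cost nothing extra.
    have h2 := Bandit.integral_mul_sq_empMean_sub_le_of_const (E := E) halg s (b s) ht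
      (q := E.d s * (ε / Fintype.card A)) (mul_nonneg (E.d_nonneg s) (by positivity))
      (mul_le_one₀ (E.d_le_one s) (by positivity) (div_le_one_of_le₀ (hε1.trans hA1) hA.le))
      fun j x => mul_le_mul_of_nonneg_left (hP j x s (b s)) (E.d_nonneg s)
    have h3 : ∀ x : Fin t → S × A × ℝ, E.d s * (ε / Fintype.card A) *
        (empMean x 0 t s (b s) - E.mean s (b s)) ^ 2 = ε / Fintype.card A *
          (E.d s * (empMean x 0 t s (b s) - E.mean s (b s)) ^ 2) := fun x => by ring
    simp_rw [h3] at h2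
    rw [integral_const_mul, div_mul_eq_mul_div, div_le_div_iff₀ hA ht'] at h2
    rw [le_div_iff₀ (by positivity)]
    linarith
  have hsupp : ∀ g : S → ℝ, ∑ s, E.d s * g s = ∑ s ∈ I, E.d s * g s := fun g =>
    (Finset.sum_subset (Finset.subset_univ I) fun s _ hs => by rw [hI s hs, zero_mul]).symm
  have h4 : ∀ x : Fin t → S × A × ℝ,
      ∑ s, E.d s * |empMean x 0 t s (b s) - E.mean s (b s)| ≤
        1 / (4 * θ) + θ * ∑ s ∈ I, E.d s * (empMean x 0 t s (b s) - E.mean s (b s)) ^ 2 := by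
    intro x
    rw [← hsupp]
    calc ∑ s, E.d s * |empMean x 0 t s (b s) - E.mean s (b s)|
        ≤ ∑ s, E.d s * (1 / (4 * θ) + θ * (empMean x 0 t s (b s) - E.mean s (b s)) ^ 2) :=
          Finset.sum_le_sum fun s _ =>
            mul_le_mul_of_nonneg_left (abs_le_add_sq_div hθ) (E.d_nonneg s)
      _ = _ := by
        simp only [mul_add, Finset.sum_add_distrib, ← Finset.sum_mul, E.d_sum, one_mul,
          Finset.mul_sum]
        congr 1
        exact Finset.sum_congr rfl fun s _ => by ring
  refine (Bandit.integral_history_mono halg (Bandit.Nice.sum _ fun s =>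
    (nice_empMean_sub 0 t s _).abs.const_mul _) ((Bandit.Nice.const _).add ((Bandit.Nice.sum I
      fun s => (hn s).const_mul _).const_mul θ)) fun x _ => h4 x).trans ?_
  rw [integral_add ((Bandit.Nice.const (E := E) _).integrable halg) (((Bandit.Nice.sum I
      fun s => (hn s).const_mul (E.d s)).const_mul θ).integrable halg),
    Bandit.integral_history_const halg, integral_const_mul,
    integral_finsetSum _ fun s _ => ((hn s).const_mul _).integrable halg]
  have h5 : ∑ s ∈ I, ∫ x, E.d s * (empMean x 0 t s (b s) - E.mean s (b s)) ^ 2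
      ∂(E.history alg t) ≤ N * (20 * E.R ^ 2 * Fintype.card A / (ε * t)) := by
    refine (Finset.sum_le_sum fun s _ => h1 s).trans ?_
    rw [Finset.sum_const, nsmul_eq_mul]
    exact mul_le_mul_of_nonneg_right (by exact_mod_cast hN) (by positivity)
  have h6 : (N : ℝ) * (20 * E.R ^ 2 * Fintype.card A / (ε * t)) =
      20 * E.R ^ 2 * N * Fintype.card A / (ε * t) := by ring
  rw [h6] at h5
  gcongr

end EpsGreedy

section EpsGreedyRegret

variable {S A : Type*} [Fintype S] [Fintype A] [Nonempty A] {E : Bandit S A}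

theorem epsGreedy_regret_le_pointwise {N n t : ℕ} {η : ℝ} (hη : 0 < η)
    (x : Fin t → S × A × ℝ) :
    E.regret (epsGreedy N n t x) ≤ (epsRate N (Fintype.card A) n : ℝ) * E.R +
      ∑ s, E.d s * |empMean x 0 t s (greedy (E.mean s)) - E.mean s (greedy (E.mean s))| +
      (1 / (4 * η) + η * ∑ s, E.d s * ∑ a, (epsGreedy N n t x : S → stdSimplex ℝ A) s a *
        (empMean x 0 t s a - E.mean s a) ^ 2) := by
  set ε : ℝ := ((epsRate N (Fintype.card A) n : Set.Icc (0 : ℝ) 1) : ℝ)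
  set p : S → stdSimplex ℝ A := epsGreedy N n t x
  have h1 : ∀ s, E.mean s (greedy (E.mean s)) - ∑ a, p s a * E.mean s a ≤ ε * E.R +
      |empMean x 0 t s (greedy (E.mean s)) - E.mean s (greedy (E.mean s))| +
      (1 / (4 * η) + η * ∑ a, p s a * (empMean x 0 t s a - E.mean s a) ^ 2) := by
    intro s
    refine (exploreOr_gap_le (f := empMean x 0 t s) (E.mean_mem s)).trans ?_
    gcongr
    calc ∑ a, p s a * |empMean x 0 t s a - E.mean s a|
        ≤ ∑ a, p s a * (1 / (4 * η) + η * (empMean x 0 t s a - E.mean s a) ^ 2) :=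
          Finset.sum_le_sum fun a _ =>
            mul_le_mul_of_nonneg_left (abs_le_add_sq_div hη) (stdSimplex.zero_le _ _)
      _ = _ := by
        simp only [mul_add, Finset.sum_add_distrib, ← Finset.sum_mul, stdSimplex.sum_eq_one,
          one_mul, Finset.mul_sum]
        congr 1
        exact Finset.sum_congr rfl fun s _ => by ring
  refine (Finset.sum_le_sum fun s _ => mul_le_mul_of_nonneg_left (h1 s) (E.d_nonneg s)).trans ?_
  have h2 : ∀ s (u v w : ℝ), E.d s * (ε * E.R + u + (v + η * w)) =
      E.d s * (ε * E.R + v) + E.d s * u + η * (E.d s * w) := fun s u v w => by ring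
  simp only [h2, Finset.sum_add_distrib, ← Finset.sum_mul, E.d_sum, ← Finset.mul_sum]
  linarith

variable [MeasurableSpace S] [DiscreteMeasurableSpace S] [MeasurableSpace A]
  [DiscreteMeasurableSpace A]

/-- Regret of tabular `ε`-greedy. -/
theorem epsGreedy_regret {N n : ℕ} (hn : 0 < n) {I : Finset S} (hI : ∀ s ∉ I, E.d s = 0)
    (hN : I.card ≤ N) (hR : 0 < E.R) :
    ∑ t ∈ Finset.range n, ∫ x, E.regret (epsGreedy N n t x) ∂(E.history (epsGreedy N n) t) ≤
      100 * n * E.R * ((N : ℝ) * Fintype.card A / n) ^ (1 / 3 : ℝ) := by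
  have halg := epsGreedy_isMeasurable (S := S) (A := A) N n
  have hN0 : 0 < N := (E.card_pos_of_support hI).trans_le hN
  have hA0 : 0 < Fintype.card A := Fintype.card_pos
  have hn' : (0 : ℝ) < n := by exact_mod_cast hn
  have hm1 : (1 : ℝ) ≤ N * Fintype.card A := by exact_mod_cast Nat.mul_pos hN0 hA0
  set z : ℝ := ((N : ℝ) * Fintype.card A / n) ^ (1 / 3 : ℝ) with hz
  have hz0 : 0 < z := Real.rpow_pos_of_pos (by positivity) _
  have hz3 : z ^ 3 = N * Fintype.card A / n := by
    rw [hz, ← Real.rpow_natCast, ← Real.rpow_mul (by positivity)]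
    norm_num
  have hz3' : (N : ℝ) * Fintype.card A = z ^ 3 * n := by rw [hz3]; field_simp
  -- If `z > 1` the exploration rate is cut off at `1`, and the trivial bound `n R` suffices.
  rcases lt_or_ge 1 z with hz1 | hz1
  · refine (Bandit.sum_integral_regret_le halg n).trans ?_
    have : 0 < n * E.R := by positivity
    nlinarith
  have hrate : (epsRate N (Fintype.card A) n : ℝ) = z := min_eq_right hz1
  -- error for the best actions
  have hB : ∀ t, ∫ x, ∑ s, E.d s *
      |empMean x 0 t s (greedy (E.mean s)) - E.mean s (greedy (E.mean s))|
        ∂(E.history (epsGreedy N n) t) ≤ 42 * E.R * z * Real.sqrt n * (1 / Real.sqrt (t + 1)) := by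
    intro t
    have hsn : 0 < Real.sqrt n := Real.sqrt_pos.2 hn'
    have hsn2 : Real.sqrt n ^ 2 = n := Real.sq_sqrt hn'.le
    rcases Nat.eq_zero_or_pos t with rfl | ht
    -- Before any observation the error is at most `R`. This fits the bound because `z³ n = N A ≥ 1`
    -- and `z ≤ 1` give `z √n ≥ 1`.
    · refine (Bandit.integral_history_mono halg (Bandit.Nice.sum _ fun s =>
        (Bandit.nice_empMean_sub 0 0 s _).abs.const_mul _) (Bandit.Nice.const E.R)
        fun x hx => ?_).trans ((Bandit.integral_history_const halg _).le.trans ?_)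
      · calc _ ≤ ∑ s, E.d s * E.R := Finset.sum_le_sum fun s _ =>
              mul_le_mul_of_nonneg_left (hx.abs_empMean_sub_le le_rfl s _) (E.d_nonneg s)
          _ = E.R := by rw [← Finset.sum_mul, E.d_sum, one_mul]
      · have h1 : 1 ≤ z ^ 2 * n := by nlinarith [mul_pos (pow_pos hz0 2) hn']
        have h2 : 1 ≤ z * Real.sqrt n := by
          refine (one_le_sq_iff₀ (by positivity)).1 ?_
          rw [mul_pow, hsn2]
          exact h1
        simp only [Nat.cast_zero, zero_add, Real.sqrt_one, div_one, mul_one]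
        nlinarith
    · have ht' : (0 : ℝ) < t := by exact_mod_cast ht
      have hst : 0 < Real.sqrt t := Real.sqrt_pos.2 ht'
      have hst2 : Real.sqrt t ^ 2 = t := Real.sq_sqrt ht'.le
      -- With `N A = z³ n`, this `θ` makes both terms multiples of `R z √(n / t)`.
      have h1 := Bandit.integral_sum_abs_empMean_sub_le halg ht hI hN hz0 hz1
        (θ := Real.sqrt t / (Real.sqrt n * E.R * z)) (by positivity) (fun j x s a => by
          classical
          simp only [epsGreedy, exploreOr_apply, hrate]
          have : 0 ≤ (1 - z) * (if a = greedy (empMean x 0 j s) then 1 else 0) :=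
            mul_nonneg (by linarith) (by split_ifs <;> simp)
          linarith) fun s => greedy (E.mean s)
      refine h1.trans ?_
      have h2 : 1 / (4 * (Real.sqrt t / (Real.sqrt n * E.R * z))) =
          E.R * z * Real.sqrt n / 4 * (1 / Real.sqrt t) := by field_simp
      have h3 : Real.sqrt t / (Real.sqrt n * E.R * z) *
          (20 * E.R ^ 2 * N * Fintype.card A / (z * t)) =
          20 * E.R * z * Real.sqrt n * (1 / Real.sqrt t) := by
        have aux : ∀ u v : ℝ, 0 < u → 0 < v → u / (v * E.R * z) *
            (20 * E.R ^ 2 * (z ^ 3 * v ^ 2) / (z * u ^ 2)) = 20 * E.R * z * v * (1 / u) := by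
          intro u v hu hv
          field_simp
        have := aux _ _ hst hsn
        rwa [hst2, hsn2, ← hz3', ← mul_assoc] at this
      rw [h2, h3]
      have h4 : 1 / Real.sqrt t ≤ 2 * (1 / Real.sqrt (t + 1)) := by
        have h5 : Real.sqrt (t + 1) ≤ 2 * Real.sqrt t := by
          refine Real.sqrt_le_iff.2 ⟨by positivity, ?_⟩
          rw [mul_pow, hst2]
          have : (1 : ℝ) ≤ t := by exact_mod_cast ht
          linarith
        have h6 : 0 < Real.sqrt (t + 1 : ℝ) := Real.sqrt_pos.2 (by positivity)
        rw [← mul_div_assoc, mul_one, div_le_div_iff₀ hst h6]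
        linarith
      have h7 : 0 < E.R * z * Real.sqrt n := by positivity
      have h8 := mul_le_mul_of_nonneg_left h4 h7.le
      have h9 : 0 < E.R * z * Real.sqrt n * (1 / Real.sqrt (t + 1 : ℝ)) := by positivity
      linarith
  -- error for the actions played
  have hη : 0 < 1 / (4 * (z * E.R)) := by positivity
  have hη2 : 1 / (4 * (1 / (4 * (z * E.R)))) = z * E.R := by field_simp
  have hn1 : ∀ t, E.Nice fun x : Fin t → S × A × ℝ => ∑ s, E.d s *
      |empMean x 0 t s (greedy (E.mean s)) - E.mean s (greedy (E.mean s))| := fun t =>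
    Bandit.Nice.sum _ fun s => (Bandit.nice_empMean_sub 0 t s _).abs.const_mul _
  have hn2 : ∀ t, E.Nice fun x : Fin t → S × A × ℝ => ∑ s, E.d s * ∑ a,
      (epsGreedy N n t x : S → stdSimplex ℝ A) s a * (empMean x 0 t s a - E.mean s a) ^ 2 :=
    fun t => Bandit.Nice.sum _ fun s => Bandit.Nice.const_mul (Bandit.Nice.sum _ fun a =>
      (Bandit.nice_alg halg t s a).mul ((Bandit.nice_empMean_sub 0 t s a).pow 2)) _
  have hround : ∀ t, ∫ x, E.regret (epsGreedy N n t x) ∂(E.history (epsGreedy N n) t) ≤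
      2 * (z * E.R) + 42 * E.R * z * Real.sqrt n * (1 / Real.sqrt (t + 1)) +
      1 / (4 * (z * E.R)) * ∫ x, ∑ s, E.d s * ∑ a, (epsGreedy N n t x : S → stdSimplex ℝ A) s a *
        (empMean x 0 t s a - E.mean s a) ^ 2 ∂(E.history (epsGreedy N n) t) := by
    intro t
    have h1 := Bandit.integral_history_mono halg (Bandit.nice_regret halg t)
      (((Bandit.Nice.const (z * E.R)).add (hn1 t)).add ((Bandit.Nice.const (z * E.R)).add
        ((hn2 t).const_mul (1 / (4 * (z * E.R)))))) fun x _ => by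
        have := epsGreedy_regret_le_pointwise (E := E) (N := N) (n := n) hη x
        rwa [hrate, hη2] at this
    rw [integral_add (((Bandit.Nice.const (z * E.R)).add (hn1 t)).integrable halg)
      (((Bandit.Nice.const (z * E.R)).add
        ((hn2 t).const_mul (1 / (4 * (z * E.R))))).integrable halg),
      integral_add ((Bandit.Nice.const (E := E) (z * E.R)).integrable halg)
        ((hn1 t).integrable halg),
      integral_add ((Bandit.Nice.const (E := E) (z * E.R)).integrable halg)
        (((hn2 t).const_mul (1 / (4 * (z * E.R)))).integrable halg),
      Bandit.integral_history_const halg, integral_const_mul] at h1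
    linarith [hB t]
  refine (Finset.sum_le_sum fun t _ => hround t).trans ?_
  have h1 := Bandit.sum_sum_integral_mul_sq_empMean_sub_le (n := n) halg hN0 hI hN
  -- The logarithm is `log (1 + z⁻³) ≤ 3 log (1 + z⁻¹)`. The loss of a factor `1 / z` is affordable,
  -- as `N A / z = z² n` is then exactly what `η` balances.
  have h2 : Real.log (1 + n / (N * Fintype.card A)) ≤ 3 / z := by
    have h3 : (n : ℝ) / (N * Fintype.card A) = (1 / z) ^ 3 := by
      rw [hz3', div_pow]; field_simp
    have hz' : 0 < 1 / z := by positivity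
    have h4 : 1 + (1 / z) ^ 3 ≤ (1 + 1 / z) ^ 3 := by nlinarith [pow_pos hz' 2]
    rw [h3]
    refine (Real.log_le_log (by positivity) h4).trans ?_
    rw [Real.log_pow]
    have := Real.log_le_sub_one_of_pos (show 0 < 1 + 1 / z by positivity)
    push_cast
    rw [show 3 / z = 3 * (1 / z) by ring]
    linarith
  have h3 : 1 / (4 * (z * E.R)) * (12 * E.R ^ 2 * (N * Fintype.card A *
      Real.log (1 + n / (N * Fintype.card A)))) ≤ 9 * n * E.R * z := by
    calc _ ≤ 1 / (4 * (z * E.R)) * (12 * E.R ^ 2 * (N * Fintype.card A * (3 / z))) := by gcongr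
      _ = 9 * n * E.R * z := by rw [hz3']; field_simp; norm_num
  have h4 := (mul_le_mul_of_nonneg_left h1 hη.le).trans h3
  have h5 : 42 * E.R * z * Real.sqrt n * ∑ t ∈ Finset.range n, 1 / Real.sqrt (t + 1) ≤
      84 * n * E.R * z := by
    calc _ ≤ 42 * E.R * z * Real.sqrt n * (2 * Real.sqrt n) := by
          gcongr
          exact sum_one_div_sqrt_le n
      _ = 84 * (Real.sqrt n) ^ 2 * E.R * z := by ring
      _ = _ := by rw [Real.sq_sqrt hn'.le]
  have h6 : ∑ _t ∈ Finset.range n, 2 * (z * E.R) = 2 * n * E.R * z := by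
    rw [Finset.sum_const, Finset.card_range, nsmul_eq_mul]; ring
  have h7 : 0 < n * E.R * z := by positivity
  -- The three contributions are `2`, `84` and `9` times `n R z`.
  rw [Finset.sum_add_distrib, Finset.sum_add_distrib, h6, ← Finset.mul_sum, ← Finset.mul_sum]
  linarith

end EpsGreedyRegret

/-! ### Inverse gap weighting -/

section InverseGapWeight

variable {A : Type*} [Fintype A] [Nonempty A]

theorem inverseGapWeight_greedy {γ : ℝ} (f : A → ℝ) :
    inverseGapWeight γ f (greedy f) = 1 - (∑ b, 1 / (Fintype.card A + γ * (f (greedy f) - f b)) -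
      1 / (Fintype.card A : ℝ)) := by
  classical
  have h := Finset.add_sum_erase Finset.univ
    (fun b => 1 / ((Fintype.card A : ℝ) + γ * (f (greedy f) - f b))) (Finset.mem_univ (greedy f))
  simp only [sub_self, mul_zero, add_zero] at h
  rw [← h, add_sub_cancel_left]
  simp only [inverseGapWeight, if_true]

theorem inverseGapWeight_of_ne {γ : ℝ} (f : A → ℝ) {a : A} (ha : a ≠ greedy f) :
    inverseGapWeight γ f a = 1 / (Fintype.card A + γ * (f (greedy f) - f a)) := by
  simp [inverseGapWeight, ha]

/-- Equality for the non-greedy actions by definition. Their weights are at most `1 / A`, so the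
greedy action keeps at least `1 / A`. This bounds the inverse probabilities in the change of
measure. -/
theorem one_le_inverseGapWeight_mul {γ : ℝ} (hγ : 0 ≤ γ) (f : A → ℝ) (a : A) :
    1 ≤ inverseGapWeight γ f a * (Fintype.card A + γ * (f (greedy f) - f a)) := by
  have hA : (0 : ℝ) < Fintype.card A := by exact_mod_cast Fintype.card_pos
  have hpos : ∀ b, (Fintype.card A : ℝ) ≤ Fintype.card A + γ * (f (greedy f) - f b) := fun b =>
    le_add_of_nonneg_right (mul_nonneg hγ (sub_nonneg.2 (le_greedy f b)))
  by_cases ha : a = greedy f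
  · rw [ha, inverseGapWeight_greedy, sub_self, mul_zero, add_zero]
    have h1 : ∑ b, 1 / (Fintype.card A + γ * (f (greedy f) - f b)) ≤
        ∑ _b : A, 1 / (Fintype.card A : ℝ) :=
      Finset.sum_le_sum fun b _ => one_div_le_one_div_of_le hA (hpos b)
    have h2 : ∑ _b : A, 1 / (Fintype.card A : ℝ) = 1 := by simp [hA.ne']
    have h3 : 1 / (Fintype.card A : ℝ) ≤ 1 -
        (∑ b, 1 / (Fintype.card A + γ * (f (greedy f) - f b)) - 1 / (Fintype.card A : ℝ)) := by
      linarith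
    have h4 := mul_le_mul_of_nonneg_right h3 hA.le
    rwa [one_div_mul_cancel hA.ne'] at h4
  · rw [inverseGapWeight_of_ne f ha, one_div_mul_cancel (hA.trans_le (hpos a)).ne']

theorem sum_inverseGapWeight_mul_gap_le {γ : ℝ} (hγ : 0 < γ) (f : A → ℝ) :
    ∑ a, inverseGapWeight γ f a * (f (greedy f) - f a) ≤ Fintype.card A / γ := by
  have hA : (0 : ℝ) < Fintype.card A := by exact_mod_cast Fintype.card_pos
  have h1 : ∀ a, inverseGapWeight γ f a * (f (greedy f) - f a) ≤ 1 / γ := by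
    intro a
    by_cases ha : a = greedy f
    · rw [ha, sub_self, mul_zero]; positivity
    · have hg : 0 ≤ f (greedy f) - f a := sub_nonneg.2 (le_greedy f a)
      rw [inverseGapWeight_of_ne f ha, div_mul_eq_mul_div, one_mul,
        div_le_div_iff₀ (by positivity) hγ]
      linarith
  refine (Finset.sum_le_sum fun a _ => h1 a).trans (le_of_eq ?_)
  rw [Finset.sum_const, Finset.card_univ, nsmul_eq_mul, mul_one_div]

theorem measurable_inverseGapWeight {α : Type*} [MeasurableSpace α] {f : α → A → ℝ}
    (hf : ∀ a, Measurable fun x => f x a) (γ : ℝ) (a : A) :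
    Measurable fun x => inverseGapWeight γ (f x) a := by
  classical
  have h1 : ∀ x, inverseGapWeight γ (f x) a = if a = greedy (f x) then
      1 - (∑ b, 1 / (Fintype.card A + γ * (f x (greedy (f x)) - f x b)) -
        1 / (Fintype.card A : ℝ))
      else 1 / (Fintype.card A + γ * (f x (greedy (f x)) - f x a)) := by
    intro x
    by_cases ha : a = greedy (f x)
    · rw [if_pos ha, ← inverseGapWeight_greedy, ← ha]
    · rw [if_neg ha, inverseGapWeight_of_ne _ ha]
  simp_rw [h1]
  have hg : Measurable fun x => f x (greedy (f x)) := measurable_comp_greedy hf hf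
  have hw : ∀ b, Measurable fun x =>
      1 / (Fintype.card A + γ * (f x (greedy (f x)) - f x b)) := fun b =>
    measurable_const.div (measurable_const.add ((hg.sub (hf b)).const_mul γ))
  exact Measurable.ite (measurable_ite_eq_greedy hf a) (measurable_const.sub
    ((Finset.measurable_sum _ fun b _ => hw b).sub_const _)) (hw a)

end InverseGapWeight

/-! ### Regret and estimated regret -/

namespace Bandit

section Errors

variable {S A : Type*} [Fintype S] [Fintype A] (E : Bandit S A)

/-- Mean absolute difference between `f` and `g` under `p`. -/
def absError (f g : S → A → ℝ) (p : S → stdSimplex ℝ A) : ℝ :=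
  ∑ s, E.d s * ∑ a, p s a * |f s a - g s a|

/-- Mean squared difference between `f` and `g` under `p`. -/
def sqError (f g : S → A → ℝ) (p : S → stdSimplex ℝ A) : ℝ :=
  ∑ s, E.d s * ∑ a, p s a * (f s a - g s a) ^ 2

theorem absError_comm (f g : S → A → ℝ) (p : S → stdSimplex ℝ A) :
    E.absError f g p = E.absError g f p := by
  simp only [absError, abs_sub_comm]

theorem sqError_nonneg (f g : S → A → ℝ) (p : S → stdSimplex ℝ A) : 0 ≤ E.sqError f g p :=
  Finset.sum_nonneg fun s _ => mul_nonneg (E.d_nonneg s) (Finset.sum_nonneg fun _ _ =>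
    mul_nonneg (stdSimplex.zero_le _ _) (sq_nonneg _))

/-- Completing the square with weights `p² / q` and `q`, followed by `p² ≤ p` and `1 / q ≤ K`. -/
theorem mul_abs_le {p q K η e : ℝ} (hp0 : 0 ≤ p) (hp1 : p ≤ 1) (hq : 0 ≤ q) (hη : 0 < η)
    (hK : 1 ≤ q * K) : p * |e| ≤ 1 / (4 * η) * (p * K) + η * (q * e ^ 2) := by
  have hq0 : 0 < q := by
    rcases hq.eq_or_lt with h | h
    · rw [← h, zero_mul] at hK; linarith
    · exact h
  have hK' : 1 / q ≤ K := by rw [div_le_iff₀ hq0, mul_comm]; exact hK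
  have h1 : 1 / (4 * η) * (p ^ 2 * (1 / q)) + η * (q * e ^ 2) - p * |e| =
      1 / (4 * η * q) * (p - 2 * η * q * |e|) ^ 2 := by
    rw [sub_sq, mul_pow _ |e|, sq_abs]
    field_simp
    ring
  have h2 : 0 ≤ 1 / (4 * η * q) * (p - 2 * η * q * |e|) ^ 2 := by positivity
  have h3 : p ^ 2 * (1 / q) ≤ p * K := by
    have : p ^ 2 ≤ p := by nlinarith
    exact mul_le_mul this hK' (by positivity) hp0
  have h4 : 1 / (4 * η) * (p ^ 2 * (1 / q)) ≤ 1 / (4 * η) * (p * K) :=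
    mul_le_mul_of_nonneg_left h3 (by positivity)
  linarith

end Errors

section Policies

variable {S A : Type*} [Fintype A] [Nonempty A]

/-- The greedy policy. -/
def greedyPolicy (f : S → A → ℝ) : S → stdSimplex ℝ A := fun s =>
  open Classical in ⟨Pi.single (greedy (f s)) 1, single_mem_stdSimplex ℝ _⟩

theorem sum_greedyPolicy_mul (f : S → A → ℝ) (s : S) (g : A → ℝ) :
    ∑ a, greedyPolicy f s a * g a = g (greedy (f s)) := by
  classical
  change ∑ a, (Pi.single (greedy (f s)) (1 : ℝ) : A → ℝ) a * g a = _
  simp [Pi.single_apply]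

/-- The inverse gap weighting policy. -/
def gapPolicy {γ : ℝ} (hγ : 0 ≤ γ) (f : S → A → ℝ) : S → stdSimplex ℝ A := fun s =>
  ⟨_, inverseGapWeight_mem hγ (f s)⟩

end Policies

section EstimatedRegret

variable {S A : Type*} [Fintype S] [Fintype A] [Nonempty A] (E : Bandit S A)

/-- The regret of `p` if `f` were the mean rewards. -/
def estRegret (f : S → A → ℝ) (p : S → stdSimplex ℝ A) : ℝ :=
  ∑ s, E.d s * (f s (greedy (f s)) - ∑ a, p s a * f s a)

theorem regret_eq_estRegret (p : S → stdSimplex ℝ A) : E.regret p = E.estRegret E.mean p := rfl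

theorem estRegret_nonneg (f : S → A → ℝ) (p : S → stdSimplex ℝ A) : 0 ≤ E.estRegret f p := by
  refine Finset.sum_nonneg fun s _ => mul_nonneg (E.d_nonneg s) (sub_nonneg.2 ?_)
  calc ∑ a, p s a * f s a ≤ ∑ a, p s a * f s (greedy (f s)) :=
        Finset.sum_le_sum fun a _ =>
          mul_le_mul_of_nonneg_left (le_greedy _ a) (stdSimplex.zero_le _ _)
    _ = _ := by rw [← Finset.sum_mul]; simp

theorem regret_nonneg (p : S → stdSimplex ℝ A) : 0 ≤ E.regret p := E.estRegret_nonneg E.mean p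

theorem estRegret_greedyPolicy (f : S → A → ℝ) : E.estRegret f (greedyPolicy f) = 0 := by
  simp [estRegret, sum_greedyPolicy_mul]

/-- The two reward functions have to be compared only on the policy `p` and on the greedy policy for
`g`, because `f` at the greedy action for `g` never exceeds the maximum of `f`. -/
theorem estRegret_le_add_absError (f g : S → A → ℝ) (p : S → stdSimplex ℝ A) :
    E.estRegret g p ≤ E.estRegret f p + E.absError f g (greedyPolicy g) + E.absError f g p := by
  simp only [estRegret, absError, ← Finset.sum_add_distrib, ← mul_add, sum_greedyPolicy_mul]
  refine Finset.sum_le_sum fun s _ => mul_le_mul_of_nonneg_left ?_ (E.d_nonneg s)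
  have h1 : ∑ a, p s a * f s a - ∑ a, p s a * g s a ≤ ∑ a, p s a * |f s a - g s a| := by
    rw [← Finset.sum_sub_distrib]
    refine Finset.sum_le_sum fun a _ => ?_
    rw [← mul_sub]
    exact mul_le_mul_of_nonneg_left (le_abs_self _) (stdSimplex.zero_le _ _)
  have h2 := le_greedy (f s) (greedy (g s))
  linarith [neg_abs_le (f s (greedy (g s)) - g s (greedy (g s)))]

theorem estRegret_gapPolicy_le {γ : ℝ} (hγ : 0 < γ) (f : S → A → ℝ) :
    E.estRegret f (gapPolicy hγ.le f) ≤ Fintype.card A / γ := by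
  have h1 : ∀ s, f s (greedy (f s)) - ∑ a, gapPolicy hγ.le f s a * f s a ≤
      Fintype.card A / γ := by
    intro s
    refine le_trans (le_of_eq ?_) (sum_inverseGapWeight_mul_gap_le hγ (f s))
    have h2 := (inverseGapWeight_mem hγ.le (f s)).2
    simp only [mul_sub, Finset.sum_sub_distrib, ← Finset.sum_mul, h2, one_mul]
    rfl
  refine (Finset.sum_le_sum fun s _ => mul_le_mul_of_nonneg_left (h1 s) (E.d_nonneg s)).trans ?_
  rw [← Finset.sum_mul, E.d_sum, one_mul]

/-- Change of measure from the inverse gap weighting policy to `p`. -/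
theorem absError_le {γ η : ℝ} (hγ : 0 ≤ γ) (hη : 0 < η) (f' f g : S → A → ℝ)
    (p : S → stdSimplex ℝ A) :
    E.absError f g p ≤ 1 / (4 * η) * (Fintype.card A + γ * E.estRegret f' p) +
      η * E.sqError f g (gapPolicy hγ f') := by
  have h1 : ∀ s, ∑ a, p s a * |f s a - g s a| ≤
      1 / (4 * η) * (Fintype.card A + γ * (f' s (greedy (f' s)) - ∑ a, p s a * f' s a)) +
      η * ∑ a, gapPolicy hγ f' s a * (f s a - g s a) ^ 2 := by
    intro s
    have h2 : ∀ a, p s a * |f s a - g s a| ≤ 1 / (4 * η) * (p s a *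
        (Fintype.card A + γ * (f' s (greedy (f' s)) - f' s a))) +
        η * (gapPolicy hγ f' s a * (f s a - g s a) ^ 2) := fun a =>
      mul_abs_le (stdSimplex.zero_le _ _) (stdSimplex.le_one _ _) (stdSimplex.zero_le _ _) hη
        (one_le_inverseGapWeight_mul hγ (f' s) a)
    refine (Finset.sum_le_sum fun a _ => h2 a).trans (le_of_eq ?_)
    rw [Finset.sum_add_distrib, ← Finset.mul_sum, ← Finset.mul_sum]
    congr 2
    have h3 : ∀ a, p s a * (Fintype.card A + γ * (f' s (greedy (f' s)) - f' s a)) =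
        p s a * (Fintype.card A + γ * f' s (greedy (f' s))) - γ * (p s a * f' s a) :=
      fun a => by ring
    simp only [h3, Finset.sum_sub_distrib, ← Finset.sum_mul, ← Finset.mul_sum,
      stdSimplex.sum_eq_one]
    ring
  unfold absError estRegret sqError
  refine (Finset.sum_le_sum fun s _ => mul_le_mul_of_nonneg_left (h1 s) (E.d_nonneg s)).trans
    (le_of_eq ?_)
  have h4 : ∀ s (u w : ℝ), E.d s * (1 / (4 * η) * (Fintype.card A + γ * u) + η * w) =
      E.d s * (1 / (4 * η) * Fintype.card A) + 1 / (4 * η) * γ * (E.d s * u) +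
        η * (E.d s * w) := fun s u w => by ring
  simp only [h4, Finset.sum_add_distrib, ← Finset.sum_mul, E.d_sum, ← Finset.mul_sum]
  ring

/-- One epoch: if the estimated regret of the previous epoch is controlled by the regret, then
regret and estimated regret control each other. -/
theorem regret_estRegret_step {γ' γ B : ℝ} (hγ' : 0 ≤ γ') (hγ : 0 < γ) (f' f : S → A → ℝ)
    (h : ∀ p, γ' * E.estRegret f' p ≤ γ * (2 * E.regret p + B)) (p : S → stdSimplex ℝ A) :
    E.estRegret f p ≤ 2 * E.regret p + (B / 7 + 16 / 7 * (Fintype.card A / (16 * γ) +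
      4 * γ * E.sqError f E.mean (gapPolicy hγ' f'))) ∧
    E.regret p ≤ 2 * E.estRegret f p + (B / 7 + 16 / 7 * (Fintype.card A / (16 * γ) +
      4 * γ * E.sqError f E.mean (gapPolicy hγ' f'))) := by
  set b := Fintype.card A / (16 * γ) + 4 * γ * E.sqError f E.mean (gapPolicy hγ' f') with hb
  -- The choice `η = 4 γ` turns the estimated regret into `1/8` of the regret, small enough to be
  -- absorbed on the left.
  have herr : ∀ p, E.absError f E.mean p ≤ E.regret p / 8 + B / 16 + b := by
    intro p
    have h1 := E.absError_le hγ' (η := 4 * γ) (by positivity) f' f E.mean p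
    have h2 : 1 / (4 * (4 * γ)) * (Fintype.card A + γ' * E.estRegret f' p) ≤
        1 / (4 * (4 * γ)) * (Fintype.card A + γ * (2 * E.regret p + B)) := by
      exact mul_le_mul_of_nonneg_left (add_le_add_right (h p) _) (by positivity)
    have h3 : 1 / (4 * (4 * γ)) * (Fintype.card A + γ * (2 * E.regret p + B)) =
        Fintype.card A / (16 * γ) + E.regret p / 8 + B / 16 := by
      field_simp
      ring
    rw [hb]
    linarith
  have hreg0 : ∀ p, E.regret p * (7 / 8) ≤ E.estRegret f p + B / 8 + 2 * b := by
    intro p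
    have h1 := E.estRegret_le_add_absError f E.mean p
    have h2 := herr (greedyPolicy E.mean)
    rw [E.regret_eq_estRegret, E.estRegret_greedyPolicy] at h2
    have h3 := herr p
    rw [← E.regret_eq_estRegret] at h1
    linarith
  have hn := E.regret_nonneg p
  have he := E.estRegret_nonneg f p
  have h1 := hreg0 p
  -- The greedy policy for `f` has estimated regret zero, so its true regret is at most `B / 7 + 16
  -- b / 7`. Through `herr` this controls the error at that policy and gives the same slack in both
  -- directions.
  have h2 := hreg0 (greedyPolicy f)
  rw [E.estRegret_greedyPolicy] at h2
  have h3 := E.estRegret_le_add_absError E.mean f p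
  rw [← E.regret_eq_estRegret, E.absError_comm, E.absError_comm E.mean f p] at h3
  have h4 := herr (greedyPolicy f)
  have h5 := herr p
  constructor <;> linarith

/-- The bound for the regret in terms of the estimated regret of epoch `i`. -/
def epochSlack (γ : ℕ → ℝ) (hγ : ∀ i, 0 ≤ γ i) (f : ℕ → S → A → ℝ) : ℕ → ℝ
  | 0 => E.R
  | i + 1 => epochSlack γ hγ f i / 7 + 16 / 7 * (Fintype.card A / (16 * γ (i + 1)) +
      4 * γ (i + 1) * E.sqError (f (i + 1)) E.mean (gapPolicy (hγ i) (f i)))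

theorem epochSlack_nonneg {γ : ℕ → ℝ} (hγ : ∀ i, 0 ≤ γ i) (f : ℕ → S → A → ℝ) (i : ℕ) :
    0 ≤ E.epochSlack γ hγ f i := by
  induction i with
  | zero => exact E.R_nonneg
  | succ i ih =>
    have h1 := hγ (i + 1)
    have h2 := E.sqError_nonneg (f (i + 1)) E.mean (gapPolicy (hγ i) (f i))
    rw [epochSlack]
    positivity

theorem estRegret_zero (p : S → stdSimplex ℝ A) : E.estRegret (fun _ _ => 0) p = 0 := by
  simp [estRegret]

theorem regret_estRegret_epoch {γ : ℕ → ℝ} (hγ : ∀ i, 0 ≤ γ i) (hγ0 : ∀ i, 0 < γ (i + 1))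
    (hmono : ∀ i, γ (i + 1) ≤ γ (i + 2)) {f : ℕ → S → A → ℝ} (hf : f 0 = fun _ _ => 0)
    (i : ℕ) (p : S → stdSimplex ℝ A) :
    E.estRegret (f i) p ≤ 2 * E.regret p + E.epochSlack γ hγ f i ∧
    E.regret p ≤ 2 * E.estRegret (f i) p + E.epochSlack γ hγ f i := by
  induction i generalizing p with
  | zero =>
    rw [hf, E.estRegret_zero, epochSlack]
    constructor <;> linarith [E.regret_nonneg p, E.R_nonneg, E.regret_le p]
  | succ i ih =>
    refine E.regret_estRegret_step (hγ i) (hγ0 i) (f i) (f (i + 1)) (fun p => ?_) p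
    have h1 : 0 ≤ 2 * E.regret p + E.epochSlack γ hγ f i := by
      linarith [E.regret_nonneg p, E.epochSlack_nonneg hγ f i]
    -- The zero estimate of the first epoch has no estimated regret, so the initial rate `γ 0` need
    -- not be below `γ 1`.
    rcases i with _ | i
    · rw [hf, E.estRegret_zero, mul_zero]
      exact mul_nonneg (hγ0 0).le h1
    · exact mul_le_mul (hmono i) (ih p).1 (E.estRegret_nonneg _ _) (hγ0 (i + 1)).le

theorem regret_gapPolicy_le {γ : ℕ → ℝ} (hγ : ∀ i, 0 ≤ γ i) (hγ0 : ∀ i, 0 < γ (i + 1))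
    (hmono : ∀ i, γ (i + 1) ≤ γ (i + 2)) {f : ℕ → S → A → ℝ} (hf : f 0 = fun _ _ => 0)
    (i : ℕ) :
    E.regret (gapPolicy (hγ (i + 1)) (f (i + 1))) ≤
      2 * (Fintype.card A / γ (i + 1)) + E.epochSlack γ hγ f (i + 1) := by
  have h1 := (E.regret_estRegret_epoch hγ hγ0 hmono hf (i + 1)
    (gapPolicy (hγ (i + 1)) (f (i + 1)))).2
  have h2 := E.estRegret_gapPolicy_le (hγ0 i) (f (i + 1))
  linarith

end EstimatedRegret

end Bandit

/-! ### FALCON+ -/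

section EpochLengths

/-- Length of epoch `i + 1`. -/
def epochLen (i : ℕ) : ℕ := epochEnd (i + 1) - epochEnd i

theorem epochEnd_add_epochLen (i : ℕ) : epochEnd i + epochLen i = epochEnd (i + 1) := by
  have : epochEnd i ≤ epochEnd (i + 1) := by
    rcases i with _ | i
    · simp [epochEnd]
    · simpa [epochEnd] using Nat.pow_le_pow_right two_pos (Nat.le_succ (i + 1))
  unfold epochLen
  omega

theorem epochLen_zero : epochLen 0 = 2 := by simp [epochLen, epochEnd]

theorem epochLen_succ (i : ℕ) : epochLen (i + 1) = 2 ^ (i + 1) := by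
  simp [epochLen, epochEnd, pow_succ]
  omega

theorem two_pow_le_epochLen (i : ℕ) : 2 ^ i ≤ epochLen i := by
  rcases i with _ | i
  · simp [epochLen_zero]
  · rw [epochLen_succ]

theorem epochLen_pos (i : ℕ) : 0 < epochLen i := (Nat.two_pow_pos i).trans_le (two_pow_le_epochLen i)

theorem epochLen_mono (i : ℕ) : epochLen i ≤ epochLen (i + 1) := by
  rcases i with _ | i
  · simp [epochLen_zero, epochLen_succ]
  · rw [epochLen_succ, epochLen_succ]
    exact Nat.pow_le_pow_right two_pos (Nat.le_succ _)

/-- Throughout epoch `i + 1` the oracle thus uses the same rate and the same estimate. The first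
epoch consists of rounds `0` and `1`, both with logarithm `0`. -/
theorem log_eq_of_mem_epoch {i j : ℕ} (hj : j < epochLen i) : Nat.log 2 (epochEnd i + j) = i := by
  rcases i with _ | i
  · rw [epochLen_zero] at hj
    simp only [epochEnd, if_true, zero_add]
    exact Nat.log_of_lt hj
  · rw [epochLen_succ] at hj
    have h : epochEnd (i + 1) = 2 ^ (i + 1) := by simp [epochEnd]
    rw [h]
    refine Nat.log_eq_of_pow_le_of_lt_pow (Nat.le_add_right _ _) ?_
    rw [pow_succ 2 (i + 1)]
    omega

theorem falconRate_eq {N nA : ℕ} (hN : 0 < N) (hA : 0 < nA) {R : ℝ} (hR : 0 < R) (i : ℕ) :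
    falconRate N nA R (i + 2) = Real.sqrt (epochLen i / N) / (2 * R) := by
  have h1 : ((epochEnd (i + 1) : ℝ) - epochEnd i) = epochLen i := by
    rw [← epochEnd_add_epochLen]
    push_cast
    ring
  have hℓ : (0 : ℝ) < epochLen i := by exact_mod_cast epochLen_pos i
  have hN' : (0 : ℝ) < N := by exact_mod_cast hN
  have hA' : (0 : ℝ) < nA := by exact_mod_cast hA
  have h2 : (nA : ℝ) / (R ^ 2 * N * nA / epochLen i) = epochLen i / N / R ^ 2 := by field_simp
  rw [falconRate, if_neg (by omega)]
  simp only [tabularError, show i + 2 - 1 = i + 1 by omega, Nat.add_sub_cancel]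
  rw [h1, h2, Real.sqrt_div' _ (sq_nonneg R), Real.sqrt_sq hR.le]
  field_simp

end EpochLengths

section FalconEst

variable {S A : Type*}

/-- The estimate computed from the data of epoch `i` (no data for `i = 0`). -/
def falconEst {t : ℕ} (x : Fin t → S × A × ℝ) (i : ℕ) (s : S) : A → ℝ :=
  empMean x (epochEnd (i - 1)) (epochEnd i) s

theorem falconEst_zero {t : ℕ} (x : Fin t → S × A × ℝ) : falconEst x 0 = fun _ _ => 0 := by
  classical
  funext s a
  have h : ∀ i : Fin t, ¬ (i : ℕ) < epochEnd 0 := fun i => by simp [epochEnd]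
  simp [falconEst, empMean, h]

end FalconEst

section Falcon

variable {S A : Type*} [Fintype A]

theorem falconPlus_eq [Nonempty A] (N : ℕ) (R : ℝ) (t : ℕ) (x : Fin t → S × A × ℝ) :
    falconPlus N R t x = Bandit.gapPolicy
      (falconRate_nonneg N (Fintype.card A) R (Nat.log 2 t + 1)) (falconEst x (Nat.log 2 t)) := rfl

variable [MeasurableSpace S] [DiscreteMeasurableSpace S] [MeasurableSpace A]
  [DiscreteMeasurableSpace A]

theorem measurable_gapPolicy_falconEst [Nonempty A] {γ : ℝ} (hγ : 0 ≤ γ) (t i : ℕ) (s : S)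
    (a : A) : Measurable fun x : Fin t → S × A × ℝ => Bandit.gapPolicy hγ (falconEst x i) s a :=
  measurable_inverseGapWeight (f := fun x : Fin t → S × A × ℝ => falconEst x i s)
    (fun b => measurable_empMean _ _ s b) γ a

theorem falconPlus_isMeasurable [Nonempty A] (N : ℕ) (R : ℝ) :
    (falconPlus N R : CBAlgorithm S A).IsMeasurable := by
  intro t s a
  simp only [falconPlus_eq]
  exact measurable_gapPolicy_falconEst _ t _ s a

variable [Fintype S] {E : Bandit S A}

namespace Bandit

theorem nice_sqError_falconEst [Nonempty A] {γ : ℝ} (hγ : 0 ≤ γ) (t i j : ℕ) :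
    E.Nice fun x : Fin t → S × A × ℝ =>
      E.sqError (falconEst x i) E.mean (gapPolicy hγ (falconEst x j)) :=
  Nice.sum _ fun s => Nice.const_mul (Nice.sum _ fun a => Nice.mul
    ⟨measurable_gapPolicy_falconEst hγ t j s a, 1, fun x _ => by
      rw [abs_of_nonneg (stdSimplex.zero_le _ _)]; exact stdSimplex.le_one _ _⟩
    ((nice_empMean_sub _ _ s a).pow 2)) _

/-- Expected squared error of the estimates of FALCON+ under the policy of the epoch in which the
data were collected. -/
theorem integral_sqError_falconEst_le [Nonempty A] {N : ℕ} {I : Finset S}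
    (hI : ∀ s ∉ I, E.d s = 0) (hN : I.card ≤ N) (R : ℝ) (i : ℕ) {t : ℕ}
    (ht : epochEnd (i + 1) ≤ t) :
    ∫ x, E.sqError (falconEst x (i + 1)) E.mean
      (gapPolicy (falconRate_nonneg N (Fintype.card A) R (i + 1)) (falconEst x i))
      ∂(E.history (falconPlus N R) t) ≤ 20 * E.R ^ 2 * N * Fintype.card A / epochLen i := by
  have halg := falconPlus_isMeasurable (S := S) (A := A) N R
  -- The history is split into the rounds before the epoch, which fix its policy, the rounds of the
  -- epoch, which give the data, and later rounds, which are integrated out.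
  obtain ⟨j, hj⟩ : ∃ j, t = epochEnd i + epochLen i + j := by
    rw [epochEnd_add_epochLen]
    exact Nat.exists_eq_add_of_le ht
  subst hj
  set γ := falconRate N (Fintype.card A) R (i + 1)
  have hγ : 0 ≤ γ := falconRate_nonneg N (Fintype.card A) R (i + 1)
  -- probability of playing `a` in context `s` in epoch `i + 1`
  let q : S → A → (Fin (epochEnd i) → S × A × ℝ) → ℝ := fun s a y =>
    E.d s * gapPolicy hγ (falconEst y i) s a
  let G : S → A → (Fin (epochEnd i + epochLen i) → S × A × ℝ) → ℝ := fun s a x =>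
    q s a (fun k => x (Fin.castAdd (epochLen i) k)) *
      (empMean x (epochEnd i) (epochEnd i + epochLen i) s a - E.mean s a) ^ 2
  have hq : ∀ s a, Measurable (q s a) := fun s a =>
    (measurable_gapPolicy_falconEst hγ _ i s a).const_mul _
  have hq0 : ∀ s a y, 0 ≤ q s a y := fun s a y =>
    mul_nonneg (E.d_nonneg s) (stdSimplex.zero_le _ _)
  have hq1 : ∀ s a y, q s a y ≤ 1 := fun s a y =>
    mul_le_one₀ (E.d_le_one s) (stdSimplex.zero_le _ _) (stdSimplex.le_one _ _)
  have hest : ∀ (m : ℕ) (x : Fin (epochEnd i + m) → S × A × ℝ),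
      falconEst (fun k => x (Fin.castAdd m k)) i = falconEst x i := fun m x =>
    funext fun s => funext fun a => empMean_castAdd x _ s a le_rfl
  have hP : ∀ s a, ∀ m < epochLen i, ∀ x : Fin (epochEnd i + m) → S × A × ℝ,
      q s a (fun k => x (Fin.castAdd m k)) ≤ E.d s * falconPlus N R (epochEnd i + m) x s a := by
    intro s a m hm x
    simp only [q]
    rw [falconPlus_eq, hest]
    have : ∀ l, l = i → gapPolicy hγ (falconEst x i) s a = gapPolicy
        (falconRate_nonneg N (Fintype.card A) R (l + 1)) (falconEst x l) s a := by
      rintro l rfl; rfl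
    rw [this _ (log_eq_of_mem_epoch hm)]
  have hG : ∀ s a, ∫ x, G s a x ∂(E.history (falconPlus N R) (epochEnd i + epochLen i)) ≤
      20 * E.R ^ 2 / epochLen i := fun s a =>
    integral_mul_sq_empMean_sub_le halg s a (epochEnd i) (epochLen i) (epochLen_pos i) (hq s a)
      (hq0 s a) (hq1 s a) (hP s a)
  have hGn : ∀ s a, E.Nice (G s a) := fun s a =>
    (Nice.comp_good (t := epochEnd i) ⟨hq s a, 1, fun y _ => by
      rw [abs_of_nonneg (hq0 s a y)]; exact hq1 s a y⟩ _).mul ((nice_empMean_sub _ _ s a).pow 2)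
  have hsum : ∀ x : Fin (epochEnd i + epochLen i + j) → S × A × ℝ,
      E.sqError (falconEst x (i + 1)) E.mean (gapPolicy hγ (falconEst x i)) =
      ∑ s ∈ I, ∑ a, G s a (fun k => x (Fin.castAdd j k)) := by
    intro x
    unfold sqError
    rw [← Finset.sum_subset (Finset.subset_univ I) fun s _ hs => by rw [hI s hs, zero_mul]]
    refine Finset.sum_congr rfl fun s _ => ?_
    rw [Finset.mul_sum]
    refine Finset.sum_congr rfl fun a _ => ?_
    simp only [G, q]
    have hnext : falconEst x (i + 1) s a =
        empMean x (epochEnd i) (epochEnd i + epochLen i) s a :=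
      congrArg (fun m => empMean x (epochEnd i) m s a) (epochEnd_add_epochLen i).symm
    rw [hest (epochLen i) fun k => x (Fin.castAdd j k), empMean_castAdd x _ s a le_rfl, hnext,
      mul_assoc]
    have : falconEst (fun k => x (Fin.castAdd j k)) i = falconEst x i :=
      funext fun s => funext fun a => empMean_castAdd x _ s a (Nat.le_add_right _ _)
    rw [this]
  simp_rw [hsum]
  rw [integral_history_castAdd halg (F := fun x => ∑ s ∈ I, ∑ a, G s a x)
    (Nice.sum _ fun s => Nice.sum _ fun a => hGn s a),
    integral_finsetSum _ fun s _ => (Nice.sum _ fun a => hGn s a).integrable halg]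
  have hs : ∀ s, ∫ x, ∑ a, G s a x ∂(E.history (falconPlus N R) (epochEnd i + epochLen i)) ≤
      Fintype.card A * (20 * E.R ^ 2 / epochLen i) := by
    intro s
    rw [integral_finsetSum _ fun a _ => (hGn s a).integrable halg]
    refine (Finset.sum_le_sum fun a _ => hG s a).trans (le_of_eq ?_)
    rw [Finset.sum_const, Finset.card_univ, nsmul_eq_mul]
  refine (Finset.sum_le_sum fun s _ => hs s).trans ?_
  rw [Finset.sum_const, nsmul_eq_mul]
  have hN' : (I.card : ℝ) ≤ N := by exact_mod_cast hN
  calc (I.card : ℝ) * (Fintype.card A * (20 * E.R ^ 2 / epochLen i))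
      ≤ N * (Fintype.card A * (20 * E.R ^ 2 / epochLen i)) := by gcongr
    _ = _ := by ring

end Bandit

end Falcon

/-! ### Expected slack and regret of FALCON+. -/

section FalconRegret

variable {S A : Type*} [Fintype S] [Fintype A] [Nonempty A] {E : Bandit S A}
  [MeasurableSpace S] [DiscreteMeasurableSpace S] [MeasurableSpace A]
  [DiscreteMeasurableSpace A]

theorem nice_epochSlack {γ : ℕ → ℝ} (hγ : ∀ i, 0 ≤ γ i) (t i : ℕ) :
    E.Nice fun x : Fin t → S × A × ℝ => E.epochSlack γ hγ (falconEst x) i := by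
  induction i with
  | zero => exact Bandit.Nice.const _
  | succ i ih =>
    simp only [Bandit.epochSlack]
    have h1 := ((Bandit.Nice.const (E := E) (t := t) (S := S) (A := A)
      (Fintype.card A / (16 * γ (i + 1)))).add
      ((Bandit.nice_sqError_falconEst (hγ i) t (i + 1) i).const_mul (4 * γ (i + 1)))).const_mul
        (16 / 7)
    have h2 := ih.const_mul (1 / 7)
    convert h2.add h1 using 2
    ring

/-- The bound decays only by `√2 ≤ 3/2` per epoch, which is harmless against the contraction `1/7`
of the slack. -/
theorem sqrt_div_two_pow_le (c : ℝ) (hc : 0 ≤ c) (i : ℕ) :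
    Real.sqrt (c / 2 ^ i) ≤ 3 / 2 * Real.sqrt (c / 2 ^ (i + 1)) := by
  have h0 : 0 ≤ c / 2 ^ (i + 1) := by positivity
  refine Real.sqrt_le_iff.2 ⟨by positivity, ?_⟩
  rw [mul_pow, Real.sq_sqrt h0, pow_succ 2 i]
  have h1 : c / (2 ^ i * 2) = c / 2 ^ i / 2 := by field_simp
  have h2 : 0 ≤ c / 2 ^ i := by positivity
  rw [h1]
  linarith

theorem falconRate_eq_inv {N nA : ℕ} (hN : 0 < N) (hA : 0 < nA) {R : ℝ} (hR : 0 < R) (i : ℕ) :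
    falconRate N nA R (i + 2) = 1 / (2 * R * Real.sqrt (N / epochLen i)) := by
  have hℓ : (0 : ℝ) < epochLen i := by exact_mod_cast epochLen_pos i
  have hN' : (0 : ℝ) < N := by exact_mod_cast hN
  rw [falconRate_eq hN hA hR, ← inv_div (N : ℝ) (epochLen i : ℝ), Real.sqrt_inv]
  have : 0 < Real.sqrt (N / epochLen i) := by positivity
  field_simp

/-- With `v = √(N / ℓ)` and rate `1 / (2 R v)`, the new terms of the recursion are `R A v / 8` and,
in the mean, at most `40 R A v`. The induction closes because `(3/2) (200 / 7 + (16/7) (40 + 1/8)) <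
200`. -/
theorem integral_epochSlack_le {N : ℕ} {I : Finset S} (hI : ∀ s ∉ I, E.d s = 0)
    (hN : I.card ≤ N) (hR : 0 < E.R) (i : ℕ) {t : ℕ} (ht : epochEnd i ≤ t) :
    ∫ x, E.epochSlack (fun i => falconRate N (Fintype.card A) E.R (i + 1))
      (fun i => falconRate_nonneg N (Fintype.card A) E.R (i + 1)) (falconEst x) i
      ∂(E.history (falconPlus N E.R) t) ≤
    200 * (E.R * Fintype.card A * Real.sqrt (N / 2 ^ i)) := by
  have halg := falconPlus_isMeasurable (S := S) (A := A) N E.R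
  have hN0 : 0 < N := (E.card_pos_of_support hI).trans_le hN
  have hA0 : 0 < Fintype.card A := Fintype.card_pos
  have hN' : (0 : ℝ) < N := by exact_mod_cast hN0
  have hA' : (0 : ℝ) < Fintype.card A := by exact_mod_cast hA0
  induction i with
  | zero =>
    have h1 : (1 : ℝ) ≤ Fintype.card A := by exact_mod_cast hA0
    have h2 : (1 : ℝ) ≤ Real.sqrt (N / 2 ^ 0) := by
      rw [pow_zero, div_one, Real.one_le_sqrt]; exact_mod_cast hN0
    have h3 : 1 ≤ Fintype.card A * Real.sqrt (N / 2 ^ 0) := one_le_mul_of_one_le_of_one_le h1 h2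
    refine (Bandit.integral_history_const halg E.R).le.trans ?_
    nlinarith
  | succ i ih =>
    have hle : epochEnd i ≤ t := by
      rw [← epochEnd_add_epochLen] at ht
      omega
    have hi := ih hle
    have hsq := Bandit.integral_sqError_falconEst_le (E := E) hI hN E.R i ht
    simp only [Bandit.epochSlack]
    have := E.isProbabilityMeasure_history halg t
    have hslack := (nice_epochSlack (E := E)
      (fun i => falconRate_nonneg N (Fintype.card A) E.R (i + 1)) t i).integrable halg
    have herr := (Bandit.nice_sqError_falconEst (E := E)
      (falconRate_nonneg N (Fintype.card A) E.R (i + 1)) t (i + 1) i).integrable halg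
    have herr' : Integrable (fun x => Fintype.card A /
        (16 * falconRate N (Fintype.card A) E.R (i + 1 + 1)) +
        4 * falconRate N (Fintype.card A) E.R (i + 1 + 1) *
          E.sqError (falconEst x (i + 1)) E.mean (Bandit.gapPolicy
            (falconRate_nonneg N (Fintype.card A) E.R (i + 1)) (falconEst x i)))
        (E.history (falconPlus N E.R) t) := (integrable_const _).add (herr.const_mul _)
    rw [integral_add (hslack.div_const 7) (herr'.const_mul _), integral_div,
      integral_const_mul, integral_add (integrable_const _) (herr.const_mul _),
      integral_const_mul, Bandit.integral_history_const halg]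
    have hℓ : (0 : ℝ) < epochLen i := by exact_mod_cast epochLen_pos i
    have hstep := sqrt_div_two_pow_le N hN'.le i
    have hv : Real.sqrt (N / epochLen i) ≤ Real.sqrt (N / 2 ^ i) := by
      refine Real.sqrt_le_sqrt (div_le_div_of_nonneg_left hN'.le (by positivity) ?_)
      exact_mod_cast two_pow_le_epochLen i
    have hγ : falconRate N (Fintype.card A) E.R (i + 1 + 1) = _ := falconRate_eq_inv hN0 hA0 hR i
    have hγ0 := falconRate_nonneg N (Fintype.card A) E.R (i + 1 + 1)
    have hv0 : 0 < Real.sqrt (N / epochLen i) := by positivity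
    have hvsq : Real.sqrt (N / epochLen i) ^ 2 = N / epochLen i := Real.sq_sqrt (by positivity)
    have hlast := mul_le_mul_of_nonneg_left hsq (mul_nonneg zero_le_four hγ0)
    have hRA : 0 < E.R * Fintype.card A := by positivity
    have hfirst : Fintype.card A / (16 * falconRate N (Fintype.card A) E.R (i + 1 + 1)) =
        E.R * Fintype.card A * Real.sqrt (N / epochLen i) / 8 := by
      rw [hγ]
      field_simp
      norm_num
    have hsecond : 4 * falconRate N (Fintype.card A) E.R (i + 1 + 1) *
        (20 * E.R ^ 2 * N * Fintype.card A / epochLen i) =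
        40 * (E.R * Fintype.card A * Real.sqrt (N / epochLen i)) := by
      have : 20 * E.R ^ 2 * N * Fintype.card A / epochLen i =
          20 * E.R ^ 2 * Fintype.card A * Real.sqrt (N / epochLen i) ^ 2 := by
        rw [hvsq]; ring
      rw [this, hγ]
      field_simp
      norm_num
    rw [hsecond] at hlast
    rw [hfirst]
    have hW := mul_le_mul_of_nonneg_left hv hRA.le
    have hW' := mul_le_mul_of_nonneg_left hstep hRA.le
    have hW0 : 0 ≤ E.R * Fintype.card A * Real.sqrt (N / 2 ^ (i + 1)) := by positivity
    linarith

theorem falconPlus_regret {n N : ℕ} {I : Finset S} (hI : ∀ s ∉ I, E.d s = 0)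
    (hN : I.card ≤ N) (hR : 0 < E.R) :
    ∑ t ∈ Finset.range n, ∫ x, E.regret (falconPlus N E.R t x) ∂(E.history (falconPlus N E.R) t) ≤
      620 * E.R * Fintype.card A * Real.sqrt N * Real.sqrt n := by
  have halg := falconPlus_isMeasurable (S := S) (A := A) N E.R
  have hN0 : 0 < N := (E.card_pos_of_support hI).trans_le hN
  have hA0 : 0 < Fintype.card A := Fintype.card_pos
  have hN' : (0 : ℝ) < N := by exact_mod_cast hN0
  have hA' : (0 : ℝ) < Fintype.card A := by exact_mod_cast hA0
  have hℓ : ∀ i, (0 : ℝ) < epochLen i := fun i => by exact_mod_cast epochLen_pos i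
  let γ : ℕ → ℝ := fun i => falconRate N (Fintype.card A) E.R (i + 1)
  have hγ : ∀ i, 0 ≤ γ i := fun i => falconRate_nonneg N (Fintype.card A) E.R (i + 1)
  have hγeq : ∀ i, γ (i + 1) = 1 / (2 * E.R * Real.sqrt (N / epochLen i)) :=
    falconRate_eq_inv hN0 hA0 hR
  have hγ0 : ∀ i, 0 < γ (i + 1) := fun i => by
    have := hℓ i
    rw [hγeq]
    positivity
  have hmono : ∀ i, γ (i + 1) ≤ γ (i + 2) := by
    intro i
    have h1 := hℓ i
    have h2 := hℓ (i + 1)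
    have h3 : (epochLen i : ℝ) ≤ epochLen (i + 1) := by exact_mod_cast epochLen_mono i
    rw [hγeq, show i + 2 = i + 1 + 1 from rfl, hγeq]
    gcongr
  have hround : ∀ t, ∫ x, E.regret (falconPlus N E.R t x) ∂(E.history (falconPlus N E.R) t) ≤
      206 * (E.R * Fintype.card A * Real.sqrt (N / 2 ^ Nat.log 2 t)) := by
    intro t
    have hslack := integral_epochSlack_le (E := E) hI hN hR (Nat.log 2 t) (t := t)
      (epoch_spec t).1
    have := E.isProbabilityMeasure_history halg t
    have hn := (nice_epochSlack (E := E) hγ t (Nat.log 2 t)).integrable halg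
    have hreg := (E.nice_regret halg t).integrable halg
    simp only [falconPlus_eq] at hreg ⊢
    generalize Nat.log 2 t = i at *
    rcases i with _ | i
    -- In the first epoch the slack is `R`, the trivial bound for the regret.
    · refine (integral_mono hreg hn fun x => E.regret_le _).trans (hslack.trans ?_)
      gcongr
      norm_num
    · have hn' : Integrable (fun x => 2 * (Fintype.card A / γ (i + 1)) +
          E.epochSlack γ hγ (falconEst x) (i + 1)) (E.history (falconPlus N E.R) t) :=
        (integrable_const _).add hn
      refine (integral_mono hreg hn' fun x =>
        E.regret_gapPolicy_le hγ hγ0 hmono (falconEst_zero x) i).trans ?_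
      rw [integral_add (integrable_const _) hn, Bandit.integral_history_const halg]
      have hv : Real.sqrt (N / epochLen i) ≤ Real.sqrt (N / 2 ^ i) := by
        refine Real.sqrt_le_sqrt (div_le_div_of_nonneg_left hN'.le (by positivity) ?_)
        exact_mod_cast two_pow_le_epochLen i
      have hRA : 0 < E.R * Fintype.card A := by positivity
      have h1 : 2 * (Fintype.card A / γ (i + 1)) =
          4 * (E.R * Fintype.card A * Real.sqrt (N / epochLen i)) := by
        have := hℓ i
        rw [hγeq]
        field_simp
        norm_num
      have hW := mul_le_mul_of_nonneg_left hv hRA.le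
      have hW' := mul_le_mul_of_nonneg_left (sqrt_div_two_pow_le N hN'.le i) hRA.le
      rw [h1]
      linarith
  -- Doubling epochs make the bound comparable to `√(N / (t + 1))`, since `t + 1 ≤ 2 ^ (log₂ t +
  -- 1)`.
  have hsqrt : ∀ t : ℕ, Real.sqrt (N / 2 ^ Nat.log 2 t) ≤
      3 / 2 * (Real.sqrt N * (1 / Real.sqrt (t + 1))) := by
    intro t
    refine (sqrt_div_two_pow_le N hN'.le _).trans ?_
    rw [mul_one_div, ← Real.sqrt_div hN'.le]
    gcongr
    exact_mod_cast Nat.lt_pow_succ_log_self one_lt_two t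
  have hRA : 0 ≤ E.R * Fintype.card A := by positivity
  calc ∑ t ∈ Finset.range n, ∫ x, E.regret (falconPlus N E.R t x)
        ∂(E.history (falconPlus N E.R) t)
      ≤ ∑ t ∈ Finset.range n, 309 * (E.R * Fintype.card A * Real.sqrt N) *
          (1 / Real.sqrt ((t : ℝ) + 1)) := by
        refine Finset.sum_le_sum fun t _ => (hround t).trans ?_
        have := mul_le_mul_of_nonneg_left (hsqrt t) hRA
        linarith
    _ ≤ 309 * (E.R * Fintype.card A * Real.sqrt N) * (2 * Real.sqrt n) := by
        rw [← Finset.mul_sum]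
        exact mul_le_mul_of_nonneg_left (sum_one_div_sqrt_le n) (by positivity)
    _ ≤ _ := by
        have : 0 ≤ E.R * Fintype.card A * Real.sqrt N * Real.sqrt n := by positivity
        linarith

end FalconRegret

/-! ### Measurable dependence on the policy -/

section PolicyMeasurability

variable {S A : Type*} [Fintype A]

theorem measurable_simplex {α : Type*} [MeasurableSpace α] {f : α → stdSimplex ℝ A}
    (hf : ∀ a, Measurable fun x => f x a) : Measurable f :=
  (measurable_pi_lambda _ hf).subtype_mk (h := fun x => (f x).2)

theorem measurable_policy {α : Type*} [MeasurableSpace α] {f : α → Policy S A}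
    (hf : ∀ h s a, Measurable fun x => f x h s a) : Measurable f :=
  measurable_pi_lambda _ fun h => measurable_pi_lambda _ fun s => measurable_simplex (hf h s)

theorem averagePolicy_apply {n : ℕ} (hn : 0 < n) (alg : CBAlgorithm S A)
    (x : Fin n → S × A × ℝ) (fallback : S → stdSimplex ℝ A) (s : S) (a : A) :
    averagePolicy alg n x fallback s a =
      (∑ t : Fin n, alg t (fun i => x (Fin.castLE t.is_lt.le i)) s a) / n := by
  rw [averagePolicy, dif_pos hn]
  rfl

theorem measurable_update_averagePolicy [MeasurableSpace S] [MeasurableSpace A]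
    {alg : CBAlgorithm S A} {n : ℕ} (hn : 0 < n) (halg : alg.IsMeasurable) (h : ℕ) :
    Measurable (Function.uncurry fun (π : Policy S A) (x : Fin n → S × A × ℝ) =>
      Function.update π h (averagePolicy alg n x (π h))) := by
  refine measurable_policy fun l s a => ?_
  by_cases hl : l = h
  · subst hl
    simp only [Function.uncurry, Function.update_self, averagePolicy_apply hn]
    refine (Finset.measurable_sum _ fun t _ => ?_).div_const _
    exact (halg t s a).comp (f := fun z : Policy S A × (Fin n → S × A × ℝ) =>
      fun i => z.2 (Fin.castLE t.is_lt.le i)) (by fun_prop)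
  · simp only [Function.uncurry, Function.update_of_ne hl]
    exact (measurable_policy_apply l s a).comp measurable_fst

theorem measurable_update_averagePolicy_right [MeasurableSpace S] [MeasurableSpace A]
    {alg : CBAlgorithm S A} {n : ℕ} (hn : 0 < n) (halg : alg.IsMeasurable)
    (h : ℕ) (π : Policy S A) : Measurable fun x : Fin n → S × A × ℝ =>
      Function.update π h (averagePolicy alg n x (π h)) :=
  (measurable_update_averagePolicy hn halg h).comp (measurable_prodMk_left (x := π))

variable [Fintype S]

theorem MDP.measurable_occupancy (M : MDP S A) (h : ℕ) (s : S) :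
    Measurable fun π : Policy S A => M.occupancy π h s := by
  induction h generalizing s with
  | zero => exact measurable_const
  | succ h ih =>
    exact Finset.measurable_sum _ fun s _ => Finset.measurable_sum _ fun a _ =>
      ((ih s).mul (measurable_policy_apply h s a)).mul_const _

theorem MDP.measurable_valueToGo (M : MDP S A) (k h : ℕ) (s : S) :
    Measurable fun π : Policy S A => M.valueToGo π k h s := by
  induction k generalizing h s with
  | zero => exact measurable_const
  | succ k ih =>
    exact Finset.measurable_sum _ fun a _ => (measurable_policy_apply h s a).mul
      (measurable_const.add (Finset.measurable_sum _ fun s' _ => (ih (h + 1) s').const_mul _))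

theorem MDP.measurable_initValue (M : MDP S A) (H : ℕ) :
    Measurable fun π : Policy S A => M.initValue H π :=
  Finset.measurable_sum _ fun s _ => (M.measurable_valueToGo _ _ s).const_mul _

theorem measurable_conv_const {α : Type*} [MeasurableSpace α] (μ : Measure ℝ)
    [IsProbabilityMeasure μ] {ν : α → Measure ℝ} (hν : Measurable ν)
    [h1 : ∀ x, IsProbabilityMeasure (ν x)] : Measurable fun x => μ ∗ ν x := by
  let κ : Kernel α ℝ := ⟨ν, hν⟩
  have : IsMarkovKernel κ := ⟨h1⟩
  have h2 : ∀ x, μ ∗ ν x = ((Kernel.const α μ ×ₖ κ) x).map fun z : ℝ × ℝ => z.1 + z.2 := by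
    intro x
    rw [Kernel.prod_apply]
    rfl
  simp_rw [h2]
  exact (Measure.measurable_map _ (by fun_prop)).comp (Kernel.measurable _)

/-- The policy left by one iteration is random and enters the reward laws of the next, so
compositions of iterations require these laws to be measurable in the policy. -/
theorem MDP.measurable_returnLaw (M : MDP S A) (k h : ℕ) (s : S) :
    Measurable fun π : Policy S A => M.returnLaw π k h s := by
  induction k generalizing h s with
  | zero => exact measurable_const
  | succ k ih =>
    exact measurable_finset_sum_smul_measure _ (fun a => measurable_policy_apply h s a) fun a =>
      measurable_conv_const _
        (ν := fun π : Policy S A => mix (M.trans h s a) fun s' => M.returnLaw π k (h + 1) s')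
        (measurable_finset_sum_smul_measure _ (fun _ => measurable_const) fun s' => ih (h + 1) s')

theorem MDP.measurable_actionReturnLaw (M : MDP S A) (k h : ℕ) (s : S) (a : A) :
    Measurable fun π : Policy S A => M.actionReturnLaw π k h s a :=
  measurable_conv_const _
    (ν := fun π : Policy S A => mix (M.trans h s a) fun s' => M.returnLaw π k (h + 1) s')
    (measurable_finset_sum_smul_measure _ (fun _ => measurable_const) fun s' =>
      M.measurable_returnLaw k (h + 1) s')

theorem MDP.valueToGo_mem (M : MDP S A) (π : Policy S A) (k h : ℕ) (s : S) :
    M.valueToGo π k h s ∈ Set.Icc (0 : ℝ) k := by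
  have h1 := M.returnLaw_ae_mem π k h s
  rw [← M.integral_returnLaw]
  refine ⟨integral_nonneg_of_ae (h1.mono fun r hr => hr.1), ?_⟩
  have := integral_mono_ae (integrable_of_ae_mem_Icc h1) (integrable_const (k : ℝ))
    (h1.mono fun r hr => hr.2)
  simpa using this

theorem MDP.initValue_mem (M : MDP S A) (H : ℕ) (π : Policy S A) :
    M.initValue H π ∈ Set.Icc (0 : ℝ) H := by
  refine ⟨Finset.sum_nonneg fun s _ => mul_nonneg (stdSimplex.zero_le _ _)
    (M.valueToGo_mem π _ _ s).1, ?_⟩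
  calc M.initValue H π ≤ ∑ s, M.init s * (H : ℝ) := Finset.sum_le_sum fun s _ =>
        mul_le_mul_of_nonneg_left (M.valueToGo_mem π _ _ s).2 (stdSimplex.zero_le _ _)
    _ = H := by rw [← Finset.sum_mul, stdSimplex.sum_eq_one, one_mul]

end PolicyMeasurability

/-! ### Performance difference -/

section PerformanceDifference

variable {S A : Type*} [Fintype S] [Fintype A] [Nonempty A]

/-- Loss in state `s` at step `h` for playing `π` instead of a greedy action, when `k` further steps
remain and `π` is followed in them. -/
def MDP.gap (M : MDP S A) (π : Policy S A) (k h : ℕ) (s : S) : ℝ :=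
  M.actionValue π k h s (greedy (M.actionValue π k h s)) - ∑ a, π h s a * M.actionValue π k h s a

theorem simplex_sum_mul_le_greedy (p : stdSimplex ℝ A) (f : A → ℝ) :
    ∑ a, p a * f a ≤ f (greedy f) :=
  calc ∑ a, p a * f a ≤ ∑ a, p a * f (greedy f) := Finset.sum_le_sum fun a _ =>
        mul_le_mul_of_nonneg_left (le_greedy f a) (stdSimplex.zero_le _ _)
    _ = f (greedy f) := by rw [← Finset.sum_mul, stdSimplex.sum_eq_one, one_mul]

theorem MDP.gap_nonneg (M : MDP S A) (π : Policy S A) (k h : ℕ) (s : S) : 0 ≤ M.gap π k h s :=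
  sub_nonneg.2 (simplex_sum_mul_le_greedy _ _)

/-- Inserting the action value of `π` averaged over the actions of `π'` splits off the difference at
later states. The rest is at most the gap, since no action distribution beats the greedy action. -/
theorem MDP.valueToGo_sub_le (M : MDP S A) (π' π : Policy S A) (k h : ℕ) (s : S) :
    M.valueToGo π' (k + 1) h s - M.valueToGo π (k + 1) h s ≤
      ∑ a, π' h s a * ∑ s', M.trans h s a s' *
        (M.valueToGo π' k (h + 1) s' - M.valueToGo π k (h + 1) s') + M.gap π k h s := by
  have h1 : ∀ a, ∑ s', M.trans h s a s' *
      (M.valueToGo π' k (h + 1) s' - M.valueToGo π k (h + 1) s') =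
      M.actionValue π' k h s a - M.actionValue π k h s a := by
    intro a
    simp only [MDP.actionValue, mul_sub, Finset.sum_sub_distrib]
    ring
  have h2 := simplex_sum_mul_le_greedy (π' h s) (M.actionValue π k h s)
  simp only [h1]
  simp only [mul_sub, Finset.sum_sub_distrib, MDP.gap, MDP.valueToGo_succ]
  linarith

/-- Sum over the steps `h, …, H - 1` of the expected gaps of `π` under the state occupancies of
`πg`. -/
def MDP.totalGap (M : MDP S A) (H : ℕ) (πg π : Policy S A) (h : ℕ) : ℝ :=
  ∑ l ∈ Finset.Ico h H, ∑ s, M.occupancy πg l s * M.gap π (H - 1 - l) l s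

theorem MDP.sum_occupancy_mul_valueToGo_sub_le (M : MDP S A) {H : ℕ} {C : ℝ}
    {π' πg : Policy S A} (hC : ∀ h < H, ∀ s, M.occupancy π' h s ≤ C * M.occupancy πg h s)
    (π : Policy S A) (k h : ℕ) (hk : h + k = H) :
    ∑ s, M.occupancy π' h s * (M.valueToGo π' k h s - M.valueToGo π k h s) ≤
      C * M.totalGap H πg π h := by
  induction k generalizing h with
  | zero => simp [MDP.valueToGo, MDP.totalGap, ← hk]
  | succ k ih =>
    have hH : H - 1 - h = k := by omega
    rw [MDP.totalGap, Finset.sum_eq_sum_Ico_succ_bot (by omega), mul_add, hH]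
    have h1 := ih (h + 1) (by omega)
    rw [M.sum_occupancy_succ_mul] at h1
    have h2 : ∑ s, M.occupancy π' h s * M.gap π k h s ≤
        C * ∑ s, M.occupancy πg h s * M.gap π k h s := by
      rw [Finset.mul_sum]
      refine Finset.sum_le_sum fun s _ => ?_
      rw [← mul_assoc]
      exact mul_le_mul_of_nonneg_right (hC h (by omega) s) (M.gap_nonneg π k h s)
    have h3 : ∑ s, M.occupancy π' h s *
        (M.valueToGo π' (k + 1) h s - M.valueToGo π (k + 1) h s) ≤ ∑ s, M.occupancy π' h s *
        (∑ a, π' h s a * ∑ s', M.trans h s a s' *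
          (M.valueToGo π' k (h + 1) s' - M.valueToGo π k (h + 1) s') + M.gap π k h s) :=
      Finset.sum_le_sum fun s _ =>
        mul_le_mul_of_nonneg_left (M.valueToGo_sub_le π' π k h s) (M.occupancy_nonneg π' h s)
    simp only [mul_add, Finset.sum_add_distrib] at h3
    unfold MDP.totalGap at h1
    linarith

theorem MDP.initValue_sub_le (M : MDP S A) {H : ℕ} {C : ℝ} {π' πg : Policy S A}
    (hC : ∀ h < H, ∀ s, M.occupancy π' h s ≤ C * M.occupancy πg h s) (π : Policy S A) :
    M.initValue H π' - M.initValue H π ≤ C * M.totalGap H πg π 0 := by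
  refine le_trans (le_of_eq ?_)
    (M.sum_occupancy_mul_valueToGo_sub_le hC π H 0 (Nat.zero_add H))
  simp [MDP.initValue, MDP.value, MDP.occupancy, mul_sub]

end PerformanceDifference

/-! ### One iteration of JSRL as a contextual bandit -/

section Iteration

variable {S A : Type*} [Fintype S] [Fintype A]

/-- The contextual bandit that the oracle faces at iteration `h` of JSRL. -/
def MDP.bandit (M : MDP S A) {H : ℕ} (h : Fin H) (π : Policy S A) : Bandit S A where
  d := M.occupancy π h
  d_nonneg := M.occupancy_nonneg π h
  d_sum := M.sum_occupancy π h
  ρ := M.actionReturnLaw π (H - 1 - h) h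
  isProbabilityMeasure_ρ := fun _ _ => inferInstance
  R := (H : ℝ) - (h : ℕ)
  R_nonneg := sub_nonneg.2 (by exact_mod_cast h.2.le)
  ρ_mem_Icc := fun s a => by
    have h1 := M.actionReturnLaw_ae_mem π (H - 1 - h) h s a
    have h2 : ((H - 1 - (h : ℕ) : ℕ) : ℝ) + 1 = (H : ℝ) - (h : ℕ) := by
      rw [eq_sub_iff_add_eq]
      exact_mod_cast (by omega : H - 1 - (h : ℕ) + 1 + h = H)
    rwa [h2] at h1

theorem MDP.bandit_mean (M : MDP S A) {H : ℕ} (h : Fin H) (π : Policy S A) (s : S) :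
    (M.bandit h π).mean s = M.actionValue π (H - 1 - h) h s :=
  funext fun a => M.integral_actionReturnLaw π _ _ s a

/-- Action values from step `h` on look only at strictly later components, so the gaps already
obtained are unchanged and the new one is the bandit regret. -/
theorem MDP.totalGap_update [Nonempty A] (M : MDP S A) {H : ℕ} (h : Fin H) {πg π : Policy S A}
    (hπ : ∀ l < (h : ℕ), π l = πg l) (p : S → stdSimplex ℝ A) :
    M.totalGap H πg (Function.update π h p) h =
      M.totalGap H πg π (h + 1) + (M.bandit h π).regret p := by
  have hval : ∀ l, (h : ℕ) ≤ l → ∀ k s,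
      M.actionValue (Function.update π h p) k l s = M.actionValue π k l s := fun l hl k s =>
    funext fun a => M.actionValue_congr k l (fun m hm =>
      Function.update_of_ne (by omega) _ _) s a
  rw [MDP.totalGap, Finset.sum_eq_sum_Ico_succ_bot h.2, add_comm, MDP.totalGap]
  congr 1
  · refine Finset.sum_congr rfl fun l hl => Finset.sum_congr rfl fun s _ => ?_
    have hl' := (Finset.mem_Ico.1 hl).1
    rw [MDP.gap, MDP.gap, hval l (by omega), Function.update_of_ne (by omega)]
  · refine Finset.sum_congr rfl fun s _ => ?_
    rw [MDP.gap, hval h le_rfl, Function.update_self, M.bandit_mean,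
      M.occupancy_congr h fun l hl => (hπ l hl).symm]
    rfl

variable [MeasurableSpace S] [MeasurableSpace A] {alg : CBAlgorithm S A}

theorem MDP.cbHistory_eq (M : MDP S A) {H : ℕ} (alg : CBAlgorithm S A) (h : Fin H)
    (π : Policy S A) (t : ℕ) : M.cbHistory alg h π t = (M.bandit h π).history alg t := by
  induction t with
  | zero => rfl
  | succ t ih =>
    rw [MDP.cbHistory, Bandit.history, ih]
    simp only [M.map_cbSample_rollout]
    rfl

theorem MDP.isProbabilityMeasure_cbHistory (M : MDP S A) {H : ℕ} (halg : alg.IsMeasurable)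
    (h : Fin H) (π : Policy S A) (t : ℕ) : IsProbabilityMeasure (M.cbHistory alg h π t) := by
  rw [M.cbHistory_eq]
  exact (M.bandit h π).isProbabilityMeasure_history halg t

theorem MDP.measurable_cbHistory (M : MDP S A) {H : ℕ} (halg : alg.IsMeasurable) (h : Fin H)
    (t : ℕ) : Measurable fun π : Policy S A => M.cbHistory alg h π t := by
  induction t with
  | zero => exact measurable_const
  | succ t ih =>
    have := fun π : Policy S A => M.isProbabilityMeasure_cbHistory halg h π t
    refine measurable_bind_family ih (g := fun π x =>
      ((M.rollout H (Function.update π h (alg t x))).map (cbSample h)).map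
        (Fin.snoc (α := fun _ => S × A × ℝ) x)) ?_
    simp only [M.map_cbSample_rollout]
    have hprob : ∀ z : Policy S A × (Fin t → S × A × ℝ), IsProbabilityMeasure
        (sampleLaw (M.occupancy z.1 h) (M.actionReturnLaw z.1 (H - 1 - h) h) (alg t z.2)) :=
      fun z => Bandit.isProbabilityMeasure_sampleLaw (M.bandit h z.1) (alg t z.2)
    refine measurable_map_family (μ := fun z : Policy S A × (Fin t → S × A × ℝ) =>
      sampleLaw (M.occupancy z.1 h) (M.actionReturnLaw z.1 (H - 1 - h) h) (alg t z.2))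
      (f := fun z y => Fin.snoc (α := fun _ => S × A × ℝ) z.2 y)
      (Bandit.measurable_sampleLaw (fun s => (M.measurable_occupancy _ s).comp measurable_fst)
        (fun s a => (M.measurable_actionReturnLaw _ _ s a).comp measurable_fst)
        fun s a => (halg t s a).comp measurable_snd) ?_
    exact (measurable_finSnoc t).comp
      (f := fun w : (Policy S A × (Fin t → S × A × ℝ)) × (S × A × ℝ) => (w.1.2, w.2))
      (by fun_prop)

theorem MDP.measurable_jsrlIteration (M : MDP S A) {H n : ℕ} (hn : 0 < n)
    (halg : alg.IsMeasurable) (h : Fin H) :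
    Measurable fun π : Policy S A => M.jsrlIteration alg n h π := by
  have := fun π : Policy S A => M.isProbabilityMeasure_cbHistory halg h π n
  exact measurable_map_family (M.measurable_cbHistory halg h n)
    (f := fun π x => Function.update π h (averagePolicy alg n x (π h)))
    (measurable_update_averagePolicy hn halg h)

theorem MDP.isProbabilityMeasure_jsrlIteration (M : MDP S A) {H n : ℕ} (hn : 0 < n)
    (halg : alg.IsMeasurable) (h : Fin H) (π : Policy S A) :
    IsProbabilityMeasure (M.jsrlIteration alg n h π) := by
  have := M.isProbabilityMeasure_cbHistory halg h π n
  exact Measure.isProbabilityMeasure_map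
    (measurable_update_averagePolicy_right hn halg h π).aemeasurable

/-- A joint induction, since the total mass of a composition is computed from the measurability of
the inner kernel. -/
theorem MDP.measurable_jsrlFrom_and (M : MDP S A) {H n : ℕ} (hn : 0 < n)
    {oracle : ℝ → CBAlgorithm S A} (horacle : ∀ R, (oracle R).IsMeasurable) (h : ℕ)
    (hh : h ≤ H) : Measurable (M.jsrlFrom H oracle n h hh) ∧
      ∀ π, IsProbabilityMeasure (M.jsrlFrom H oracle n h hh π) := by
  induction h with
  | zero => exact ⟨Measure.measurable_dirac, fun π => inferInstanceAs
      (IsProbabilityMeasure (Measure.dirac π))⟩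
  | succ h ih =>
    obtain ⟨h1, h2⟩ := ih (Nat.le_of_succ_le hh)
    have h3 := fun π => M.isProbabilityMeasure_jsrlIteration hn (horacle ((H : ℝ) - h))
      (⟨h, hh⟩ : Fin H) π
    refine ⟨?_, fun π => isProbabilityMeasure_bind h1 h2⟩
    exact measurable_bind_family (M.measurable_jsrlIteration hn (horacle ((H : ℝ) - h))
      (⟨h, hh⟩ : Fin H)) (g := fun _ => M.jsrlFrom H oracle n h (Nat.le_of_succ_le hh))
      (h1.comp measurable_snd)

theorem MDP.measurable_jsrlFrom (M : MDP S A) {H n : ℕ} (hn : 0 < n)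
    {oracle : ℝ → CBAlgorithm S A} (horacle : ∀ R, (oracle R).IsMeasurable) (h : ℕ)
    (hh : h ≤ H) : Measurable (M.jsrlFrom H oracle n h hh) :=
  (M.measurable_jsrlFrom_and hn horacle h hh).1

theorem MDP.isProbabilityMeasure_jsrlFrom (M : MDP S A) {H n : ℕ} (hn : 0 < n)
    {oracle : ℝ → CBAlgorithm S A} (horacle : ∀ R, (oracle R).IsMeasurable) (h : ℕ)
    (hh : h ≤ H) (π : Policy S A) : IsProbabilityMeasure (M.jsrlFrom H oracle n h hh π) :=
  (M.measurable_jsrlFrom_and hn horacle h hh).2 π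

end Iteration

/-! ### Regret of the averaged policy -/

section Marginal

variable {S A : Type*} [Fintype S] [Fintype A] {E : Bandit S A} [MeasurableSpace S]
  [MeasurableSpace A] {alg : CBAlgorithm S A}

namespace Bandit

theorem integral_history_castLE (halg : alg.IsMeasurable) {t n : ℕ} (ht : t ≤ n)
    {F : (Fin t → S × A × ℝ) → ℝ} (hF : E.Nice F) :
    ∫ x, F (fun i => x (Fin.castLE ht i)) ∂(E.history alg n) = ∫ x, F x ∂(E.history alg t) := by
  obtain ⟨j, rfl⟩ := Nat.exists_eq_add_of_le ht
  exact integral_history_castAdd halg hF j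

theorem nice_regret_castLE [Nonempty A] (halg : alg.IsMeasurable) {n : ℕ} (t : Fin n) :
    E.Nice fun x : Fin n → S × A × ℝ =>
      E.regret (alg t fun i => x (Fin.castLE t.is_lt.le i)) :=
  (nice_regret halg t).comp_good _

end Bandit

end Marginal

section Average

variable {S A : Type*} [Fintype S] [Fintype A] [Nonempty A] (E : Bandit S A)

namespace Bandit

/-- Regret is affine in the policy: the online-to-batch conversion holds with equality. -/
theorem regret_averagePolicy {n : ℕ} (hn : 0 < n) (alg : CBAlgorithm S A)
    (x : Fin n → S × A × ℝ) (fallback : S → stdSimplex ℝ A) :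
    E.regret (averagePolicy alg n x fallback) =
      (∑ t : Fin n, E.regret (alg t fun i => x (Fin.castLE t.is_lt.le i))) / n := by
  have hn' : (n : ℝ) ≠ 0 := by exact_mod_cast hn.ne'
  simp only [regret]
  rw [Finset.sum_comm, Finset.sum_div]
  refine Finset.sum_congr rfl fun s _ => ?_
  rw [← Finset.mul_sum, mul_div_assoc, Finset.sum_sub_distrib, Finset.sum_const,
    Finset.card_univ, Fintype.card_fin, nsmul_eq_mul, sub_div, mul_div_cancel_left₀ _ hn',
    Finset.sum_comm, Finset.sum_div]
  congr 2
  refine Finset.sum_congr rfl fun a _ => ?_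
  rw [averagePolicy_apply hn, ← Finset.sum_mul]
  ring

variable {E} [MeasurableSpace S] [MeasurableSpace A] {alg : CBAlgorithm S A}

theorem nice_regret_averagePolicy {n : ℕ} (hn : 0 < n) (halg : alg.IsMeasurable)
    (fallback : S → stdSimplex ℝ A) :
    E.Nice fun x => E.regret (averagePolicy alg n x fallback) := by
  simp only [E.regret_averagePolicy hn, div_eq_inv_mul]
  exact (Nice.sum _ fun t => nice_regret_castLE halg t).const_mul _

theorem integral_regret_averagePolicy {n : ℕ} (hn : 0 < n) (halg : alg.IsMeasurable)
    (fallback : S → stdSimplex ℝ A) :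
    ∫ x, E.regret (averagePolicy alg n x fallback) ∂(E.history alg n) =
      (∑ t ∈ Finset.range n, ∫ x, E.regret (alg t x) ∂(E.history alg t)) / n := by
  simp only [E.regret_averagePolicy hn]
  rw [integral_div, integral_finsetSum _ fun t _ =>
    (nice_regret_castLE halg t).integrable halg, Finset.sum_range]
  congr 1
  exact Finset.sum_congr rfl fun t _ =>
    integral_history_castLE halg t.is_lt.le (nice_regret halg t)

end Bandit

end Average

/-! ### Suboptimality of JSRL -/

section BindBound

variable {α β : Type*} [MeasurableSpace α] [MeasurableSpace β]

theorem integrable_integral_of_bounded {μ : Measure α} [IsFiniteMeasure μ] {κ : α → Measure β}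
    (hκ : Measurable κ) (h1 : ∀ a, IsProbabilityMeasure (κ a)) {F : β → ℝ} (hF : Measurable F)
    {B : ℝ} (hB : ∀ b, |F b| ≤ B) : Integrable (fun a => ∫ b, F b ∂(κ a)) μ := by
  let η : Kernel α β := ⟨κ, hκ⟩
  have : IsMarkovKernel η := ⟨h1⟩
  refine Integrable.of_bound
    (hF.stronglyMeasurable.integral_kernel (κ := η)).aestronglyMeasurable B
    (Filter.Eventually.of_forall fun a => ?_)
  have := norm_integral_le_of_norm_le_const (μ := κ a) (C := B) (f := F)
    (Filter.Eventually.of_forall hB)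
  simpa using this

end BindBound

section InitValue

variable {S A : Type*} [Fintype S] [Fintype A]

theorem MDP.abs_initValue_sub_le (M : MDP S A) (H : ℕ) (π π' : Policy S A) :
    |M.initValue H π - M.initValue H π'| ≤ H := by
  have h1 := M.initValue_mem H π
  have h2 := M.initValue_mem H π'
  rw [abs_le]
  constructor <;> linarith [h1.1, h1.2, h2.1, h2.2]

theorem MDP.measurable_initValue_sub (M : MDP S A) (H : ℕ) (πstar : Policy S A) :
    Measurable fun π : Policy S A => M.initValue H πstar - M.initValue H π :=
  (M.measurable_initValue H).const_sub _

theorem MDP.integrable_initValue_sub (M : MDP S A) (H : ℕ) (πstar : Policy S A)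
    (μ : Measure (Policy S A)) [IsFiniteMeasure μ] :
    Integrable (fun π => M.initValue H πstar - M.initValue H π) μ :=
  Integrable.of_bound (M.measurable_initValue_sub H πstar).aestronglyMeasurable H
    (Filter.Eventually.of_forall fun π => M.abs_initValue_sub_le H πstar π)

/-- Summing over the states at step `0`, both occupancies having total mass one, even gives `1 ≤ C`.
-/
theorem MDP.concentrability_nonneg {M : MDP S A} {H : ℕ} {C : ℝ} {πg πstar : Policy S A}
    (hH : 0 < H) (hC : ∀ h < H, ∀ s, M.occupancy πstar h s ≤ C * M.occupancy πg h s) :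
    0 ≤ C := by
  have h1 := Finset.sum_le_sum fun s (_ : s ∈ Finset.univ) => hC 0 hH s
  rw [← Finset.mul_sum, M.sum_occupancy, M.sum_occupancy] at h1
  linarith

end InitValue

/-! ### Backward recursion over the iterations. -/

section Recursion

variable {S A : Type*} [Fintype S] [Fintype A] [Nonempty A] [MeasurableSpace S]
  [MeasurableSpace A]

/-- The oracle has average expected regret at most `R * b` over `n` rounds, for rewards in `[0, R]`
and at most `N` contexts. -/
def RegretBound (oracle : ℝ → CBAlgorithm S A) (N n : ℕ) (b : ℝ) : Prop :=
  ∀ (E : Bandit S A) (I : Finset S), (∀ s ∉ I, E.d s = 0) → I.card ≤ N → 0 < E.R →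
    ∑ t ∈ Finset.range n, ∫ x, E.regret (oracle E.R t x) ∂(E.history (oracle E.R) t) ≤
      n * E.R * b

variable {M : MDP S A} {H N n : ℕ} {oracle : ℝ → CBAlgorithm S A} {b C : ℝ}
  {πg πstar : Policy S A}

/-- The contexts have the guide's occupancy, because the earlier steps still follow it. Their
support thus has at most `N` elements, and the range `H - h` is at most `H`. -/
theorem MDP.integral_regret_averagePolicy_le (hn : 0 < n)
    (horacle : ∀ R, (oracle R).IsMeasurable) (hreg : RegretBound oracle N n b) (hb : 0 ≤ b)
    (hN : M.maxVisited H πg ≤ N) {h : Fin H} {π : Policy S A} (hπ : ∀ l < (h : ℕ), π l = πg l) :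
    ∫ x, (M.bandit h π).regret (averagePolicy (oracle ((H : ℝ) - (h : ℕ))) n x (π h))
      ∂((M.bandit h π).history (oracle ((H : ℝ) - (h : ℕ))) n) ≤ H * b := by
  classical
  have hn' : (0 : ℝ) < n := by exact_mod_cast hn
  have hR : (0 : ℝ) < (H : ℝ) - (h : ℕ) := sub_pos.2 (by exact_mod_cast h.2)
  have hRH : (H : ℝ) - (h : ℕ) ≤ H := sub_le_self _ (Nat.cast_nonneg _)
  rw [Bandit.integral_regret_averagePolicy hn (horacle _), div_le_iff₀ hn']
  let I : Finset S := Finset.univ.filter fun s => 0 < M.occupancy πg h s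
  have hI : I.card ≤ N := by
    refine le_trans ?_ hN
    have := Finset.le_sup (f := fun h => (Finset.univ.filter fun s =>
      0 < M.occupancy πg h s).card) (Finset.mem_range.2 h.2)
    unfold MDP.maxVisited
    convert this
  refine (hreg (M.bandit h π) I (fun s hs => ?_) hI hR).trans ?_
  · have h1 : ¬ 0 < M.occupancy πg h s := by simpa [I] using hs
    change M.occupancy π h s = 0
    rw [M.occupancy_congr h hπ]
    exact le_antisymm (not_lt.1 h1) (M.occupancy_nonneg πg h s)
  · change n * ((H : ℝ) - (h : ℕ)) * b ≤ _
    rw [mul_assoc, mul_comm (n : ℝ)]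
    gcongr

/-- The invariant before the remaining `h` iterations: the gaps of the finished steps are kept, and
each remaining step adds at most `H b` in the mean. -/
theorem MDP.integral_jsrlFrom_le (hn : 0 < n) (horacle : ∀ R, (oracle R).IsMeasurable)
    (hreg : RegretBound oracle N n b) (hb : 0 ≤ b) (hN : M.maxVisited H πg ≤ N) (hC0 : 0 ≤ C)
    (hC : ∀ h < H, ∀ s, M.occupancy πstar h s ≤ C * M.occupancy πg h s) (h : ℕ) (hh : h ≤ H)
    (π : Policy S A) (hπ : ∀ l < h, π l = πg l) :
    ∫ π', (M.initValue H πstar - M.initValue H π') ∂(M.jsrlFrom H oracle n h hh π) ≤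
      C * (M.totalGap H πg π h + h * (H * b)) := by
  induction h generalizing π with
  | zero =>
    rw [MDP.jsrlFrom, integral_dirac' _ _ (M.measurable_initValue_sub H πstar).stronglyMeasurable]
    simpa using M.initValue_sub_le hC π
  | succ h ih =>
    let i : Fin H := ⟨h, hh⟩
    have halg := horacle ((H : ℝ) - h)
    have hκ := M.measurable_jsrlFrom hn horacle h (Nat.le_of_succ_le hh)
    have hκ1 := M.isProbabilityMeasure_jsrlFrom hn horacle h (Nat.le_of_succ_le hh)
    have hP := M.isProbabilityMeasure_jsrlFrom hn horacle (h + 1) hh π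
    have hI := M.isProbabilityMeasure_jsrlIteration hn halg i π
    have hF := M.measurable_initValue_sub H πstar
    have hupd := measurable_update_averagePolicy_right (alg := oracle ((H : ℝ) - h)) hn halg h π
    have hint := integrable_integral_of_bounded (μ := M.jsrlIteration (oracle ((H : ℝ) - h)) n i π)
      hκ hκ1 hF fun π' => M.abs_initValue_sub_le H πstar π'
    have hprob := M.isProbabilityMeasure_cbHistory halg i π n
    have hF1 := M.integrable_initValue_sub H πstar (M.jsrlFrom H oracle n (h + 1) hh π)
    rw [MDP.jsrlFrom] at hF1 ⊢
    rw [integral_bind_family hκ hκ1 hF1]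
    rw [MDP.jsrlIteration] at hint ⊢
    rw [integral_map hupd.aemeasurable hint.1]
    have hint' := hint.comp_measurable hupd
    rw [M.cbHistory_eq] at hint' hprob ⊢
    have hnice := (Bandit.nice_regret_averagePolicy (E := M.bandit i π) hn halg (π h)).integrable
      halg
    have hle : ∀ x, ∫ π', (M.initValue H πstar - M.initValue H π') ∂(M.jsrlFrom H oracle n h
        (Nat.le_of_succ_le hh)
        (Function.update π h (averagePolicy (oracle ((H : ℝ) - h)) n x (π h)))) ≤
        C * (M.totalGap H πg π (h + 1) + h * (H * b)) + C * (M.bandit i π).regret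
          (averagePolicy (oracle ((H : ℝ) - h)) n x (π h)) := by
      intro x
      refine (ih (Nat.le_of_succ_le hh) _ fun l hl => ?_).trans (le_of_eq ?_)
      · rw [Function.update_of_ne hl.ne]
        exact hπ l (by omega)
      · have := M.totalGap_update i (πg := πg) (π := π) (fun l hl => hπ l (Nat.lt_succ_of_lt hl))
          (averagePolicy (oracle ((H : ℝ) - h)) n x (π h))
        rw [show h = (i : ℕ) from rfl, this]
        ring
    refine (integral_mono hint' ((integrable_const _).add (hnice.const_mul C)) hle).trans ?_
    have hfin : C * ∫ x, (M.bandit i π).regret (averagePolicy (oracle ((H : ℝ) - h)) n x (π h))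
        ∂((M.bandit i π).history (oracle ((H : ℝ) - h)) n) ≤ C * (H * b) := mul_le_mul_of_nonneg_left (MDP.integral_regret_averagePolicy_le hn horacle hreg hb
      hN (h := i) (π := π) fun l hl => hπ l (Nat.lt_succ_of_lt hl)) hC0
    have hsplit := integral_add (integrable_const (μ := (M.bandit i π).history
      (oracle ((H : ℝ) - h)) n) (C * (M.totalGap H πg π (h + 1) + h * (H * b))))
      (hnice.const_mul C)
    rw [Bandit.integral_history_const halg, integral_const_mul] at hsplit
    refine hsplit.le.trans ?_
    push_cast
    linarith

theorem MDP.suboptimalityLE_jsrl (hH : 0 < H) (hn : 0 < n)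
    (horacle : ∀ R, (oracle R).IsMeasurable) (hreg : RegretBound oracle N n b) (hb : 0 ≤ b)
    (hN : M.maxVisited H πg ≤ N)
    (hC : ∀ h < H, ∀ s, M.occupancy πstar h s ≤ C * M.occupancy πg h s) :
    M.SuboptimalityLE H πstar (M.jsrl H oracle n πg) (C * (H * (H * b))) := by
  have hC0 := MDP.concentrability_nonneg hH hC
  have hP := M.isProbabilityMeasure_jsrlFrom hn horacle H le_rfl πg
  refine ⟨hP, M.integrable_initValue_sub H πstar (M.jsrlFrom H oracle n H le_rfl πg), ?_⟩
  have := MDP.integral_jsrlFrom_le hn horacle hreg hb hN hC0 hC H le_rfl πg fun _ _ => rfl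
  simpa [MDP.totalGap, MDP.jsrl] using this

end Recursion

/-! ### From oracle regret to the stated rates. -/

section Rounds

theorem rounds_pos {T H : ℕ} (hT : 0 < T) (hH : 0 < H) : 0 < rounds T H :=
  Nat.ceil_pos.2 (by positivity)

theorem div_rounds_le {T H : ℕ} (hT : 0 < T) (hH : 0 < H) {c : ℝ} (hc : 0 ≤ c) :
    c / rounds T H ≤ c * H / T := by
  have h1 : (T : ℝ) / H ≤ rounds T H := Nat.le_ceil _
  have hT' : (0 : ℝ) < T := by exact_mod_cast hT
  have hH' : (0 : ℝ) < H := by exact_mod_cast hH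
  calc c / rounds T H ≤ c / (T / H) := by gcongr
    _ = c * H / T := by field_simp

end Rounds

section Oracles

variable {S A : Type*} [Fintype S] [Fintype A] [Nonempty A] [MeasurableSpace S]
  [DiscreteMeasurableSpace S] [MeasurableSpace A] [DiscreteMeasurableSpace A]

theorem epsGreedy_regretBound {N n : ℕ} (hn : 0 < n) :
    RegretBound (fun _ => (epsGreedy N n : CBAlgorithm S A)) N n
      (100 * ((N : ℝ) * Fintype.card A / n) ^ (1 / 3 : ℝ)) := fun _ _ hI hN hR =>
  (epsGreedy_regret hn hI hN hR).trans (le_of_eq (by ring))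

theorem falconPlus_regretBound {N n : ℕ} (hn : 0 < n) :
    RegretBound (fun R => (falconPlus N R : CBAlgorithm S A)) N n
      (620 * Fintype.card A * Real.sqrt (N / n)) := fun E _ hI hN hR => by
  have hn' : (0 : ℝ) < n := by exact_mod_cast hn
  refine (falconPlus_regret hI hN hR).trans (le_of_eq ?_)
  have h2 : 0 < Real.sqrt n := Real.sqrt_pos.2 hn'
  rw [Real.sqrt_div' _ hn'.le]
  field_simp
  rw [Real.sq_sqrt hn'.le]

end Oracles

theorem MDP.SuboptimalityLE.mono {S A : Type*} [Fintype S] [Fintype A] {M : MDP S A} {H : ℕ}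
    {πstar : Policy S A} {μ : Measure (Policy S A)} {b b' : ℝ}
    (h : M.SuboptimalityLE H πstar μ b) (hb : b ≤ b') : M.SuboptimalityLE H πstar μ b' :=
  ⟨h.1, h.2.1, h.2.2.trans hb⟩

end

end JSRL

theorem mainTheorem3 :
    ∃ K : ℝ, 0 < K ∧
      ∀ (S A : Type*) [Fintype S] [Fintype A] [Nonempty A]
        [MeasurableSpace S] [DiscreteMeasurableSpace S]
        [MeasurableSpace A] [DiscreteMeasurableSpace A]
        (M : JSRL.MDP S A) (H T N : ℕ) (C : ℝ) (πg πstar : JSRL.Policy S A),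
        0 < H → 0 < T →
        M.IsOptimal H πstar →
        (∀ h < H, ∀ s, M.occupancy πstar h s ≤ C * M.occupancy πg h s) →
        M.maxVisited H πg ≤ N →
        M.SuboptimalityLE H πstar
          (M.jsrl H (fun _ => JSRL.epsGreedy N (JSRL.rounds T H)) (JSRL.rounds T H) πg)
          (K * (C * (H : ℝ) ^ (7 / 3 : ℝ) * (N : ℝ) ^ (1 / 3 : ℝ) *
            (Fintype.card A : ℝ) ^ (1 / 3 : ℝ) / (T : ℝ) ^ (1 / 3 : ℝ))) ∧
        M.SuboptimalityLE H πstar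
          (M.jsrl H (fun R => JSRL.falconPlus N R) (JSRL.rounds T H) πg)
          (K * (C * (H : ℝ) ^ (5 / 2 : ℝ) * (N : ℝ) ^ (1 / 2 : ℝ) *
            (Fintype.card A : ℝ) / (T : ℝ) ^ (1 / 2 : ℝ))) := by
  -- The larger of the oracle constants `100` and `620`.
  refine ⟨620, by norm_num, ?_⟩
  intro S A _ _ _ _ _ _ _ M H T N C πg πstar hH hT _ hC hN
  have hn := JSRL.rounds_pos hT hH
  have hC0 := JSRL.MDP.concentrability_nonneg hH hC
  have hH' : (0 : ℝ) < H := by exact_mod_cast hH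
  have hT' : (0 : ℝ) < T := by exact_mod_cast hT
  have hNn : (0 : ℝ) ≤ N := Nat.cast_nonneg N
  refine ⟨(JSRL.MDP.suboptimalityLE_jsrl hH hn
      (fun _ => JSRL.epsGreedy_isMeasurable N (JSRL.rounds T H))
      (JSRL.epsGreedy_regretBound hn) (by positivity) hN hC).mono ?_,
    (JSRL.MDP.suboptimalityLE_jsrl hH hn (fun R => JSRL.falconPlus_isMeasurable N R)
      (JSRL.falconPlus_regretBound hn) (by positivity) hN hC).mono ?_⟩
  · have h1 : ((N : ℝ) * Fintype.card A / JSRL.rounds T H) ^ (1 / 3 : ℝ) ≤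
        (N : ℝ) ^ (1 / 3 : ℝ) * (Fintype.card A : ℝ) ^ (1 / 3 : ℝ) * (H : ℝ) ^ (1 / 3 : ℝ) /
          (T : ℝ) ^ (1 / 3 : ℝ) := by
      rw [← Real.mul_rpow hNn (by positivity), ← Real.mul_rpow (by positivity) hH'.le,
        ← Real.div_rpow (by positivity) hT'.le]
      exact Real.rpow_le_rpow (by positivity) (JSRL.div_rounds_le hT hH (by positivity))
        (by norm_num)
    -- One factor `H` counts the iterations, one is the reward range, and `H ^ (1/3)` comes from
    -- having about `T / H` rounds per iteration.
    have h2 : (H : ℝ) ^ (7 / 3 : ℝ) = H * H * (H : ℝ) ^ (1 / 3 : ℝ) := by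
      rw [show (7 / 3 : ℝ) = 1 + 1 + 1 / 3 by norm_num, Real.rpow_add hH', Real.rpow_add hH',
        Real.rpow_one]
    calc _ ≤ C * (H * (H * (620 * ((N : ℝ) ^ (1 / 3 : ℝ) * (Fintype.card A : ℝ) ^ (1 / 3 : ℝ) *
          (H : ℝ) ^ (1 / 3 : ℝ) / (T : ℝ) ^ (1 / 3 : ℝ))))) := by
          gcongr
          norm_num
      _ = _ := by rw [h2]; ring
  · have h1 : Real.sqrt (N / JSRL.rounds T H) ≤
        (N : ℝ) ^ (1 / 2 : ℝ) * (H : ℝ) ^ (1 / 2 : ℝ) / (T : ℝ) ^ (1 / 2 : ℝ) := by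
      rw [Real.sqrt_eq_rpow, ← Real.mul_rpow hNn hH'.le, ← Real.div_rpow (by positivity) hT'.le]
      exact Real.rpow_le_rpow (by positivity) (JSRL.div_rounds_le hT hH hNn) (by norm_num)
    have h2 : (H : ℝ) ^ (5 / 2 : ℝ) = H * H * (H : ℝ) ^ (1 / 2 : ℝ) := by
      rw [show (5 / 2 : ℝ) = 1 + 1 + 1 / 2 by norm_num, Real.rpow_add hH', Real.rpow_add hH',
        Real.rpow_one]
    calc _ ≤ C * (H * (H * (620 * Fintype.card A * ((N : ℝ) ^ (1 / 2 : ℝ) *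
          (H : ℝ) ^ (1 / 2 : ℝ) / (T : ℝ) ^ (1 / 2 : ℝ))))) := by gcongr
      _ = _ := by rw [h2]; ring
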